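/- **Setting.** $n$ threads share a sequentially consistent memory; each step of a thread is one atomic access to shared memory (up to merging accesses to data that no other thread can change at that time), the scheduler is arbitrary, and any thread may stop forever at any point. Retired nodes are handed over in batches. The nodes of a batch are linked cyclically by `BatchNext`, and every node points to the batch's counter node, which holds an $N$-bit unsigned counter `NRef` (arithmetic modulo $2^N$). There are $k$ slots. Slot $i$ has a head $[\mathrm{HRef},\mathrm{HPtr}]$, which is read and modified atomically, and which starts a list (linked by `Next`) of batches. With $\mathit{Adjs}=\lfloor (2^N-1)/k\rfloor+1$, the operations are as follows. * *Hyaline* ($k$ a power of two). `enter(slot)` atomically increments HRef and returns the old HPtr as the thread's handle; the double-width fetch-and-add is primitive or is emulated by a CAS loop. `retire(batch)` sets NRef to $0$ and goes through all slots. In a slot with $\mathrm{HRef}=0$ it only counts $\mathit{Adjs}$ towards a sum *Empty*. In any other slot it puts a node of the batch at the front of the list by a CAS loop on the head and adds $\mathit{Adjs}+\mathrm{HRef}$ to NRef of the predecessor's batch (if there is a predecessor). In the end it adds *Empty* to NRef of its own batch if some slot was passed over. `leave` decrements HRef by a CAS loop on the head (setting HPtr to Null when HRef becomes $0$, and then adding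 $\mathit{Adjs}$ to NRef of the batch of the former first node). If the first node was not the handle, it then *traverses* the list from the node after the first one up to and including the handle (or to Null), subtracting $1$ from NRef of the batch of each node. Whoever brings NRef to $0$ frees the nodes of the batch one by one. Freed addresses may be allocated again. * *Hyaline-1* (each thread has its own slot). `enter` writes $[1,\mathrm{Null}]$ to the head. `leave` swaps the head with $[0,\mathrm{Null}]$ and traverses the whole former list. `retire` does not adjust predecessors, but in the end adds the number of lists to which the batch was added to NRef of the batch. * *Hyaline-S* and *Hyaline-1S* add birth eras to Hyaline and Hyaline-1. `init_node` increments the global era on every *Freq*-th call in a thread and stamps the node with the era. `deref` repeats: read the pointer, read the global era, return if it equals the access era of the slot, otherwise call `touch`. `touch` raises the access era of the slot to the era that was read, by a CAS loop that stops if the access era is already at least as large (a plain write instead of the CAS in Hyaline-1S). `retire` also passes over slots whose access era is smaller than the minimal birth era of the batch. In Hyaline-S, moreover, each slot has an integer Ack: `retire` adds HRef to it for each insertion, and a thread that traverses subtracts the number of iterations of its traversal; `enter` looks through the slots, each at most once, for one with Ack below a threshold, and if there is none doubles the number of slots and searches again, or, once a fixed maximal number of slots is reached, takes the last slot tried. (The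 case in which the number of slots is fixed is included; *Adjs* and the slots of a batch are those at the time of its retirement.) The client calls `deref`, `retire` and `leave` only between `enter` and `leave`, and retires each allocated node at most once, in batches with more than $k$ nodes. Reference counts fit the word: $n\,k_{\max}^2<2^N$ for Hyaline and Hyaline-S, where $k_{\max}$ is the largest number of slots, and $k<2^N$ for Hyaline-1 and Hyaline-1S. **Theorem.** For each of Hyaline, Hyaline-1, Hyaline-S, Hyaline-1S, the following holds in every infinite execution from the initial state. 1. (Lock-freedom with respect to CPU progress.) If threads take infinitely many steps inside operations (`enter`, `leave`, `retire`, and with birth eras also `deref` and `init_node`), then infinitely many operations are completed. 2. If a CAS on the head of a slot fails in the retry loop of `enter`, `leave` or `retire`, then, between the last load of this head by that thread (which belongs to the same loop iteration) and the failure, another thread executing `enter`, `leave` or `retire` successfully finished its modification of the same head. If the CAS on the access era of a slot fails in `touch`, then, between the load in the same iteration and the failure, another thread executing `touch` successfully updated the access era of the same slot. 3. If a thread enters a slot at time $i$ (modification of the head by `enter`) and next leaves it at time $j$ (modification of the head by `leave`), then the number of nodes processed by the traverse loop of that `leave` is at most the (finite) number of batches added to the list of this slot between $i$ and $j$. 4.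 Between any two iterations of the loop in one call of `deref` that fail the test (access era $=$ global era), another thread advances the global era in `init_node`. A thread that is executing `deref` and keeps taking steps returns from it, unless another thread advances the global era after that time. -/

import Mathlib

open Filter

namespace Hyaline

/-! ## The four schemes and their parameters -/

/-- The Hyaline family. -/
inductive Variant where
  | hyaline
  | hyaline1
  | hyalineS
  | hyaline1S
  deriving DecidableEq

/-- Hyaline-1 and Hyaline-1S: every thread has its own slot. -/
def Variant.single : Variant → Bool
  | .hyaline1 => true
  | .hyaline1S => true
  | _ => false

/-- Hyaline-S and Hyaline-1S: the variants with birth eras. -/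
def Variant.robust : Variant → Bool
  | .hyalineS => true
  | .hyaline1S => true
  | _ => false

/-- Parameters of a system. `kmin` is the initial number of slots. `dirSize` is the number of
entries of the directory of slots: Hyaline-S may double the number of slots `dirSize - 1` times
(`dirSize = 1` is Hyaline-S with a fixed number of slots). `bits` is the width of the unsigned
per-batch counter `NRef`. `own` is the slot of a thread in Hyaline-1 and Hyaline-1S. `casEnter`
says whether the double-width fetch-and-add of `enter` is emulated by a CAS loop (as on machines
whose only double-width atomic instruction is CAS) or is a primitive. -/
structure Params where
  variant : Variant
  threads : ℕ
  kmin : ℕ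
  dirSize : ℕ
  bits : ℕ
  freq : ℕ
  threshold : ℤ
  casEnter : Bool
  own : Fin threads → ℕ

/-- The largest number of slots that can ever be in use. -/
def Params.kmax (P : Params) : ℕ := P.kmin * 2 ^ (P.dirSize - 1)

/-- Standing assumptions. The number of slots is a power of two for Hyaline and Hyaline-S;
slots are unique to threads for Hyaline-1 and Hyaline-1S; the word is so wide that reference
counts do not overflow (for Hyaline and Hyaline-S this says `threads * k < Adjs`). -/
structure Params.Valid (P : Params) : Prop where
  kmin_pos : 0 < P.kmin
  dir_pos : 0 < P.dirSize
  freq_pos : 0 < P.freq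
  pow_two : P.variant.single = false → ∃ m : ℕ, P.kmin = 2 ^ m
  own_lt : P.variant.single = true → ∀ t, P.own t < P.kmin
  own_inj : P.variant.single = true → Function.Injective P.own
  no_overflow : P.variant.single = false → P.threads * P.kmax ^ 2 < 2 ^ P.bits
  no_overflow_single : P.variant.single = true → P.kmin < 2 ^ P.bits

/-! ## Memory -/

/-- Addresses of nodes. -/
abbrev Addr := ℕ

/-- Pointers to nodes, `none` is `Null`. -/
abbrev Ptr := Option Addr

/-- `N`-bit unsigned integers with wrap-around arithmetic. -/
abbrev UWord (N : ℕ) := ZMod (2 ^ N)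

/-- The constant `Adjs = ⌊(2^N - 1) / k⌋ + 1`. -/
def adjsOf (N k : ℕ) : UWord N := (((2 ^ N - 1) / k + 1 : ℕ) : ZMod (2 ^ N))

/-- The tuple `[HRef, HPtr]` of a slot, which is read and written atomically. -/
structure Head where
  href : ℕ
  hptr : Ptr
  deriving DecidableEq

/-- The header of a node. `adjs` is meaningful in the counter node (`NRefNode`) of a batch only,
and is the value of `Adjs` for the number of slots with which the batch was retired. -/
structure Node (N : ℕ) where
  nref : UWord N
  next : Ptr
  nrefNode : Addr
  batchNext : Addr
  adjs : UWord N
  birthEra : ℕ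

/-- Allocation status: not allocated; allocated and being initialized; allocated and usable by
the client; handed to `retire` and not yet freed. A freed address may be allocated again. -/
inductive Status where
  | free
  | fresh
  | live
  | retired
  deriving DecidableEq

/-! ## Program counters and local variables -/

/-- Local variables of `retire`: `first`, `ref` (the counter node), `k`, `adjs` and `minBirth`
describe the batch, `i` is the current slot. -/
structure RLocals (N : ℕ) where
  first : Addr
  ref : Addr
  k : ℕ
  adjs : UWord N
  minBirth : ℕ
  i : ℕ
  cur : Addr
  doAdj : Bool
  empty : UWord N
  inserts : ℕ

/-- Where to continue after a call of `adjust` or `free_batch`. -/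
inductive Cont (N : ℕ) where
  /-- in `leave`, with the values of `Curr` and `Next` -/
  | leave (curr next : Ptr)
  /-- in `retire`, after the adjustment of the predecessor in slot `r.i` -/
  | slot (r : RLocals N) (href : ℕ)
  /-- at the end of `retire` -/
  | done
  /-- in `traverse`, at the end of the body of the loop -/
  | trav (curr : Addr) (next : Ptr) (counter : ℕ)

/-- Program counters, with the local variables that are live there. -/
inductive PC (N : ℕ) where
  /-- outside of the operations of the scheme -/
  | idle
  /-- `enter` of Hyaline-S: read the current number of slots -/
  | enterK (slot : ℕ)
  /-- `enter` of Hyaline-S: test `Acks[slot]`; `tries` slots out of `k` were tried before -/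
  | enterAck (slot tries k : ℕ)
  /-- `enter` of Hyaline-S: install an array of new slots in the directory -/
  | growDir (slot k : ℕ)
  /-- `enter` of Hyaline-S: CAS on the number of slots -/
  | growK (k : ℕ)
  /-- `enter`: FAA on `Heads[slot]` (a plain write in Hyaline-1 and Hyaline-1S) -/
  | enterFAA (slot : ℕ)
  /-- `enter` with an emulated FAA: load of `Heads[slot]` -/
  | enterLoad (slot : ℕ)
  /-- `enter` with an emulated FAA: CAS on `Heads[slot]` -/
  | enterCAS (slot : ℕ) (last : Head)
  /-- `leave`: `Head = Heads[slot]` -/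
  | leaveLoad
  /-- `leave`: `Next = Curr->Next` if `Curr` is not the handle -/
  | leaveNext (hd : Head)
  /-- `leave`: CAS on `Heads[slot]` -/
  | leaveCAS (hd : Head) (next : Ptr)
  /-- `leave` of Hyaline-1 and Hyaline-1S: SWAP on `Heads[slot]` -/
  | leaveSwap
  /-- `adjust`: read `Ref = node->NRefNode`; the value to add is `x`, plus the `Adjs` of the
  batch of `node` if `useAdjs` -/
  | adjLoad (node : Addr) (useAdjs : Bool) (x : UWord N) (c : Cont N)
  /-- `adjust`: FAA on `Ref->NRef` -/
  | adjFAA (ref : Addr) (val : UWord N) (c : Cont N)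
  /-- `free_batch(Ref->BatchNext)`: read the first node -/
  | freeLoad (ref : Addr) (c : Cont N)
  /-- `free_batch`: read `cur->BatchNext`, free `cur` -/
  | freeNode (first cur : Addr) (c : Cont N)
  /-- `traverse`: start of the body of the loop -/
  | travLoop (next : Ptr) (counter : ℕ)
  /-- `traverse`: `Ref = Curr->NRefNode` -/
  | travRef (curr : Addr) (next : Ptr) (counter : ℕ)
  /-- `traverse`: FAA on `Ref->NRef` -/
  | travFAA (curr : Addr) (next : Ptr) (ref : Addr) (counter : ℕ)
  /-- `traverse` of Hyaline-S: `FAA(&Acks[slot], -Counter)` -/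
  | travAck (counter : ℕ)
  /-- `retire`: `batch->NRefNode->NRef = 0` -/
  | retInit (r : RLocals N)
  /-- `retire`: end of the loop over the slots, or `Head = Heads[i]` -/
  | retSlot (r : RLocals N)
  /-- `retire` of Hyaline-S and Hyaline-1S: `Access = Accesses[i]` -/
  | retAccess (r : RLocals N) (hd : Head)
  /-- `retire`: `CurrNode->Next = Head.HPtr` -/
  | retLink (r : RLocals N) (hd : Head)
  /-- `retire`: CAS on `Heads[i]` -/
  | retCAS (r : RLocals N) (hd : Head)
  /-- `retire`: `CurrNode = CurrNode->BatchNext` -/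
  | retAdvance (r : RLocals N) (hd : Head)
  /-- `retire` of Hyaline-S: `FAA(&Acks[i], Head.HRef)` -/
  | retAck (r : RLocals N) (href : ℕ)
  /-- `deref`: `Access = Accesses[slot]` -/
  | derefAccess (loc : ℕ)
  /-- `deref`, start of the body of the loop: `Node = *ptr_node` -/
  | derefNode (loc access : ℕ)
  /-- `deref`: `Alloc = AllocEra`, and the test `Access = Alloc` -/
  | derefEra (loc access : ℕ) (node : Ptr)
  /-- `touch`: `Access = Accesses[slot]`, and the test `Access ≥ era` -/
  | touchLoad (loc era : ℕ)
  /-- `touch`: CAS on `Accesses[slot]` (a plain write in Hyaline-1S) -/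
  | touchCAS (loc era access : ℕ)
  /-- `init_node`: test of `AllocCounter` -/
  | initTest (a : Addr)
  /-- `init_node`: `FAA(&AllocEra, 1)` -/
  | initFAA (a : Addr)
  /-- `init_node`: `node->BirthEra = AllocEra` -/
  | initBirth (a : Addr)

/-- Private state of a thread. `active` holds between `enter` and `leave`; `slot` and `handle`
are those of the last `enter`; `ret` is the last result of `deref`. -/
structure Thread (N : ℕ) where
  pc : PC N
  active : Bool
  slot : ℕ
  handle : Ptr
  allocCounter : ℕ
  ret : Ptr

/-- Global state. `k` is the current number of slots, `dir` tells which entries of the directory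
of slots point to an array, and `links` holds the pointers of the client's data structures. -/
structure State (P : Params) where
  heads : ℕ → Head
  accesses : ℕ → ℕ
  acks : ℕ → ℤ
  allocEra : ℕ
  k : ℕ
  dir : ℕ → Bool
  node : Addr → Node P.bits
  status : Addr → Status
  links : ℕ → Ptr
  thr : Fin P.threads → Thread P.bits

/-- The initial state. -/
def init (P : Params) : State P where
  heads := fun _ => ⟨0, none⟩
  accesses := fun _ => 0
  acks := fun _ => 0
  allocEra := 0
  k := P.kmin
  dir := fun j => decide (j = 0)
  node := fun _ => ⟨0, none, 0, 0, 0, 0⟩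
  status := fun _ => .free
  links := fun _ => none
  thr := fun _ => ⟨.idle, false, 0, none, 0, none⟩

namespace State

variable {P : Params}

/-- Replace the private state of a thread. -/
def setThread (s : State P) (t : Fin P.threads) (th : Thread P.bits) : State P :=
  { s with thr := Function.update s.thr t th }

/-- Replace the program counter of a thread. -/
def goto (s : State P) (t : Fin P.threads) (pc : PC P.bits) : State P :=
  s.setThread t { s.thr t with pc := pc }

/-- Write a slot head. -/
def setHead (s : State P) (i : ℕ) (h : Head) : State P :=
  { s with heads := Function.update s.heads i h }

/-- Write a node header. -/
def setNode (s : State P) (a : Addr) (x : Node P.bits) : State P :=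
  { s with node := Function.update s.node a x }

/-- `FAA(&ref->NRef, val)`. -/
def addNRef (s : State P) (ref : Addr) (val : UWord P.bits) : State P :=
  s.setNode ref { s.node ref with nref := (s.node ref).nref + val }

/-- Return from `enter`. -/
def finishEnter (s : State P) (t : Fin P.threads) (slot : ℕ) (handle : Ptr) : State P :=
  s.setThread t { s.thr t with pc := .idle, active := true, slot := slot, handle := handle }

/-- Return from `leave`. -/
def finishLeave (s : State P) (t : Fin P.threads) : State P :=
  s.setThread t { s.thr t with pc := .idle, active := false }

/-- Return from `traverse` and from the enclosing `leave`. -/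
def endTraverse (s : State P) (t : Fin P.threads) (counter : ℕ) : State P :=
  if P.variant = .hyalineS then s.goto t (.travAck counter) else s.finishLeave t

/-- Continue after `adjust` or `free_batch`. -/
def resume (s : State P) (t : Fin P.threads) : Cont P.bits → State P
  | .leave curr next =>
      if curr ≠ (s.thr t).handle then s.goto t (.travLoop next 0) else s.finishLeave t
  | .slot r href =>
      if P.variant = .hyalineS then s.goto t (.retAck r href)
      else s.goto t (.retSlot { r with i := r.i + 1 })
  | .done => s.goto t .idle
  | .trav curr next counter =>
      if some curr ≠ (s.thr t).handle then s.goto t (.travLoop next counter)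
      else s.endTraverse t counter

/-- `retire` passes over a slot. -/
def skipSlot (s : State P) (t : Fin P.threads) (r : RLocals P.bits) : State P :=
  s.goto t (.retSlot { r with doAdj := true, empty := r.empty + r.adjs, i := r.i + 1 })

end State

/-- The program counter from which `enter` gets hold of the head of a slot. -/
def enterPC (P : Params) (slot : ℕ) : PC P.bits :=
  if P.variant.single = false ∧ P.casEnter = true then .enterLoad slot else .enterFAA slot

/-! ## The code of the operations -/

/-- One step of a thread that executes an operation. -/
def code (P : Params) (s : State P) (t : Fin P.threads) : State P :=
  let th := s.thr t
  match th.pc with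
  | .idle => s
  -- enter
  | .enterK slot => s.goto t (.enterAck slot 0 s.k)
  | .enterAck slot tries k =>
      if s.acks slot < P.threshold then s.goto t (enterPC P slot)
      else if tries + 1 < k then s.goto t (.enterAck ((slot + 1) % k) (tries + 1) k)
      else if Nat.log 2 (k / P.kmin) + 1 < P.dirSize then s.goto t (.growDir slot k)
      else s.goto t (enterPC P slot)
  | .growDir _ k =>
      { s with dir := Function.update s.dir (Nat.log 2 (k / P.kmin) + 1) true }.goto t (.growK k)
  | .growK k =>
      (if s.k = k then { s with k := 2 * k } else s).goto t (.enterK k)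
  | .enterFAA slot =>
      if P.variant.single = true then (s.setHead slot ⟨1, none⟩).finishEnter t slot none
      else (s.setHead slot ⟨(s.heads slot).href + 1, (s.heads slot).hptr⟩).finishEnter t slot
        (s.heads slot).hptr
  | .enterLoad slot => s.goto t (.enterCAS slot (s.heads slot))
  | .enterCAS slot last =>
      if s.heads slot = last then
        (s.setHead slot ⟨last.href + 1, last.hptr⟩).finishEnter t slot last.hptr
      else s.goto t (.enterLoad slot)
  -- leave
  | .leaveLoad => s.goto t (.leaveNext (s.heads th.slot))
  | .leaveNext hd =>
      if hd.hptr ≠ th.handle then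
        s.goto t (.leaveCAS hd (hd.hptr.bind fun c => (s.node c).next))
      else s.goto t (.leaveCAS hd none)
  | .leaveCAS hd next =>
      if s.heads th.slot = hd then
        let s' := s.setHead th.slot ⟨hd.href - 1, if hd.href = 1 then none else hd.hptr⟩
        match hd.hptr with
        | some c =>
            if hd.href = 1 then s'.goto t (.adjLoad c true 0 (.leave hd.hptr next))
            else s'.resume t (.leave hd.hptr next)
        | none => s'.resume t (.leave hd.hptr next)
      else s.goto t .leaveLoad
  | .leaveSwap =>
      let hd := s.heads th.slot
      let s' := s.setHead th.slot ⟨0, none⟩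
      if hd.hptr ≠ none then s'.goto t (.travLoop hd.hptr 0) else s'.finishLeave t
  -- adjust
  | .adjLoad a useAdjs x c =>
      let ref := (s.node a).nrefNode
      s.goto t (.adjFAA ref (if useAdjs then (s.node ref).adjs + x else x) c)
  | .adjFAA ref val c =>
      if (s.node ref).nref = -val then (s.addNRef ref val).goto t (.freeLoad ref c)
      else (s.addNRef ref val).resume t c
  -- free_batch
  | .freeLoad ref c => s.goto t (.freeNode (s.node ref).batchNext (s.node ref).batchNext c)
  | .freeNode first cur c =>
      let s' : State P := { s with status := Function.update s.status cur .free }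
      if (s.node cur).batchNext ≠ first then s'.goto t (.freeNode first (s.node cur).batchNext c)
      else s'.resume t c
  -- traverse
  | .travLoop none counter => s.endTraverse t (counter + 1)
  | .travLoop (some curr) counter => s.goto t (.travRef curr (s.node curr).next (counter + 1))
  | .travRef curr next counter => s.goto t (.travFAA curr next (s.node curr).nrefNode counter)
  | .travFAA curr next ref counter =>
      if (s.node ref).nref = 1 then
        (s.addNRef ref (-1)).goto t (.freeLoad ref (.trav curr next counter))
      else (s.addNRef ref (-1)).resume t (.trav curr next counter)
  | .travAck counter =>
      { s with acks := Function.update s.acks th.slot (s.acks th.slot - counter) }.finishLeave t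
  -- retire
  | .retInit r => (s.setNode r.ref { s.node r.ref with nref := 0 }).goto t (.retSlot r)
  | .retSlot r =>
      if r.i < r.k then
        if P.variant.robust = true then s.goto t (.retAccess r (s.heads r.i))
        else if (s.heads r.i).href = 0 then s.skipSlot t r
        else s.goto t (.retLink r (s.heads r.i))
      else if P.variant.single = true then
        s.goto t (.adjLoad r.first false (r.inserts : UWord P.bits) .done)
      else if r.doAdj = true then s.goto t (.adjLoad r.first false r.empty .done)
      else s.goto t .idle
  | .retAccess r hd =>
      if hd.href = 0 ∨ s.accesses r.i < r.minBirth then s.skipSlot t r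
      else s.goto t (.retLink r hd)
  | .retLink r hd =>
      (s.setNode r.cur { s.node r.cur with next := hd.hptr }).goto t (.retCAS r hd)
  | .retCAS r hd =>
      if s.heads r.i = hd then (s.setHead r.i ⟨hd.href, some r.cur⟩).goto t (.retAdvance r hd)
      else s.goto t (.retSlot r)
  | .retAdvance r hd =>
      let r' := { r with cur := (s.node r.cur).batchNext }
      if P.variant.single = true then
        s.goto t (.retSlot { r' with inserts := r.inserts + 1, i := r.i + 1 })
      else
        match hd.hptr with
        | some p => s.goto t (.adjLoad p true (hd.href : UWord P.bits) (.slot r' hd.href))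
        | none => s.resume t (.slot r' hd.href)
  | .retAck r href =>
      { s with acks := Function.update s.acks r.i (s.acks r.i + href) }.goto t
        (.retSlot { r with i := r.i + 1 })
  -- deref
  | .derefAccess loc => s.goto t (.derefNode loc (s.accesses th.slot))
  | .derefNode loc access => s.goto t (.derefEra loc access (s.links loc))
  | .derefEra loc access nd =>
      if access = s.allocEra then
        s.setThread t { th with pc := .idle, ret := nd }
      else s.goto t (.touchLoad loc s.allocEra)
  | .touchLoad loc era =>
      if era ≤ s.accesses th.slot then s.goto t (.derefNode loc (s.accesses th.slot))
      else s.goto t (.touchCAS loc era (s.accesses th.slot))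
  | .touchCAS loc era access =>
      if P.variant.single = true ∨ s.accesses th.slot = access then
        { s with accesses := Function.update s.accesses th.slot era }.goto t (.derefNode loc era)
      else s.goto t (.touchLoad loc era)
  -- init_node
  | .initTest a =>
      s.setThread t { th with
        allocCounter := th.allocCounter + 1
        pc := if th.allocCounter % P.freq = 0 then .initFAA a else .initBirth a }
  | .initFAA a => { s with allocEra := s.allocEra + 1 }.goto t (.initBirth a)
  | .initBirth a =>
      { s.setNode a { s.node a with birthEra := s.allocEra } with
        status := Function.update s.status a .live }.goto t .idle

/-! ## Calls by the client, executions -/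

/-- The headers of the nodes after the nodes of `l` were linked to a batch for `k` slots: the
last node is the counter node, all nodes point to it, and `BatchNext` runs through `l`
cyclically. -/
def linkBatch (N k : ℕ) (l : List Addr) (node : Addr → Node N) : Addr → Node N := fun a =>
  if a ∈ l then
    { node a with
      nrefNode := l.getLastD 0
      batchNext := l.getD ((l.idxOf a + 1) % l.length) 0
      adjs := adjsOf N k }
  else node a

/-- The minimal birth era of the nodes of `l`. -/
def minBirth {N : ℕ} (l : List Addr) (node : Addr → Node N) : ℕ :=
  (l.map fun a => (node a).birthEra).foldr min (node (l.headD 0)).birthEra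

/-- Local variables of `retire` at the start. -/
def startRetire {P : Params} (s : State P) (l : List Addr) : RLocals P.bits where
  first := l.headD 0
  ref := l.getLastD 0
  k := s.k
  adjs := adjsOf P.bits s.k
  minBirth := minBirth l s.node
  i := 0
  cur := l.headD 0
  doAdj := false
  empty := 0
  inserts := 0

/-- The steps of a thread: the next step of the operation that it executes, the call of an
operation, or a step of the client. The client has to respect the interface: `deref`, `retire`
and `leave` are called between `enter` and `leave` only, and a node is retired once, in a batch
that has more nodes than there are slots. -/
inductive Step (P : Params) : State P → Fin P.threads → State P → Prop
  /-- a step of the operation that is being executed -/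
  | run (s : State P) (t : Fin P.threads) (hpc : (s.thr t).pc ≠ .idle) :
      Step P s t (code P s t)
  /-- call of `enter`, with any slot, or with the thread's own slot -/
  | callEnter (s : State P) (t : Fin P.threads) (slot : ℕ)
      (hpc : (s.thr t).pc = .idle) (hact : (s.thr t).active = false) (hslot : slot < s.k)
      (hown : P.variant.single = true → slot = P.own t) :
      Step P s t (s.goto t (if P.variant = .hyalineS then .enterK slot else enterPC P slot))
  /-- call of `leave` -/
  | callLeave (s : State P) (t : Fin P.threads)
      (hpc : (s.thr t).pc = .idle) (hact : (s.thr t).active = true) :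
      Step P s t (s.goto t (if P.variant.single = true then .leaveSwap else .leaveLoad))
  /-- call of `deref` -/
  | callDeref (s : State P) (t : Fin P.threads) (loc : ℕ) (hrob : P.variant.robust = true)
      (hpc : (s.thr t).pc = .idle) (hact : (s.thr t).active = true) :
      Step P s t (s.goto t (.derefAccess loc))
  /-- call of `retire`; the number of slots is read here -/
  | callRetire (s : State P) (t : Fin P.threads) (l : List Addr)
      (hpc : (s.thr t).pc = .idle) (hact : (s.thr t).active = true)
      (hnodup : l.Nodup) (hlen : s.k < l.length) (hlive : ∀ a ∈ l, s.status a = .live) :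
      Step P s t
        ({ s with
            node := linkBatch P.bits s.k l s.node
            status := fun a => if a ∈ l then .retired else s.status a }.goto t
          (.retInit (startRetire s l)))
  /-- allocation of a node (with an arbitrary content) and call of `init_node` -/
  | callInit (s : State P) (t : Fin P.threads) (a : Addr) (junk : Node P.bits)
      (hrob : P.variant.robust = true)
      (hpc : (s.thr t).pc = .idle) (hfree : s.status a = .free) :
      Step P s t
        ({ s.setNode a junk with status := Function.update s.status a .fresh }.goto t
          (.initTest a))
  /-- allocation of a node in Hyaline and Hyaline-1, where there is no `init_node` -/
  | malloc (s : State P) (t : Fin P.threads) (a : Addr) (junk : Node P.bits)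
      (hrob : P.variant.robust = false)
      (hpc : (s.thr t).pc = .idle) (hfree : s.status a = .free) :
      Step P s t { s.setNode a junk with status := Function.update s.status a .live }
  /-- the client changes its data structures -/
  | write (s : State P) (t : Fin P.threads) (f : ℕ → Ptr) (hpc : (s.thr t).pc = .idle) :
      Step P s t { s with links := f }

/-- `σ` is the sequence of the states of an execution, and `τ i` is the thread that makes the
`i`-th step. The schedule is arbitrary; any thread may stop for ever at any point. -/
structure Execution (P : Params) (σ : ℕ → State P) (τ : ℕ → Fin P.threads) : Prop where
  start : σ 0 = init P
  step : ∀ i, Step P (σ i) (τ i) (σ (i + 1))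

/-! ## What a step does

In the predicates below, `s` is the state before the step, and `t` the thread that makes it. -/

section Events

variable {P : Params}

/-- The thread is executing an operation. -/
def InOperation (s : State P) (t : Fin P.threads) : Prop := (s.thr t).pc ≠ .idle

/-- `enter` acquires `Heads[slot]`. -/
def EnterCommit (s : State P) (t : Fin P.threads) (slot : ℕ) : Prop :=
  (s.thr t).pc = .enterFAA slot ∨ (s.thr t).pc = .enterCAS slot (s.heads slot)

/-- `leave` updates `Heads[slot]` successfully. -/
def LeaveCommit (s : State P) (t : Fin P.threads) (slot : ℕ) : Prop :=
  slot = (s.thr t).slot ∧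
    ((s.thr t).pc = .leaveSwap ∨ ∃ next, (s.thr t).pc = .leaveCAS (s.heads slot) next)

/-- `retire` adds its batch to the list of `slot`. -/
def InsertCommit (s : State P) (t : Fin P.threads) (slot : ℕ) : Prop :=
  ∃ r, r.i = slot ∧ (s.thr t).pc = .retCAS r (s.heads slot)

/-- `enter`, `leave` or `retire` finishes a modification of `Heads[slot]`. -/
def HeadCommit (s : State P) (t : Fin P.threads) (slot : ℕ) : Prop :=
  EnterCommit s t slot ∨ LeaveCommit s t slot ∨ InsertCommit s t slot

/-- The load of `Heads[slot]` in the retry loop of `enter`, `leave` or `retire`. -/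
def HeadLoad (s : State P) (t : Fin P.threads) (slot : ℕ) : Prop :=
  (s.thr t).pc = .enterLoad slot ∨ (slot = (s.thr t).slot ∧ (s.thr t).pc = .leaveLoad) ∨
    ∃ r, r.i = slot ∧ r.i < r.k ∧ (s.thr t).pc = .retSlot r

/-- A CAS on `Heads[slot]` in `enter`, `leave` or `retire` fails. -/
def HeadFail (s : State P) (t : Fin P.threads) (slot : ℕ) : Prop :=
  ∃ hd, s.heads slot ≠ hd ∧
    ((s.thr t).pc = .enterCAS slot hd ∨
      (slot = (s.thr t).slot ∧ ∃ next, (s.thr t).pc = .leaveCAS hd next) ∨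
      ∃ r, r.i = slot ∧ (s.thr t).pc = .retCAS r hd)

/-- `touch` updates `Accesses[slot]` successfully. -/
def TouchCommit (s : State P) (t : Fin P.threads) (slot : ℕ) : Prop :=
  slot = (s.thr t).slot ∧ ∃ loc era access, (s.thr t).pc = .touchCAS loc era access ∧
    (P.variant.single = true ∨ s.accesses slot = access)

/-- The load of `Accesses[slot]` in the retry loop of `touch`. -/
def TouchLoad (s : State P) (t : Fin P.threads) (slot : ℕ) : Prop :=
  slot = (s.thr t).slot ∧ ∃ loc era, (s.thr t).pc = .touchLoad loc era

/-- The CAS on `Accesses[slot]` in `touch` fails. -/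
def TouchFail (s : State P) (t : Fin P.threads) (slot : ℕ) : Prop :=
  slot = (s.thr t).slot ∧ P.variant.single = false ∧
    ∃ loc era access, (s.thr t).pc = .touchCAS loc era access ∧ s.accesses slot ≠ access

/-- `traverse` begins an iteration that processes a node of the retirement list. -/
def TraverseVisit (s : State P) (t : Fin P.threads) : Prop :=
  ∃ curr counter, (s.thr t).pc = .travLoop (some curr) counter

/-- `init_node` increments the global era. -/
def EraAdvance (s : State P) (t : Fin P.threads) : Prop :=
  ∃ a, (s.thr t).pc = .initFAA a

/-- The thread executes `deref` (including `touch`). -/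
def InDeref (s : State P) (t : Fin P.threads) : Prop :=
  (∃ loc, (s.thr t).pc = .derefAccess loc) ∨
  (∃ loc access, (s.thr t).pc = .derefNode loc access) ∨
  (∃ loc access nd, (s.thr t).pc = .derefEra loc access nd) ∨
  (∃ loc era, (s.thr t).pc = .touchLoad loc era) ∨
  (∃ loc era access, (s.thr t).pc = .touchCAS loc era access)

/-- An iteration of the loop of `deref` fails its test `Access = Alloc`, so that the loop has to
be repeated. -/
def DerefRepeat (s : State P) (t : Fin P.threads) : Prop :=
  ∃ loc access nd, (s.thr t).pc = .derefEra loc access nd ∧ access ≠ s.allocEra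

end Events

/-! ## Progress properties of an execution -/

section Progress

variable {P : Params} (σ : ℕ → State P) (τ : ℕ → Fin P.threads)

/-- In step `i`, thread `t` returns from an operation. -/
def Completes (t : Fin P.threads) (i : ℕ) : Prop :=
  τ i = t ∧ InOperation (σ i) t ∧ ¬ InOperation (σ (i + 1)) t

/-- Lock-freedom: if threads make infinitely many steps inside of operations, then infinitely
many operations are completed. -/
def LockFree : Prop :=
  (∃ᶠ i in atTop, InOperation (σ i) (τ i)) → ∃ᶠ i in atTop, Completes σ τ (τ i) i

/-- If a compare-and-swap (`fail`) on the location of `slot` fails, then between the last `load`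
of this location by the same thread and the failure another thread finished an operation on the
same location (`commit`). -/
def FailureImpliesProgress (fail load commit : State P → Fin P.threads → ℕ → Prop) : Prop :=
  ∀ j slot, fail (σ j) (τ j) slot →
    ∃ i < j, τ i = τ j ∧ load (σ i) (τ i) slot ∧
      (∀ q, i < q → q < j → τ q = τ j → ¬ load (σ q) (τ q) slot) ∧
      ∃ m, i < m ∧ m < j ∧ τ m ≠ τ j ∧ commit (σ m) (τ m) slot

open Classical in
/-- If thread `t` enters `slot` in step `i` and leaves it in step `j`, then the loop of `traverse`
in this `leave` processes at most as many nodes as batches were added to `slot` between `i`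
and `j`. -/
def TraverseBounded : Prop :=
  ∀ (t : Fin P.threads) (slot i j : ℕ), i < j → τ i = t → τ j = t →
    EnterCommit (σ i) t slot → LeaveCommit (σ j) t slot →
    (∀ q, i < q → q < j → τ q = t → ∀ slot', ¬ LeaveCommit (σ q) t slot') →
    {q | j < q ∧ τ q = t ∧ TraverseVisit (σ q) t ∧
        ∀ r, j ≤ r → r < q → ¬ Completes σ τ t r}.encard ≤
      (((Finset.Ioo i j).filter fun m => InsertCommit (σ m) (τ m) slot).card : ℕ∞)

/-- Between two unsuccessful iterations of the loop in one call of `deref`, another thread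
advances the global era. -/
def DerefRepeatImpliesAdvance : Prop :=
  ∀ (t : Fin P.threads) (i j : ℕ), i < j → τ i = t → τ j = t →
    DerefRepeat (σ i) t → DerefRepeat (σ j) t →
    (∀ r, i ≤ r → r < j → ¬ Completes σ τ t r) →
    ∃ m, i < m ∧ m < j ∧ τ m ≠ t ∧ EraAdvance (σ m) (τ m)

/-- A thread that executes `deref` and is never stopped returns from it, unless other threads
advance the global era. -/
def DerefTerminates : Prop :=
  ∀ (t : Fin P.threads) (i : ℕ), InDeref (σ i) t → (∃ᶠ q in atTop, τ q = t) →
    (∀ m, i ≤ m → τ m ≠ t → ¬ EraAdvance (σ m) (τ m)) →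
    ∃ j, i ≤ j ∧ Completes σ τ t j

end Progress

end Hyaline

namespace Hyaline

/-! The statements about failures and about `deref` need no memory safety. A CAS compares a location
with a value that the same thread loaded before and has not overwritten since, so a failed
comparison shows that somebody else modified the location (`failureImpliesProgress_of`). In `deref`,
access eras never exceed the global era, and a test that fails at global era `E` is followed by a
`touch` that ends with an access era of at least `E`; while the global era stays `E`, the next test
must succeed (`derefRepeatImpliesAdvance`). For termination it remains to exclude that the CAS of
`touch` is lost for ever: with shared slots the access era is monotone and bounded by the global
era, hence eventually constant, and then `derefRank` descends (`derefTerminates`).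

The bound on `traverse` and lock-freedom require that the lists are intact: a node that a thread has
yet to traverse must not be freed and allocated again, since the loop could then wander off. So the
safety of the reference counts has to be proved first, and this is the bulk of the work. An
auxiliary state records for each thread the list `todo` of nodes that it protects and the
contributions to counters that it still owes, and for each batch the number `settled` of
contributions received, the references `granted` by them and the references `dropped`. With shared
slots a batch receives one contribution of `Adjs` per slot: when the slot is passed over, when the
node of the batch is replaced as first node (together with `HRef`, the number of threads that then
hold a counted reference), or when the list is emptied.

The invariant `Inv` is double-entry bookkeeping. Contributions made and outstanding add up to the
number `k` of slots; references held and dropped add up to those granted and owed; and `NRef` is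
`Adjs * settled + granted - dropped` modulo `2 ^ N`. Since `k * Adjs = 2 ^ N`, while all references
together stay below `Adjs`, a step can bring the counter to `0` only when all `k` contributions have
arrived and every reference was given up (`zero_test`). With own slots there is a single
contribution, the number of insertions, and no `Adjs`. Therefore, whenever a batch starts being
freed, no thread has a node of it in its list (`no_todo`, `Inv.faa`). `Inv.step` shows that every
step can be accompanied by a change of the auxiliary state.

The traversal bound follows: the counted part of a thread's list is empty after `enter`, grows by
insertions into its slot only, is handed to the traversal by `leave`, and loses one node per visit.

For lock-freedom, suppose that nothing completes from some time on. One call modifies heads and the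
era boundedly often (`Step.commits_le`), so these are eventually fixed, and so is the bounded number
of slots. Some thread makes infinitely many steps inside an operation. It is not in `deref`, which
would terminate. In all other operations each of its steps lowers a lexicographic rank, finite
because the list to be traversed and the nodes to be freed are finite (`Step.rank_lt`), which is
absurd. -/

variable {P : Params}

/-! ## Local facts about program counters -/

/-- The numbers of slots that can occur. -/
def SlotCount (P : Params) (k : ℕ) : Prop := ∃ j < P.dirSize, k = P.kmin * 2 ^ j

/-- Facts about the local variables of `retire` that do not depend on the memory. -/
def RLocals.WellFormed (P : Params) (r : RLocals P.bits) : Prop :=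
  SlotCount P r.k ∧ (P.variant.single = true → r.k = P.kmin) ∧ r.adjs = adjsOf P.bits r.k

/-- Facts about a continuation that do not depend on the memory. -/
def Cont.WellFormed (P : Params) : Cont P.bits → Prop
  | .slot r _ => P.variant.single = false ∧ r.WellFormed P ∧ r.i < r.k
  | _ => True

/-- Facts about the private state of a thread that depend on the number of slots and the global
era only. -/
def PcWellFormed (P : Params) (k era : ℕ) (t : Fin P.threads) (th : Thread P.bits) : Prop :=
  match th.pc with
  | .idle => True
  | .enterK slot => P.variant = .hyalineS ∧ th.active = false ∧ slot < k
  | .enterAck slot _ k' =>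
      P.variant = .hyalineS ∧ th.active = false ∧ slot < k' ∧ k' ≤ k ∧ SlotCount P k'
  | .growDir _ k' | .growK k' =>
      P.variant = .hyalineS ∧ th.active = false ∧ k' ≤ k ∧ SlotCount P k' ∧ SlotCount P (2 * k')
  | .enterFAA slot =>
      th.active = false ∧ slot < k ∧ (P.variant.single = true → slot = P.own t)
  | .enterLoad slot | .enterCAS slot _ =>
      th.active = false ∧ slot < k ∧ P.variant.single = false
  | .leaveLoad | .leaveNext _ | .leaveCAS _ _ => th.active = true ∧ P.variant.single = false
  | .leaveSwap => th.active = true ∧ P.variant.single = true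
  | .adjLoad _ _ _ c | .adjFAA _ _ c | .freeLoad _ c | .freeNode _ _ c =>
      th.active = true ∧ c.WellFormed P
  | .travLoop _ _ | .travRef _ _ _ | .travFAA _ _ _ _ => th.active = true
  | .travAck _ => th.active = true ∧ P.variant = .hyalineS
  | .retInit r | .retSlot r => th.active = true ∧ r.WellFormed P ∧ r.i ≤ r.k
  | .retAccess r _ => th.active = true ∧ r.WellFormed P ∧ r.i < r.k
  -- The test of `HRef` is a fact about the value read; as the CAS compares the whole tuple, a
  -- successful insertion finds a thread inside the slot.
  | .retLink r hd | .retCAS r hd => th.active = true ∧ r.WellFormed P ∧ r.i < r.k ∧ hd.href ≠ 0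
  | .retAdvance r _ => th.active = true ∧ r.WellFormed P ∧ r.i < r.k
  | .retAck r _ =>
      th.active = true ∧ r.WellFormed P ∧ r.i < r.k ∧ P.variant = .hyalineS
  | .derefAccess _ => th.active = true
  | .derefNode _ a | .derefEra _ a _ => th.active = true ∧ a ≤ era
  | .touchLoad _ e => th.active = true ∧ e ≤ era
  -- The strict inequality makes a successful comparison raise the access era.
  | .touchCAS _ e a => th.active = true ∧ e ≤ era ∧ a < e
  | .initTest _ | .initFAA _ | .initBirth _ => True

/-- An active thread has a valid slot. -/
def SlotWellFormed (P : Params) (t : Fin P.threads) (th : Thread P.bits) : Prop :=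
  th.active = true → th.slot < P.kmax ∧ (P.variant.single = true → th.slot = P.own t)

/-- The invariants of the control flow. -/
structure State.WellFormed (s : State P) : Prop where
  slotCount : SlotCount P s.k
  fixed : P.variant ≠ .hyalineS → s.k = P.kmin
  access_le : ∀ i, s.accesses i ≤ s.allocEra
  pc : ∀ t, PcWellFormed P s.k s.allocEra t (s.thr t)
  slot : ∀ t, SlotWellFormed P t (s.thr t)

theorem SlotCount.le_kmax {k : ℕ} (h : SlotCount P k) : k ≤ P.kmax := by
  obtain ⟨j, hj, rfl⟩ := h
  exact Nat.mul_le_mul_left _ (Nat.pow_le_pow_right (by norm_num) (by omega))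

/-- The logarithm in the test of `enterAck` recovers the exponent `j` of `k = kmin * 2 ^ j`, so the
test says that the directory has an entry for `j + 1`. -/
theorem SlotCount.two_mul {k : ℕ} (hP : P.Valid) (h : SlotCount P k)
    (hlog : Nat.log 2 (k / P.kmin) + 1 < P.dirSize) : SlotCount P (2 * k) := by
  obtain ⟨j, hj, rfl⟩ := h
  rw [Nat.mul_div_cancel_left _ hP.kmin_pos, Nat.log_pow (by norm_num)] at hlog
  exact ⟨j + 1, hlog, by ring⟩

theorem PcWellFormed.mono {k k' e e' : ℕ} {t : Fin P.threads} {th : Thread P.bits}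
    (h : PcWellFormed P k e t th) (hk : k ≤ k') (he : e ≤ e') : PcWellFormed P k' e' t th := by
  unfold PcWellFormed at *
  split at h <;> simp_all <;> omega

theorem single_false_of_hyalineS (h : P.variant = .hyalineS) : P.variant.single = false := by
  rw [h]; rfl

/-- The facts about the other threads are upper bounds by the number of slots and the global era,
both of which only grow. -/
theorem State.WellFormed.of_step {s s' : State P} {t : Fin P.threads} (hs : s.WellFormed)
    (hk : s.k ≤ s'.k) (hcount : SlotCount P s'.k) (hfix : P.variant ≠ .hyalineS → s'.k = P.kmin)
    (he : s.allocEra ≤ s'.allocEra) (hacc : ∀ i, s'.accesses i ≤ s'.allocEra)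
    (hother : ∀ t', t' ≠ t → s'.thr t' = s.thr t')
    (hpc : PcWellFormed P s'.k s'.allocEra t (s'.thr t)) (hslot : SlotWellFormed P t (s'.thr t)) :
    s'.WellFormed where
  slotCount := hcount
  fixed := hfix
  access_le := hacc
  pc t' := by
    by_cases h : t' = t
    · subst h; exact hpc
    · rw [hother t' h]; exact (hs.pc t').mono hk he
  slot t' := by
    by_cases h : t' = t
    · subst h; exact hslot
    · rw [hother t' h]; exact hs.slot t'

/-- A step that changes nothing but the program counter, as far as the control flow is
concerned. -/
theorem State.WellFormed.of_pc {s s' : State P} {t : Fin P.threads} (hs : s.WellFormed)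
    (hk : s'.k = s.k) (he : s'.allocEra = s.allocEra) (ha : s'.accesses = s.accesses)
    (hother : ∀ t', t' ≠ t → s'.thr t' = s.thr t')
    (hpc : PcWellFormed P s.k s.allocEra t (s'.thr t)) (hslot : SlotWellFormed P t (s'.thr t)) :
    s'.WellFormed :=
  hs.of_step hk.ge (hk ▸ hs.slotCount) (hk ▸ hs.fixed) he.ge (by rw [ha, he]; exact hs.access_le)
    hother (by rw [hk, he]; exact hpc) hslot

theorem init_wellFormed (hP : P.Valid) : (init P).WellFormed where
  slotCount := ⟨0, hP.dir_pos, by simp [init]⟩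
  fixed _ := rfl
  access_le _ := by simp [init]
  pc t := by simp [init, PcWellFormed]
  slot t := by simp [init, SlotWellFormed]

theorem resume_wellFormed {s s₀ : State P} {t : Fin P.threads} (hs : s₀.WellFormed)
    (hk : s.k = s₀.k) (he : s.allocEra = s₀.allocEra) (ha : s.accesses = s₀.accesses)
    (ht : s.thr = s₀.thr) {c : Cont P.bits} (hact : (s₀.thr t).active = true)
    (hc : c.WellFormed P) : (s.resume t c).WellFormed := by
  have h2 := hs.slot t
  cases c <;> simp only [State.resume, State.endTraverse] <;> (try split_ifs) <;>
  refine hs.of_pc (t := t) ?_ ?_ ?_ ?_ ?_ ?_ <;>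
  simp_all [State.goto, State.setThread, State.finishLeave, PcWellFormed, Cont.WellFormed,
    SlotWellFormed]
  simp_all [RLocals.WellFormed]

theorem code_wellFormed (hP : P.Valid) {s : State P} {t : Fin P.threads} (hs : s.WellFormed) :
    (code P s t).WellFormed := by
  have h1 := hs.pc t
  have h2 := hs.slot t
  have h3 := hs.access_le
  have h4 := hs.slotCount
  rcases hpc : (s.thr t).pc
  case growK k =>
    simp only [code, hpc]
    simp only [PcWellFormed, hpc] at h1
    -- The search resumes at slot `k`. It exists because the number of slots is now `2 * k` with `k
    -- > 0`, or because the number was already larger than `k`.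
    have hk0 : 0 < k := by
      obtain ⟨j, hj, h⟩ := h1.2.2.2.1
      have := hP.kmin_pos
      rw [h]; positivity
    split_ifs with hk
    · refine hs.of_step (t := t) ?_ ?_ ?_ ?_ ?_ ?_ ?_ ?_ <;>
        simp_all [State.goto, State.setThread, PcWellFormed, SlotWellFormed]
    · refine hs.of_pc (t := t) ?_ ?_ ?_ ?_ ?_ ?_ <;>
        simp_all [State.goto, State.setThread, PcWellFormed, SlotWellFormed]
      omega
  case initFAA a =>
    simp only [code, hpc]
    refine hs.of_step (t := t) ?_ ?_ ?_ ?_ ?_ ?_ ?_ ?_ <;>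
      simp_all [State.goto, State.setThread, PcWellFormed, SlotWellFormed]
    · exact hs.fixed
    · intro i; have := h3 i; omega
  case touchCAS loc era access =>
    simp only [code, hpc]
    simp only [PcWellFormed, hpc] at h1
    split_ifs with hk
    · refine hs.of_step (t := t) ?_ ?_ ?_ ?_ ?_ ?_ ?_ ?_ <;>
        simp_all [State.goto, State.setThread, PcWellFormed, SlotWellFormed]
      · exact hs.fixed
      · intro i; rw [Function.update_apply]; split_ifs <;> simp [*]
    · refine hs.of_pc (t := t) ?_ ?_ ?_ ?_ ?_ ?_ <;>
        simp_all [State.goto, State.setThread, PcWellFormed, SlotWellFormed]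
  case leaveCAS hd next =>
    simp only [PcWellFormed, hpc] at h1
    simp only [code, hpc]
    split_ifs with hk h5
    · split
      · refine hs.of_pc (t := t) ?_ ?_ ?_ ?_ ?_ ?_ <;>
          simp_all [State.goto, State.setThread, State.setHead, PcWellFormed, SlotWellFormed,
            Cont.WellFormed]
      · exact resume_wellFormed hs (by rfl) (by rfl) (by rfl) (by rfl) h1.1 (by simp [Cont.WellFormed])
    · split <;> exact resume_wellFormed hs (by rfl) (by rfl) (by rfl) (by rfl) h1.1 (by simp [Cont.WellFormed])
    · refine hs.of_pc (t := t) ?_ ?_ ?_ ?_ ?_ ?_ <;>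
        simp_all [State.goto, State.setThread, PcWellFormed, SlotWellFormed]
  case adjFAA ref val c =>
    simp only [PcWellFormed, hpc] at h1
    simp only [code, hpc]
    split_ifs with hk
    · refine hs.of_pc (t := t) ?_ ?_ ?_ ?_ ?_ ?_ <;>
        simp_all [State.goto, State.setThread, State.addNRef, State.setNode, PcWellFormed,
          SlotWellFormed]
    · exact resume_wellFormed hs (by rfl) (by rfl) (by rfl) (by rfl) h1.1 h1.2
  case freeNode first cur c =>
    simp only [PcWellFormed, hpc] at h1
    simp only [code, hpc]
    split_ifs with hk
    · refine hs.of_pc (t := t) ?_ ?_ ?_ ?_ ?_ ?_ <;>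
        simp_all [State.goto, State.setThread, PcWellFormed, SlotWellFormed]
    · exact resume_wellFormed hs (by rfl) (by rfl) (by rfl) (by rfl) h1.1 h1.2
  case travLoop next counter =>
    simp only [PcWellFormed, hpc] at h1
    cases next <;> simp only [code, hpc, State.endTraverse] <;> (try split_ifs) <;>
    refine hs.of_pc (t := t) ?_ ?_ ?_ ?_ ?_ ?_ <;>
        simp_all [State.goto, State.setThread, State.finishLeave, PcWellFormed, SlotWellFormed]
  case travFAA curr next ref counter =>
    simp only [PcWellFormed, hpc] at h1
    simp only [code, hpc]
    split_ifs with hk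
    · refine hs.of_pc (t := t) ?_ ?_ ?_ ?_ ?_ ?_ <;>
        simp_all [State.goto, State.setThread, State.addNRef, State.setNode, PcWellFormed,
          SlotWellFormed, Cont.WellFormed]
    · exact resume_wellFormed hs (by rfl) (by rfl) (by rfl) (by rfl) h1 (by simp [Cont.WellFormed])
  case retAdvance r hd =>
    simp only [PcWellFormed, hpc] at h1
    simp only [code, hpc]
    split_ifs with h5
    · refine hs.of_pc (t := t) ?_ ?_ ?_ ?_ ?_ ?_ <;>
        simp_all [State.goto, State.setThread, PcWellFormed, SlotWellFormed,
          RLocals.WellFormed]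
      · exact ⟨h1.2.1.2.1 ▸ h1.2.1.1, h1.2.1.2.1 ▸ h1.2.2⟩
      · exact h2.2 ▸ h2.1
    · split
      · refine hs.of_pc (t := t) ?_ ?_ ?_ ?_ ?_ ?_ <;>
          simp_all [State.goto, State.setThread, PcWellFormed, SlotWellFormed,
            RLocals.WellFormed, Cont.WellFormed]
      · refine resume_wellFormed (s₀ := s) (c := .slot _ _) hs rfl rfl rfl rfl h1.1 ?_
        simp_all [Cont.WellFormed, RLocals.WellFormed]
  case enterAck slot tries k =>
    simp only [PcWellFormed, hpc] at h1
    have hn := single_false_of_hyalineS h1.1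
    simp only [code, hpc]
    split_ifs with h5 h6 h7
    · refine hs.of_pc (t := t) ?_ ?_ ?_ ?_ ?_ ?_ <;>
        simp_all [State.goto, State.setThread, SlotWellFormed, enterPC]
      split_ifs <;> simp_all [PcWellFormed] <;> omega
    · refine hs.of_pc (t := t) ?_ ?_ ?_ ?_ ?_ ?_ <;>
        simp_all [State.goto, State.setThread, SlotWellFormed, PcWellFormed]
      exact Nat.mod_lt _ (by omega)
    · refine hs.of_pc (t := t) ?_ ?_ ?_ ?_ ?_ ?_ <;>
        simp_all [State.goto, State.setThread, SlotWellFormed, PcWellFormed]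
      exact SlotCount.two_mul hP h1.2.2.2.2 h7
    · refine hs.of_pc (t := t) ?_ ?_ ?_ ?_ ?_ ?_ <;>
        simp_all [State.goto, State.setThread, SlotWellFormed, enterPC]
      split_ifs <;> simp_all [PcWellFormed] <;> omega
  all_goals
    simp only [PcWellFormed, hpc] at h1
    simp only [code, hpc]
    (try split_ifs) <;>
    refine hs.of_pc (t := t) ?_ ?_ ?_ ?_ ?_ ?_ <;>
        simp_all [State.goto, State.setThread, State.setNode, State.setHead, State.skipSlot,
          State.finishLeave, State.finishEnter, PcWellFormed, SlotWellFormed, Cont.WellFormed,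
          RLocals.WellFormed]
  all_goals try (have := h4.le_kmax; omega)

theorem step_wellFormed (hP : P.Valid) {s s' : State P} {t : Fin P.threads}
    (h : Step P s t s') (hs : s.WellFormed) : s'.WellFormed := by
  have h2 := hs.slot t
  have h4 := hs.slotCount
  cases h
  case run => exact code_wellFormed hP hs
  case callEnter slot hpc hact hslot hown =>
    refine hs.of_pc (t := t) ?_ ?_ ?_ ?_ ?_ ?_ <;>
      simp_all [State.goto, State.setThread, SlotWellFormed, enterPC]
    split_ifs <;> simp_all [PcWellFormed]
  case callRetire l hpc hact hnodup hlen hlive =>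
    refine hs.of_pc (t := t) ?_ ?_ ?_ ?_ ?_ ?_ <;>
      simp_all [State.goto, State.setThread, SlotWellFormed, PcWellFormed, startRetire,
        RLocals.WellFormed]
    intro h; apply hs.fixed; intro h'; simp [h', Variant.single] at h
  all_goals
    refine hs.of_pc (t := t) ?_ ?_ ?_ ?_ ?_ ?_ <;>
      simp_all [State.goto, State.setThread, State.setNode, SlotWellFormed, PcWellFormed]
  all_goals try split_ifs <;> simp_all

theorem Execution.wellFormed (hP : P.Valid) {σ : ℕ → State P} {τ : ℕ → Fin P.threads}
    (h : Execution P σ τ) (i : ℕ) : (σ i).WellFormed := by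
  induction i with
  | zero => rw [h.start]; exact init_wellFormed hP
  | succ i ih => exact step_wellFormed hP (h.step i) ih

/-! ## What a step changes -/

@[simp] theorem goto_thr_self (s : State P) (t : Fin P.threads) (pc : PC P.bits) :
    (s.goto t pc).thr t = { s.thr t with pc := pc } := by simp [State.goto, State.setThread]

theorem goto_thr_ne (s : State P) {t t' : Fin P.threads} (h : t' ≠ t) (pc : PC P.bits) :
    (s.goto t pc).thr t' = s.thr t' := by simp [State.goto, State.setThread, h]

theorem resume_thr_ne (s : State P) {t t' : Fin P.threads} (h : t' ≠ t) (c : Cont P.bits) :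
    (s.resume t c).thr t' = s.thr t' := by
  cases c <;> simp only [State.resume, State.endTraverse] <;> (try split_ifs) <;>
    simp [State.goto, State.setThread, State.finishLeave, h]

/-- `resume` changes nothing but the program counter of the thread and the flag `active`. -/
theorem resume_fields (s : State P) (t : Fin P.threads) (c : Cont P.bits) :
    (s.resume t c).heads = s.heads ∧ (s.resume t c).accesses = s.accesses ∧
      (s.resume t c).allocEra = s.allocEra ∧ (s.resume t c).k = s.k ∧
      (s.resume t c).node = s.node ∧ (s.resume t c).status = s.status := by
  cases c <;> simp only [State.resume, State.endTraverse] <;> (try split_ifs) <;>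
    simp [State.goto, State.setThread, State.finishLeave]

@[simp] theorem resume_heads (s : State P) (t : Fin P.threads) (c : Cont P.bits) :
    (s.resume t c).heads = s.heads := (resume_fields s t c).1
@[simp] theorem resume_accesses (s : State P) (t : Fin P.threads) (c : Cont P.bits) :
    (s.resume t c).accesses = s.accesses := (resume_fields s t c).2.1
@[simp] theorem resume_allocEra (s : State P) (t : Fin P.threads) (c : Cont P.bits) :
    (s.resume t c).allocEra = s.allocEra := (resume_fields s t c).2.2.1
@[simp] theorem resume_k (s : State P) (t : Fin P.threads) (c : Cont P.bits) :
    (s.resume t c).k = s.k := (resume_fields s t c).2.2.2.1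
@[simp] theorem resume_node (s : State P) (t : Fin P.threads) (c : Cont P.bits) :
    (s.resume t c).node = s.node := (resume_fields s t c).2.2.2.2.1
@[simp] theorem resume_status (s : State P) (t : Fin P.threads) (c : Cont P.bits) :
    (s.resume t c).status = s.status := (resume_fields s t c).2.2.2.2.2

theorem Step.thr_ne {s s' : State P} {t t' : Fin P.threads} (h : Step P s t s') (hne : t' ≠ t) :
    s'.thr t' = s.thr t' := by
  cases h
  case run =>
    rcases hpc : (s.thr t).pc <;> simp only [code, hpc]
    case travLoop next counter =>
      cases next <;> simp only [State.endTraverse] <;> (try split_ifs) <;>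
        simp [State.goto, State.setThread, State.finishLeave, hne]
    all_goals
      (try split_ifs) <;> (try split) <;>
      simp [State.goto, State.setThread, State.setNode, State.setHead, State.addNRef,
        State.skipSlot, State.finishLeave, State.finishEnter, resume_thr_ne _ hne, hne]
  all_goals simp [State.goto, State.setThread, State.setNode, hne]

theorem Step.heads_change {s s' : State P} {t : Fin P.threads} (h : Step P s t s') {slot : ℕ}
    (hne : s'.heads slot ≠ s.heads slot) : HeadCommit s t slot := by
  revert hne
  cases h
  case run =>
    rcases hpc : (s.thr t).pc <;> simp only [code, hpc]
    case travLoop next counter =>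
      cases next <;> simp only [State.endTraverse] <;> (try split_ifs) <;>
        simp [State.goto, State.setThread, State.finishLeave]
    all_goals
      (try split_ifs) <;> (try split) <;>
      simp [State.goto, State.setThread, State.setNode, State.setHead, State.addNRef,
        State.skipSlot, State.finishLeave, State.finishEnter, Function.update_apply] <;>
      intros <;> subst_vars <;>
      simp [HeadCommit, EnterCommit, LeaveCommit, InsertCommit, hpc]
  all_goals simp [State.goto, State.setThread, State.setNode]

theorem Step.accesses_change {s s' : State P} {t : Fin P.threads} (h : Step P s t s') {slot : ℕ}
    (hne : s'.accesses slot ≠ s.accesses slot) : TouchCommit s t slot := by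
  revert hne
  cases h
  case run =>
    rcases hpc : (s.thr t).pc <;> simp only [code, hpc]
    case travLoop next counter =>
      cases next <;> simp only [State.endTraverse] <;> (try split_ifs) <;>
        simp [State.goto, State.setThread, State.finishLeave]
    all_goals
      (try split_ifs) <;> (try split) <;>
      simp [State.goto, State.setThread, State.setNode, State.setHead, State.addNRef,
        State.skipSlot, State.finishLeave, State.finishEnter, Function.update_apply] <;>
      intros <;> subst_vars <;>
      simp_all [TouchCommit]
  all_goals simp [State.goto, State.setThread, State.setNode]

theorem Step.allocEra_eq {s s' : State P} {t : Fin P.threads} (h : Step P s t s')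
    (hne : ¬ EraAdvance s t) : s'.allocEra = s.allocEra := by
  revert hne
  cases h
  case run =>
    rcases hpc : (s.thr t).pc <;> simp only [code, hpc]
    case travLoop next counter =>
      cases next <;> simp only [State.endTraverse] <;> (try split_ifs) <;>
        simp [State.goto, State.setThread, State.finishLeave]
    all_goals
      (try split_ifs) <;> (try split) <;>
      simp [State.goto, State.setThread, State.setNode, State.setHead, State.addNRef,
        State.skipSlot, State.finishLeave, State.finishEnter, EraAdvance, hpc]
  all_goals simp [State.goto, State.setThread, State.setNode]

theorem Step.k_le {s s' : State P} {t : Fin P.threads} (h : Step P s t s') : s.k ≤ s'.k := by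
  cases h
  case run =>
    rcases hpc : (s.thr t).pc <;> simp only [code, hpc]
    case travLoop next counter =>
      cases next <;> simp only [State.endTraverse] <;> (try split_ifs) <;>
        simp [State.goto, State.setThread, State.finishLeave]
    all_goals
      (try split_ifs) <;> (try split) <;>
      simp [State.goto, State.setThread, State.setNode, State.setHead, State.addNRef,
        State.skipSlot, State.finishLeave, State.finishEnter]
    omega
  all_goals simp [State.goto, State.setThread, State.setNode]

/-- In the variants with shared slots, access eras do not decrease, and a successful `touch`
increases one. -/
theorem Step.accesses_mono {s s' : State P} {t : Fin P.threads} (hs : s.WellFormed)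
    (h : Step P s t s') (hsingle : P.variant.single = false) (slot : ℕ) :
    s.accesses slot ≤ s'.accesses slot := by
  by_cases hne : s'.accesses slot = s.accesses slot
  · exact hne.ge
  · obtain ⟨h1, loc, era, access, hpc, h2⟩ := h.accesses_change hne
    have h3 := hs.pc t
    simp only [PcWellFormed, hpc] at h3
    simp only [hsingle, Bool.false_eq_true, false_or] at h2
    cases h
    case run => simp [code, hpc, State.goto, State.setThread, ← h1, h2]; omega
    all_goals simp_all

/-! ## Failures of compare-and-swap -/

/-- `pending` says that a thread has read the value `v` from the location of `slot` and will
compare the location with `v`. If such a comparison is always preceded by a load, without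
modifications by the same thread in between, then a failure is caused by another thread. -/
theorem failureImpliesProgress_of {α : Type*} {σ : ℕ → State P} {τ : ℕ → Fin P.threads}
    (hσ : Execution P σ τ) {fail load commit : State P → Fin P.threads → ℕ → Prop}
    (val : State P → ℕ → α) (pending : Thread P.bits → ℕ → α → Prop)
    (hidle : ∀ th slot v, th.pc = .idle → ¬ pending th slot v)
    (hstep : ∀ s t s' slot v, Step P s t s' → pending (s'.thr t) slot v →
      (load s t slot ∧ val s slot = v) ∨
        (pending (s.thr t) slot v ∧ ¬ load s t slot ∧ ¬ commit s t slot))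
    (hfail : ∀ s t slot, fail s t slot → ∃ v, pending (s.thr t) slot v ∧ val s slot ≠ v)
    (hchange : ∀ s t s' slot, Step P s t s' → val s' slot ≠ val s slot → commit s t slot)
    (hload : ∀ s t slot, load s t slot → ¬ commit s t slot) :
    FailureImpliesProgress σ τ fail load commit := by
  -- A pending value is traced back to the load that produced it; since then the thread has neither
  -- loaded nor modified the location.
  have key : ∀ j t slot v, pending ((σ j).thr t) slot v →
      ∃ i < j, τ i = t ∧ load (σ i) t slot ∧ val (σ i) slot = v ∧
        ∀ q, i < q → q < j → τ q = t → ¬ load (σ q) t slot ∧ ¬ commit (σ q) t slot := by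
    intro j
    induction j with
    | zero =>
      intro t slot v h
      exact absurd h (hidle _ _ _ (by rw [hσ.start]; rfl))
    | succ j ih =>
      intro t slot v h
      by_cases htj : τ j = t
      · subst htj
        rcases hstep _ _ _ _ _ (hσ.step j) h with ⟨h1, h2⟩ | ⟨h1, h2, h3⟩
        · exact ⟨j, by omega, rfl, h1, h2, by omega⟩
        · obtain ⟨i, hij, h4, h5, h6, h7⟩ := ih _ _ _ h1
          refine ⟨i, by omega, h4, h5, h6, fun q hq1 hq2 hq3 => ?_⟩
          rcases Nat.lt_or_ge q j with hq | hq
          · exact h7 q hq1 hq hq3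
          · obtain rfl : q = j := by omega
            exact ⟨h2, h3⟩
      · rw [(hσ.step j).thr_ne (Ne.symm htj)] at h
        obtain ⟨i, hij, h4, h5, h6, h7⟩ := ih _ _ _ h
        refine ⟨i, by omega, h4, h5, h6, fun q hq1 hq2 hq3 => ?_⟩
        rcases Nat.lt_or_ge q j with hq | hq
        · exact h7 q hq1 hq hq3
        · obtain rfl : q = j := by omega
          exact absurd hq3 htj
  intro j slot hf
  obtain ⟨v, hv, hne⟩ := hfail _ _ _ hf
  obtain ⟨i, hij, h4, h5, h6, h7⟩ := key j _ _ _ hv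
  refine ⟨i, hij, h4, by rw [h4]; exact h5, fun q h1 h2 h3 => by rw [h3]; exact (h7 q h1 h2 h3).1,
    ?_⟩
  by_contra hcon
  push Not at hcon
  -- Without a commit of another thread the location keeps the loaded value up to the comparison:
  -- the step `i` is a load and hence no commit, and the thread itself makes none later.
  have hconst : ∀ m, i ≤ m → m ≤ j → val (σ m) slot = v := by
    intro m hm
    induction m, hm using Nat.le_induction with
    | base => intro _; exact h6
    | succ m him ih =>
      intro hmj
      rw [← ih (by omega)]
      by_contra hne'
      have hc := hchange _ _ _ _ (hσ.step m) hne'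
      rcases Nat.eq_or_lt_of_le him with rfl | him'
      · exact hload _ _ _ (by rw [h4]; exact h5) hc
      · by_cases hm : τ m = τ j
        · exact (h7 m him' (by omega) hm).2 (hm ▸ hc)
        · exact hcon m him' (by omega) hm hc
  exact hne (hconst j hij.le le_rfl)

/-- The thread has read `hd` from the head of `slot` and will compare the head with it. -/
def HeadPending (th : Thread P.bits) (slot : ℕ) (hd : Head) : Prop :=
  th.pc = .enterCAS slot hd ∨
    (slot = th.slot ∧ (th.pc = .leaveNext hd ∨ ∃ next, th.pc = .leaveCAS hd next)) ∨
    ∃ r, r.i = slot ∧ (th.pc = .retAccess r hd ∨ th.pc = .retLink r hd ∨ th.pc = .retCAS r hd)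

/-- Between load and CAS, `leave` reads `Next`, and `retire` reads the access era and writes the
link of its node. The value stays pending through these steps, none of which touches a head. -/
theorem headFail_progress {σ : ℕ → State P} {τ : ℕ → Fin P.threads} (hσ : Execution P σ τ) :
    FailureImpliesProgress σ τ HeadFail HeadLoad HeadCommit := by
  refine failureImpliesProgress_of hσ (fun s slot => s.heads slot) HeadPending ?_ ?_ ?_ ?_ ?_
  · intro th slot v h; simp [HeadPending, h]
  · intro s t s' slot v h
    cases h
    case run =>
      rcases hpc : (s.thr t).pc <;> simp only [code, hpc]
      case travLoop next counter =>
        cases next <;> simp only [State.endTraverse] <;> (try split_ifs) <;>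
          simp [State.setThread, State.finishLeave, HeadPending]
      case adjFAA ref val c =>
        split_ifs <;> (try cases c) <;>
          (try simp only [State.resume, State.endTraverse]) <;> (try split_ifs) <;>
          simp [State.setThread, State.finishLeave, HeadPending]
      case freeNode ref val c =>
        split_ifs <;> (try cases c) <;>
          (try simp only [State.resume, State.endTraverse]) <;> (try split_ifs) <;>
          simp [State.setThread, State.finishLeave, HeadPending]
      all_goals
        (try split_ifs) <;> (try split) <;>
        (try simp only [State.resume, State.endTraverse]) <;> (try split_ifs) <;>
        simp [State.setThread, State.setNode, State.setHead, State.addNRef,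
          State.skipSlot, State.finishLeave, State.finishEnter, HeadPending, HeadLoad,
          HeadCommit, EnterCommit, LeaveCommit, InsertCommit, hpc, enterPC, State.goto] <;>
        (try split_ifs) <;> intros <;> subst_vars <;> simp_all
    case callEnter =>
      simp only [goto_thr_self, enterPC, HeadPending]; split_ifs <;> simp
    case callLeave =>
      simp only [goto_thr_self, HeadPending]; split_ifs <;> simp
    case write hpc => simp [HeadPending, hpc]
    case malloc hpc _ => simp [HeadPending, hpc, State.setNode]
    all_goals simp [HeadPending]
  · rintro s t slot ⟨hd, h1, h2⟩
    refine ⟨hd, ?_, h1⟩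
    rcases h2 with h | ⟨h, next, h'⟩ | ⟨r, h, h'⟩
    · exact Or.inl h
    · exact Or.inr (Or.inl ⟨h, Or.inr ⟨next, h'⟩⟩)
    · exact Or.inr (Or.inr ⟨r, h, Or.inr (Or.inr h')⟩)
  · intro s t s' slot h hne; exact h.heads_change hne
  · rintro s t slot (h | ⟨-, h⟩ | ⟨r, -, -, h⟩) <;>
      simp [HeadCommit, EnterCommit, LeaveCommit, InsertCommit, h]

/-- The thread has read `a` from the access era of `slot` and will compare it with it. -/
def TouchPending (th : Thread P.bits) (slot : ℕ) (a : ℕ) : Prop :=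
  slot = th.slot ∧ ∃ loc era, th.pc = .touchCAS loc era a

/-- Here the load and the CAS are consecutive steps of the thread, so only `touchCAS` carries a
pending value. -/
theorem touchFail_progress {σ : ℕ → State P} {τ : ℕ → Fin P.threads} (hσ : Execution P σ τ) :
    FailureImpliesProgress σ τ TouchFail TouchLoad TouchCommit := by
  refine failureImpliesProgress_of hσ (fun s slot => s.accesses slot) TouchPending ?_ ?_ ?_ ?_ ?_
  · intro th slot v h; simp [TouchPending, h]
  · intro s t s' slot v h
    cases h
    case run =>
      rcases hpc : (s.thr t).pc <;> simp only [code, hpc]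
      case travLoop next counter =>
        cases next <;> simp only [State.endTraverse] <;> (try split_ifs) <;>
          simp [State.setThread, State.finishLeave, TouchPending]
      case adjFAA ref val c =>
        split_ifs <;> (try cases c) <;>
          (try simp only [State.resume, State.endTraverse]) <;> (try split_ifs) <;>
          simp [State.setThread, State.finishLeave, TouchPending]
      case freeNode ref val c =>
        split_ifs <;> (try cases c) <;>
          (try simp only [State.resume, State.endTraverse]) <;> (try split_ifs) <;>
          simp [State.setThread, State.finishLeave, TouchPending]
      all_goals
        (try split_ifs) <;> (try split) <;>
        (try simp only [State.resume, State.endTraverse]) <;> (try split_ifs) <;>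
        simp [State.setThread, State.setNode, State.setHead, State.addNRef,
          State.skipSlot, State.finishLeave, State.finishEnter, TouchPending, TouchLoad,
          hpc, enterPC, State.goto] <;>
        (try split_ifs) <;> intros <;> subst_vars <;> simp_all
    case callEnter =>
      simp only [goto_thr_self, enterPC, TouchPending]; split_ifs <;> simp
    case callLeave =>
      simp only [goto_thr_self, TouchPending]; split_ifs <;> simp
    case write hpc => simp [TouchPending, hpc]
    case malloc hpc _ => simp [TouchPending, hpc, State.setNode]
    all_goals simp [TouchPending]
  · rintro s t slot ⟨h1, h2, loc, era, access, h3, h4⟩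
    exact ⟨access, ⟨h1, loc, era, h3⟩, h4⟩
  · intro s t s' slot h hne; exact h.accesses_change hne
  · rintro s t slot ⟨h1, loc, era, h2⟩
    simp [TouchCommit, h2]

/-! ## Termination of `deref` -/

/-- The least value taken from `M` on would be undercut by any later strict descent. All termination
arguments below end here, with ranks that steps of other threads leave unchanged. -/
theorem not_frequently_descending {α : Type*} [LinearOrder α] [WellFoundedLT α] {f : ℕ → α}
    {M : ℕ} (hmono : ∀ q, M ≤ q → f (q + 1) ≤ f q) : ¬ ∃ᶠ q in atTop, f (q + 1) < f q := by
  intro hfreq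
  obtain ⟨q₀, hq₀, hmin⟩ := (wellFounded_lt (α := α)).has_min (f '' Set.Ici M) ⟨_, M, Set.self_mem_Ici, rfl⟩
  obtain ⟨q₁, hq₁, rfl⟩ := hq₀
  obtain ⟨q, hq, hlt⟩ := (frequently_atTop.1 hfreq) q₁
  have hle : ∀ p, q₁ ≤ p → f p ≤ f q₁ := by
    intro p hp
    induction p, hp using Nat.le_induction with
    | base => exact le_rfl
    | succ p hp ih => exact (hmono p (le_trans hq₁ hp)).trans ih
  exact hmin _ ⟨q + 1, Set.mem_Ici.2 (by have : M ≤ q₁ := hq₁; omega), rfl⟩ (hlt.trans_le (hle q hq))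

/-- A bounded sequence of numbers that does not decrease is eventually constant. -/
theorem eventually_constant_of_le {f : ℕ → ℕ} {M b : ℕ} (hmono : ∀ q, M ≤ q → f q ≤ f (q + 1))
    (hb : ∀ q, M ≤ q → f q ≤ b) : ∀ᶠ q in atTop, f (q + 1) = f q := by
  by_contra h
  -- Each strict increase of `f` shortens the distance to the bound.
  refine not_frequently_descending (f := fun q => b - f q) (M := M)
    (fun q hq => Nat.sub_le_sub_left (hmono q hq) b) ?_
  refine ((not_eventually.1 h).and_eventually (eventually_ge_atTop M)).mono fun q hq => ?_
  have h1 := hmono q hq.2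
  have h2 := hb (q + 1) (by omega)
  have h3 := hq.1
  show b - f (q + 1) < b - f q
  omega

theorem eventually_eq_of_step {α : Type*} {f : ℕ → α} (h : ∀ᶠ q in atTop, f (q + 1) = f q) :
    ∃ c, ∀ᶠ q in atTop, f q = c := by
  obtain ⟨M, hM⟩ := eventually_atTop.1 h
  refine ⟨f M, eventually_atTop.2 ⟨M, fun q hq => ?_⟩⟩
  induction q, hq using Nat.le_induction with
  | base => rfl
  | succ q hq ih => rw [hM q hq, ih]

theorem Step.inDeref {s s' : State P} {t : Fin P.threads} (h : Step P s t s')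
    (hd : InDeref s t) : InDeref s' t ∨ (s'.thr t).pc = .idle := by
  have hne : (s.thr t).pc ≠ .idle := by
    rcases hd with ⟨_, h⟩ | ⟨_, _, h⟩ | ⟨_, _, _, h⟩ | ⟨_, _, h⟩ | ⟨_, _, _, h⟩ <;> simp [h]
  cases h
  case run =>
    rcases hd with ⟨_, h⟩ | ⟨_, _, h⟩ | ⟨_, _, _, h⟩ | ⟨_, _, h⟩ | ⟨_, _, _, h⟩ <;>
      simp only [code, h] <;> (try split_ifs) <;> simp [InDeref, State.goto, State.setThread]
  all_goals contradiction

theorem InDeref.inOperation {s : State P} {t : Fin P.threads} (hd : InDeref s t) :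
    InOperation s t := by
  rcases hd with ⟨_, h⟩ | ⟨_, _, h⟩ | ⟨_, _, _, h⟩ | ⟨_, _, h⟩ | ⟨_, _, _, h⟩ <;>
    simp [InOperation, h]

theorem InDeref.not_eraAdvance {s : State P} {t : Fin P.threads} (hd : InDeref s t) :
    ¬ EraAdvance s t := by
  rcases hd with ⟨_, h⟩ | ⟨_, _, h⟩ | ⟨_, _, _, h⟩ | ⟨_, _, h⟩ | ⟨_, _, _, h⟩ <;>
    simp [EraAdvance, h]

theorem InDeref.persists {σ : ℕ → State P} {τ : ℕ → Fin P.threads} (hσ : Execution P σ τ)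
    {t : Fin P.threads} {i j : ℕ} (hij : i ≤ j) (hd : InDeref (σ i) t)
    (hc : ∀ r, i ≤ r → r < j → ¬ Completes σ τ t r) : InDeref (σ j) t := by
  induction j, hij using Nat.le_induction with
  | base => exact hd
  | succ j hij ih =>
    have hj := ih fun r h1 h2 => hc r h1 (by omega)
    by_cases ht : τ j = t
    · have hstep := hσ.step j
      rw [ht] at hstep
      rcases hstep.inDeref hj with h | h
      · exact h
      · exact absurd ⟨ht, hj.inOperation, by simp [InOperation, h]⟩ (hc j hij (by omega))
    · have := (hσ.step j).thr_ne (Ne.symm ht)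
      simpa only [InDeref, this] using hj

/-- In an execution of `deref` after an unsuccessful comparison with the era `e`. -/
def DerefSince (e : ℕ) (pc : PC P.bits) : Prop :=
  match pc with
  | .derefNode _ a | .derefEra _ a _ | .touchLoad _ a | .touchCAS _ a _ => e ≤ a
  | _ => False

/-- `touch` returns either because the access era is already at least the requested era or after
installing that era, so the lower bound passes into the next iteration. After a new failed test the
requested era is the current global era, which is at least `e`. -/
theorem Step.derefSince {s s' : State P} {t : Fin P.threads} (h : Step P s t s') {e : ℕ}
    (hd : DerefSince e (s.thr t).pc) (he : e ≤ s.allocEra) :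
    DerefSince e (s'.thr t).pc ∨ (s'.thr t).pc = .idle := by
  cases h
  case run =>
    rcases hpc : (s.thr t).pc <;> simp only [hpc, DerefSince] at hd <;> simp only [code, hpc] <;>
      (try split_ifs) <;> simp_all [DerefSince, State.setThread]
    omega
  all_goals simp_all [DerefSince]

/-- If the global era were the same at both tests, the access era held at the second one would be at
least this era by `DerefSince`, and at most this era by `PcWellFormed`. The second test would then
succeed. -/
theorem derefRepeatImpliesAdvance (hP : P.Valid) {σ : ℕ → State P} {τ : ℕ → Fin P.threads}
    (hσ : Execution P σ τ) : DerefRepeatImpliesAdvance σ τ := by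
  intro t i j hij hi hj hri hrj hc
  by_contra hcon
  push Not at hcon
  have hind : InDeref (σ i) t := by
    obtain ⟨loc, a, nd, h, -⟩ := hri
    exact Or.inr (Or.inr (Or.inl ⟨loc, a, nd, h⟩))
  have hera : ∀ q, i ≤ q → q ≤ j → (σ q).allocEra = (σ i).allocEra := by
    intro q hq
    induction q, hq using Nat.le_induction with
    | base => intro _; rfl
    | succ q hiq ih =>
      intro hqj
      rw [← ih (by omega)]
      refine (hσ.step q).allocEra_eq fun hadv => ?_
      by_cases hq : τ q = t
      · have := InDeref.persists hσ hiq hind fun r h1 h2 => hc r h1 (by omega)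
        rw [hq] at hadv
        exact this.not_eraAdvance hadv
      · rcases Nat.eq_or_lt_of_le hiq with rfl | h
        · exact hq hi
        · exact hcon q h (by omega) hq hadv
  have hsince : ∀ q, i < q → q ≤ j → DerefSince (σ i).allocEra ((σ q).thr t).pc := by
    intro q hq
    induction q, hq using Nat.le_induction with
    | base =>
      intro _
      obtain ⟨loc, a, nd, h, hne⟩ := hri
      have hstep := hσ.step i
      rw [hi] at hstep
      generalize hs' : σ (i + 1) = s' at hstep
      cases hstep
      case run => simp [code, h, hne, DerefSince]
      all_goals simp_all
    | succ q hiq ih =>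
      intro hqj
      have h := ih (by omega)
      by_cases ht : τ q = t
      · have hstep := hσ.step q
        rw [ht] at hstep
        rcases hstep.derefSince h (hera q (by omega) (by omega)).ge with h' | h'
        · exact h'
        · refine absurd ⟨ht, ?_, by simp [InOperation, h']⟩ (hc q (by omega) (by omega))
          exact (InDeref.persists hσ (by omega) hind fun r h1 h2 => hc r h1 (by omega)).inOperation
      · rw [(hσ.step q).thr_ne (Ne.symm ht)]; exact h
  obtain ⟨loc, a, nd, h, hne⟩ := hrj
  have h1 := hsince j hij le_rfl
  have h2 := (hσ.wellFormed hP j).pc t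
  have h3 := hera j hij.le le_rfl
  simp only [h, DerefSince] at h1
  simp only [h, PcWellFormed] at h2
  omega

/-- The number of steps to the end of `deref`, if the global era is `E` and the access era of the
slot is `acc`, as long as these do not change. -/
def derefRank (P : Params) (E acc : ℕ) : PC P.bits → ℕ
  -- A complete iteration with a wrong access era runs 8, 7, 5, 4 and returns to `derefNode` with
  -- era `E`, at 2. The values 14 and 15 belong to a `touch` for an outdated era, after which one
  -- such iteration may follow. A CAS bound to fail costs 2 more, because it leads back to the load,
  -- one above the CAS that succeeds.
  | .derefAccess _ => 9
  | .derefNode _ a => if a = E then 2 else 8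
  | .derefEra _ a _ => if a = E then 1 else 7
  | .touchLoad _ e => if e = E then 5 else 15
  | .touchCAS _ e a =>
      (if e = E then 4 else 14) + (if P.variant.single = true ∨ acc = a then 0 else 2)
  | _ => 0

/-- Because access eras are at most the global era `E`, a `touch` for `E` that finds the access era
large enough finds exactly `E`. With own slots `touch` compares nothing, so `acc` plays no role
there. -/
theorem Step.derefRank_lt {s s' : State P} {t : Fin P.threads} (hs : s.WellFormed)
    (h : Step P s t s') (hd : InDeref s t) {acc : ℕ}
    (hacc : P.variant.single = false → s.accesses (s.thr t).slot = acc) :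
    derefRank P s.allocEra acc (s'.thr t).pc < derefRank P s.allocEra acc (s.thr t).pc := by
  have hw := hs.pc t
  have ha := hs.access_le (s.thr t).slot
  have hne := hd.inOperation
  cases h
  case run =>
    rcases hd with ⟨_, h⟩ | ⟨_, _, h⟩ | ⟨_, _, _, h⟩ | ⟨_, _, h⟩ | ⟨_, _, _, h⟩ <;>
      simp only [PcWellFormed, h] at hw <;>
      rcases hsing : P.variant.single <;> simp only [hsing, forall_const] at hacc <;>
      simp only [code, h] <;> (try split_ifs) <;>
      simp_all [derefRank, State.setThread] <;> (try split_ifs) <;> (try omega)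
  all_goals exact absurd ‹_› hne

theorem Step.slot_eq_of_inDeref {s s' : State P} {t : Fin P.threads} (h : Step P s t s')
    (hd : InDeref s t) : (s'.thr t).slot = (s.thr t).slot := by
  have hne := hd.inOperation
  cases h
  case run =>
    rcases hd with ⟨_, h⟩ | ⟨_, _, h⟩ | ⟨_, _, _, h⟩ | ⟨_, _, h⟩ | ⟨_, _, _, h⟩ <;>
      simp only [code, h] <;> (try split_ifs) <;> simp [State.goto, State.setThread]
  all_goals exact absurd ‹_› hne

/-- A thread that stays in `deref` keeps its slot and does not advance the era itself, so the global
era is fixed. Once the access era of the slot has settled as well, every step of the thread lowers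
`derefRank`. -/
theorem derefTerminates (hP : P.Valid) {σ : ℕ → State P} {τ : ℕ → Fin P.threads}
    (hσ : Execution P σ τ) : DerefTerminates σ τ := by
  intro t i hd hfreq hadv
  by_contra hcon
  push Not at hcon
  have hin : ∀ q, i ≤ q → InDeref (σ q) t := fun q hq =>
    InDeref.persists hσ hq hd fun r h1 _ => hcon r h1
  have hera : ∀ q, i ≤ q → (σ q).allocEra = (σ i).allocEra := by
    intro q hq
    induction q, hq using Nat.le_induction with
    | base => rfl
    | succ q hiq ih =>
      rw [← ih]
      refine (hσ.step q).allocEra_eq fun h => ?_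
      by_cases ht : τ q = t
      · exact (hin q hiq).not_eraAdvance (ht ▸ h)
      · exact hadv q hiq ht h
  have hslot : ∀ q, i ≤ q → ((σ q).thr t).slot = ((σ i).thr t).slot := by
    intro q hq
    induction q, hq using Nat.le_induction with
    | base => rfl
    | succ q hiq ih =>
      rw [← ih]
      by_cases ht : τ q = t
      · have := hσ.step q
        rw [ht] at this
        exact this.slot_eq_of_inDeref (hin q hiq)
      · rw [(hσ.step q).thr_ne (Ne.symm ht)]
  -- Only the CAS of shared slots needs a stable access era; it is monotone there and bounded by the
  -- fixed global era.
  obtain ⟨acc, M, hM⟩ : ∃ acc M, ∀ q, M ≤ q → P.variant.single = false →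
      (σ q).accesses ((σ i).thr t).slot = acc := by
    by_cases hsing : P.variant.single = false
    · obtain ⟨c, hc⟩ := eventually_eq_of_step
        (f := fun q => (σ q).accesses ((σ i).thr t).slot) (eventually_constant_of_le
        (f := fun q => (σ q).accesses ((σ i).thr t).slot) (M := i) (b := (σ i).allocEra)
        (fun q _ => (hσ.step q).accesses_mono (hσ.wellFormed hP q) hsing _)
        (fun q hq => hera q hq ▸ (hσ.wellFormed hP q).access_le _))
      obtain ⟨M, hM⟩ := eventually_atTop.1 hc
      exact ⟨c, M, fun q hq _ => hM q hq⟩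
    · exact ⟨0, 0, fun q _ h => absurd h hsing⟩
  have hlt : ∀ q, max i M ≤ q → τ q = t →
      derefRank P (σ i).allocEra acc ((σ (q + 1)).thr t).pc
        < derefRank P (σ i).allocEra acc ((σ q).thr t).pc := by
    intro q hq ht
    have hq1 : i ≤ q := le_trans (le_max_left _ _) hq
    have hq2 : M ≤ q := le_trans (le_max_right _ _) hq
    have hstep := hσ.step q
    rw [ht] at hstep
    have := hstep.derefRank_lt (hσ.wellFormed hP q) (hin q hq1) (acc := acc)
      (fun h => by rw [hslot q hq1]; exact hM q hq2 h)
    rwa [hera q hq1] at this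
  refine not_frequently_descending
    (f := fun q => derefRank P (σ i).allocEra acc ((σ q).thr t).pc) (M := max i M) ?_ ?_
  · intro q hq
    by_cases ht : τ q = t
    · exact (hlt q hq ht).le
    · simp only [(hσ.step q).thr_ne (Ne.symm ht), le_refl]
  · exact (hfreq.and_eventually (eventually_ge_atTop (max i M))).mono fun q hq => hlt q hq.2 hq.1

/-! ## Reference counts modulo `2 ^ N` -/

/-- The largest number of references that a settled slot contributes to a batch. -/
def Params.grain (P : Params) : ℕ := if P.variant.single = true then P.kmin else P.threads

/-- The number of contributions after which all references to a batch are known. -/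
def Params.total (P : Params) (k : ℕ) : ℕ := if P.variant.single = true then 1 else k

/-- What a contribution adds to `NRef` in addition to its references. -/
def Params.weight (P : Params) (k : ℕ) : UWord P.bits :=
  if P.variant.single = true then 0 else adjsOf P.bits k

theorem div_pred_pow_add_one {N m : ℕ} (h : m ≤ N) : (2 ^ N - 1) / 2 ^ m + 1 = 2 ^ (N - m) := by
  obtain ⟨d, rfl⟩ := Nat.exists_eq_add_of_le h
  rw [Nat.add_sub_cancel_left, pow_add]
  have h1 : 0 < 2 ^ m := by positivity
  have h2 : 0 < 2 ^ d := by positivity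
  have : (2 ^ m * 2 ^ d - 1) / 2 ^ m = 2 ^ d - 1 := by
    apply Nat.div_eq_of_lt_le
    · rw [Nat.sub_mul, one_mul, mul_comm]; omega
    · rw [Nat.sub_add_cancel h2, mul_comm]
      have : 0 < 2 ^ d * 2 ^ m := by positivity
      omega
  omega

/-- As `k` is a power of two below `2 ^ N`, `Adjs` is exactly `2 ^ N / k`: `k` contributions wrap
around to `0` precisely. From `n * k ^ 2 < 2 ^ N = a * k` one gets `n * k < a`, so all references
together weigh less than one `Adjs`. The thread `t` witnesses `n > 0`, which is used for `k < 2 ^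
N`. -/
theorem SlotCount.adjs {k : ℕ} (hP : P.Valid) (t : Fin P.threads) (hk : SlotCount P k)
    (hs : P.variant.single = false) :
    ∃ a : ℕ, adjsOf P.bits k = (a : UWord P.bits) ∧ a * k = 2 ^ P.bits ∧ P.threads * k < a := by
  have hle := hk.le_kmax
  obtain ⟨j, hj, rfl⟩ := hk
  obtain ⟨m, hm⟩ := hP.pow_two hs
  have hov := hP.no_overflow hs
  have hn : 0 < P.threads := t.pos
  rw [hm, ← pow_add] at hle ⊢
  set k := 2 ^ (m + j) with hkdef
  have hk0 : 0 < k := by positivity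
  have h1 : P.threads * k * k < 2 ^ P.bits := by
    refine lt_of_le_of_lt ?_ hov
    rw [mul_assoc, sq]
    exact Nat.mul_le_mul_left _ (Nat.mul_le_mul hle hle)
  have h2 : k < 2 ^ P.bits := by
    refine lt_of_le_of_lt ?_ h1
    nlinarith [Nat.mul_pos hn hk0]
  have h3 : m + j ≤ P.bits := ((Nat.pow_lt_pow_iff_right (by norm_num)).1 h2).le
  have h4 : 2 ^ (P.bits - (m + j)) * k = 2 ^ P.bits := by
    rw [hkdef, ← pow_add, Nat.sub_add_cancel h3]
  refine ⟨2 ^ (P.bits - (m + j)), ?_, h4, ?_⟩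
  · rw [adjsOf, div_pred_pow_add_one h3]
  · rw [← h4] at h1
    exact Nat.lt_of_mul_lt_mul_right h1

/-- A counter that reaches `0` after a contribution or a subtraction has received all
contributions, and all references were given up. -/
theorem zero_test (hP : P.Valid) (t : Fin P.threads) {k f R D : ℕ} (hk : SlotCount P k)
    (hk1 : P.variant.single = true → k = P.kmin) (hf : f ≤ P.total k) (hR : R ≤ P.grain * f)
    (hD : D ≤ P.grain * P.total k) (hpos : 0 < f ∨ 0 < D)
    (hz : P.weight k * (f : UWord P.bits) + (R : UWord P.bits) - (D : UWord P.bits) = 0) :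
    f = P.total k ∧ R = D := by
  by_cases hs : P.variant.single = true
  · have hlt := hP.no_overflow_single hs
    obtain rfl := hk1 hs
    simp only [Params.grain, Params.total, Params.weight, hs, if_true] at hf hR hD hz ⊢
    rw [zero_mul, zero_add] at hz
    have hz' : (((R : ℤ) - D : ℤ) : ZMod (2 ^ P.bits)) = 0 := by push_cast; exact hz
    rw [ZMod.intCast_zmod_eq_zero_iff_dvd] at hz'
    have hRk : R ≤ P.kmin := hR.trans (by simpa using Nat.mul_le_mul_left P.kmin hf)
    have hDk : D ≤ P.kmin := by simpa using hD
    have h0 : (R : ℤ) - D = 0 := by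
      refine Int.eq_zero_of_abs_lt_dvd hz' ?_
      rw [abs_lt]; push_cast
      have : (P.kmin : ℤ) < 2 ^ P.bits := by exact_mod_cast hlt
      constructor <;> omega
    have hRD : R = D := by omega
    refine ⟨?_, hRD⟩
    rcases Nat.eq_zero_or_pos f with rfl | hf0
    · omega
    · omega
  · rw [Bool.not_eq_true] at hs
    obtain ⟨a, ha, hak, hna⟩ := hk.adjs hP t hs
    simp only [Params.grain, Params.total, Params.weight, hs, Bool.false_eq_true, if_false] at hf hR hD hz ⊢
    rw [ha] at hz
    have hz' : (((a * f + R : ℤ) - D : ℤ) : ZMod (2 ^ P.bits)) = 0 := by push_cast; exact hz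
    rw [ZMod.intCast_zmod_eq_zero_iff_dvd] at hz'
    have hRk : R ≤ P.threads * k := hR.trans (Nat.mul_le_mul_left _ hf)
    have hakz : (a : ℤ) * k = 2 ^ P.bits := by exact_mod_cast hak
    have hk0 : 0 < k := by
      rcases Nat.eq_zero_or_pos k with rfl | h
      · have : 0 < 2 ^ P.bits := by positivity
        omega
      · exact h
    have haN : (a : ℤ) ≤ 2 ^ P.bits := by
      rw [← hakz]
      have : a * 1 ≤ a * k := Nat.mul_le_mul_left a hk0
      exact_mod_cast (by simpa using this)
    -- For `f = 0` the value is `-D` with `0 < D < 2 ^ N`. For `0 < f < k` the term `a * f` lies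
    -- between `a` and `2 ^ N - a`, and `R - D` is too small to reach a multiple of `2 ^ N`. For `f
    -- = k` the term `a * f` vanishes modulo `2 ^ N`, which leaves `R = D`.
    rcases Nat.eq_zero_or_pos f with rfl | hf0
    · exfalso
      have hR0 : R = 0 := by simpa using hR
      have : ((a : ℤ) * (0 : ℕ) + R - D) = 0 := by
        refine Int.eq_zero_of_abs_lt_dvd hz' ?_
        rw [abs_lt]; push_cast
        subst hR0
        constructor <;> push_cast <;> omega
      subst hR0
      push_cast at this
      omega
    · rcases Nat.lt_or_ge f k with hfk | hfk
      · exfalso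
        have h1 : a * 1 ≤ a * f := Nat.mul_le_mul_left a hf0
        have h2 : a * (f + 1) ≤ a * k := Nat.mul_le_mul_left a hfk
        have h1' : (a : ℤ) ≤ a * f := by exact_mod_cast (by simpa using h1)
        have h2' : (a : ℤ) * f + a ≤ 2 ^ P.bits := by
          rw [← hakz]
          have : ((a * (f + 1) : ℕ) : ℤ) ≤ ((a * k : ℕ) : ℤ) := by exact_mod_cast h2
          push_cast at this; linarith
        have : ((a : ℤ) * f + R - D) = 0 := by
          refine Int.eq_zero_of_abs_lt_dvd hz' ?_
          rw [abs_lt]; push_cast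
          constructor <;> omega
        omega
      · obtain rfl : f = k := le_antisymm hf hfk
        refine ⟨rfl, ?_⟩
        have h1 : ((2 ^ P.bits : ℕ) : ℤ) ∣ (R : ℤ) - D := by
          have : (R : ℤ) - D = (a * f + R - D) - ((2 ^ P.bits : ℕ) : ℤ) := by
            push_cast; rw [hakz]; ring
          rw [this]
          exact dvd_sub_self_right.2 hz'
        have : (R : ℤ) - D = 0 := by
          refine Int.eq_zero_of_abs_lt_dvd h1 ?_
          rw [abs_lt]; push_cast
          constructor <;> omega
        omega

/-! ## Auxiliary state -/

/-- The phase of a batch: handed over, but `NRef` is not initialized; counting references; being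
freed by a thread. -/
inductive Phase (P : Params) where
  | fresh
  | counting
  | freeing (t : Fin P.threads)

/-- Auxiliary state of a batch, which is identified by its counter node: the nodes that are not
freed, the number of slots, the phase, the number of contributions made to `NRef`, the number of
references in these contributions, and the number of references given up. -/
structure Batch (P : Params) where
  nodes : List Addr
  k : ℕ
  phase : Phase P
  settled : ℕ
  granted : ℕ
  dropped : ℕ

/-- Auxiliary state of a thread. `inside` holds between the modifications of the head by `enter`
and `leave`, and `todo` are the nodes that the thread has to traverse, with the first node of the
list as long as the thread is inside. The thread owes to the batch `rref`, which it retires,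
`rtok` contributions with `rowe` references, and to the batch `pref`, which it adjusts, `ptok`
contributions with `powe` references. Among the slots for the current batch, `skip` were passed
over, and `rest` are the nodes of the batch that are still unused. The thread is going to free
the nodes `frees`. -/
structure Account where
  inside : Bool
  todo : List Addr
  rref : Addr
  rtok : ℕ
  rowe : ℕ
  pref : Addr
  ptok : ℕ
  powe : ℕ
  skip : ℕ
  rest : List Addr
  frees : List Addr

/-- Auxiliary state. -/
structure Ghost (P : Params) where
  thr : Fin P.threads → Account
  batch : Addr → Batch P

/-- The contributions that a thread owes to a batch. -/
def Account.tok (x : Account) (r : Addr) : ℕ :=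
  (if x.rref = r then x.rtok else 0) + (if x.pref = r then x.ptok else 0)

/-- The references in these contributions. -/
def Account.owe (x : Account) (r : Addr) : ℕ :=
  (if x.rref = r then x.rowe else 0) + (if x.pref = r then x.powe else 0)

/-- The nodes for which the reference of the thread is counted: the first node of a list with
shared slots is not counted yet. -/
def Account.counted (P : Params) (x : Account) : List Addr :=
  -- With shared slots the references to the first node exist only as `HRef` of the head. They are
  -- credited to its batch when another node takes its place, and `leave` does not subtract for the
  -- first node either.
  if x.inside = true ∧ P.variant.single = false then x.todo.tail else x.todo

/-- The number of references of the thread to a batch. -/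
def Account.held (P : Params) (node : Addr → Node P.bits) (x : Account) (r : Addr) : ℕ :=
  (x.counted P).countP fun a => (node a).nrefNode = r

/-- The contributions that the first node of a list stands for. -/
def headTok (P : Params) (node : Addr → Node P.bits) (p : Ptr) (r : Addr) : ℕ :=
  if P.variant.single = true then 0 else
    match p with
    | none => 0
    | some a => if (node a).nrefNode = r then 1 else 0

/-- `l` is the list from `p` to the handle, along `Next`. -/
def Path {N : ℕ} (node : Addr → Node N) (handle : Ptr) : Ptr → List Addr → Prop
  | p, [] => p = none ∧ handle = none
  | p, a :: l => p = some a ∧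
      if p = handle then l = [] else Path node handle (node a).next l

/-- `l` is the rest of such a list after the node `curr`. -/
def PathAfter {N : ℕ} (node : Addr → Node N) (handle curr next : Ptr) (l : List Addr) : Prop :=
  if curr = handle then l = [] else Path node handle next l

/-- `l` is the rest of a cyclic list along `BatchNext` that starts with `first`. -/
def Ring {N : ℕ} (node : Addr → Node N) (first : Addr) : List Addr → Prop
  | [] => True
  | [a] => (node a).batchNext = first
  | a :: b :: l => (node a).batchNext = b ∧ b ≠ first ∧ Ring node first (b :: l)

/-- The batch counts references. -/
def Ghost.Counting (g : Ghost P) (r : Addr) : Prop := (g.batch r).phase = .counting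

/-- The batch is not being freed. -/
def Ghost.Alive (g : Ghost P) (r : Addr) : Prop :=
  (g.batch r).nodes ≠ [] ∧ ∀ t, (g.batch r).phase ≠ .freeing t

/-- The node belongs to a batch that counts references. -/
def Ghost.Live (g : Ghost P) (node : Addr → Node P.bits) (a : Addr) : Prop :=
  a ∈ (g.batch (node a).nrefNode).nodes ∧ g.Counting (node a).nrefNode

/-- The nodes of a batch are linked correctly. -/
structure BatchOk (P : Params) (node : Addr → Node P.bits) (status : Addr → Status) (r : Addr)
    (b : Batch P) : Prop where
  last : b.nodes.getLast? = some r
  ref : ∀ a ∈ b.nodes, (node a).nrefNode = r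
  retired : ∀ a ∈ b.nodes, status a = .retired
  nodup : b.nodes.Nodup
  count : SlotCount P b.k
  count_single : P.variant.single = true → b.k = P.kmin
  adjs : (node r).adjs = adjsOf P.bits b.k
  -- While nodes are freed from the front, the ring still closes at the original first node, which
  -- is gone; `PcOk` then keeps the ring for the freeing thread.
  ring : (∀ t, b.phase ≠ .freeing t) → Ring node (b.nodes.headD 0) b.nodes

/-- The contributions to a batch that are still to be made. -/
def missing (heads : ℕ → Head) (node : Addr → Node P.bits) (thr : Fin P.threads → Account)
    (r : Addr) : ℕ :=
  (∑ i ∈ Finset.range P.kmax, headTok P node (heads i).hptr r) + ∑ t, (thr t).tok r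

/-- The balance of a batch. -/
structure Balance (heads : ℕ → Head) (node : Addr → Node P.bits) (thr : Fin P.threads → Account)
    (r : Addr) (b : Batch P) : Prop where
  -- Every outstanding contribution has one place: the head of a list whose first node belongs to
  -- the batch, or the account of a thread.
  tokens : b.settled + missing heads node thr r = P.total b.k
  refs : (∑ t, (thr t).held P node r) + b.dropped = b.granted + ∑ t, (thr t).owe r
  granted_le : b.granted ≤ P.grain * b.settled
  nref : b.phase = .counting →
    (node r).nref = P.weight b.k * (b.settled : UWord P.bits) + (b.granted : UWord P.bits)
      - (b.dropped : UWord P.bits)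

/-- The account of a thread that executes `retire` with the slots below `i` done. -/
structure RetireOk (P : Params) (g : Ghost P) (x : Account) (r : RLocals P.bits)
    (i inserts : ℕ) : Prop where
  inside : x.inside = true
  ref : x.rref = r.ref
  -- One contribution for each slot not yet done and one for each slot passed over, which is paid as
  -- part of `Empty` in the end. The contribution for an insertion has already moved to the head.
  tok : x.rtok = if P.variant.single = true then 1 else (r.k - i) + x.skip
  owe : x.rowe = if P.variant.single = true then inserts else 0
  inserts_le : P.variant.single = true → inserts ≤ i
  empty : P.variant.single = false → r.empty = (x.skip : UWord P.bits) * r.adjs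
  doAdj : P.variant.single = false → (r.doAdj = true ↔ x.skip ≠ 0)
  -- After an insertion into the last slot with nothing passed over, the thread owes nothing to its
  -- own batch, which other threads may then free while `retire` still runs. Nothing about the batch
  -- can be claimed in that case.
  batch : x.rtok ≠ 0 → r.first ∈ (g.batch x.rref).nodes ∧ (g.batch x.rref).k = r.k

/-- The current node of `retire` is the first unused node of the batch, and there are enough
unused nodes for the slots from `i` on. -/
def CurrentOk (g : Ghost P) (x : Account) (r : RLocals P.bits) (i : ℕ) : Prop :=
  if i < r.k then
    ∃ used l, (g.batch x.rref).nodes = used ++ x.rest ∧ x.rest = r.cur :: l ∧ r.k - i ≤ l.length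
  else x.rest = []

/-- The current node of `retire` was used just now. -/
def CurrentUsed (g : Ghost P) (x : Account) (r : RLocals P.bits) (i : ℕ) : Prop :=
  if i < r.k then
    ∃ used, (g.batch x.rref).nodes = used ++ r.cur :: x.rest ∧ r.k - i < x.rest.length
  else x.rest = []

/-- The account of a thread after a call of `adjust` or `free_batch`. -/
def ContOk (P : Params) (node : Addr → Node P.bits) (g : Ghost P) (x : Account) (handle : Ptr) :
    Cont P.bits → Prop
  | .leave curr next => x.rtok = 0 ∧ x.rest = [] ∧ x.inside = false ∧
      PathAfter node handle curr next x.todo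
  | .slot r _ => RetireOk P g x r (r.i + 1) r.inserts ∧ CurrentOk g x r (r.i + 1) ∧
      (x.rtok ≠ 0 → g.Counting x.rref)
  | .done => x.rtok = 0 ∧ x.rest = [] ∧ x.inside = true
  | .trav curr next _ => x.rtok = 0 ∧ x.rest = [] ∧ x.inside = false ∧
      PathAfter node handle (some curr) next x.todo

/-- The thread owes nothing. -/
def Account.Quiet (x : Account) : Prop := x.rtok = 0 ∧ x.ptok = 0 ∧ x.rest = []

/-- The account of a thread agrees with its program counter. -/
def PcOk (P : Params) (node : Addr → Node P.bits) (g : Ghost P) (t : Fin P.threads)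
    (th : Thread P.bits) : Prop :=
  let x := g.thr t
  match th.pc with
  | .idle | .initTest _ | .initFAA _ | .initBirth _ =>
      x.Quiet ∧ x.inside = th.active ∧ (x.inside = false → x.todo = [])
  | .enterK _ | .enterAck _ _ _ | .growDir _ _ | .growK _ | .enterFAA _ | .enterLoad _
  | .enterCAS _ _ => x.Quiet ∧ x.inside = false ∧ x.todo = []
  | .leaveLoad | .leaveSwap | .derefAccess _ | .derefNode _ _ | .derefEra _ _ _
  | .touchLoad _ _ | .touchCAS _ _ _ => x.Quiet ∧ x.inside = true
  -- The value `hd` may be outdated, but while the thread is inside the list changes at its front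
  -- only, so the former first node is still protected and its `Next` is still right.
  | .leaveNext hd => x.Quiet ∧ x.inside = true ∧
      ∀ c, hd.hptr = some c → hd.hptr ≠ th.handle → c ∈ x.todo
  | .leaveCAS hd next => x.Quiet ∧ x.inside = true ∧
      ∀ c, hd.hptr = some c → hd.hptr ≠ th.handle → c ∈ x.todo ∧ next = (node c).next
  | .adjLoad a useAdjs v c => ContOk P node g x th.handle c ∧ x.ptok ≠ 0 ∧ g.Counting x.pref ∧
      a ∈ (g.batch x.pref).nodes ∧
      (if useAdjs then adjsOf P.bits (g.batch x.pref).k + v else v) =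
        P.weight (g.batch x.pref).k * (x.ptok : UWord P.bits) + (x.powe : UWord P.bits)
  | .adjFAA ref v c => ContOk P node g x th.handle c ∧ x.ptok ≠ 0 ∧ g.Counting x.pref ∧
      ref = x.pref ∧
      v = P.weight (g.batch x.pref).k * (x.ptok : UWord P.bits) + (x.powe : UWord P.bits)
  | .freeLoad ref c => ContOk P node g x th.handle c ∧ x.ptok = 0 ∧
      (g.batch ref).phase = .freeing t ∧ (g.batch ref).nodes = x.frees ∧ x.frees ≠ [] ∧
      Ring node (x.frees.headD 0) x.frees
  | .freeNode first cur c => ContOk P node g x th.handle c ∧ x.ptok = 0 ∧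
      ∃ r l, (g.batch r).phase = .freeing t ∧ (g.batch r).nodes = x.frees ∧ x.frees = cur :: l ∧
      Ring node first x.frees
  | .travLoop next _ => x.Quiet ∧ x.inside = false ∧ Path node th.handle next x.todo
  | .travRef curr next _ => x.Quiet ∧ x.inside = false ∧
      ∃ l, x.todo = curr :: l ∧ PathAfter node th.handle (some curr) next l
  | .travFAA curr next ref _ => x.Quiet ∧ x.inside = false ∧
      ∃ l, x.todo = curr :: l ∧ PathAfter node th.handle (some curr) next l ∧
        ref = (node curr).nrefNode
  | .travAck _ => x.Quiet ∧ x.inside = false ∧ x.todo = []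
  -- Nothing was settled, granted or dropped yet, so writing `0` makes the equation for `NRef` true.
  | .retInit r => RetireOk P g x r r.i r.inserts ∧ CurrentOk g x r r.i ∧ x.ptok = 0 ∧
      x.rtok ≠ 0 ∧ (g.batch x.rref).phase = .fresh ∧ (g.batch x.rref).settled = 0 ∧
      (g.batch x.rref).granted = 0 ∧ (g.batch x.rref).dropped = 0
  | .retSlot r | .retAccess r _ | .retLink r _ =>
      RetireOk P g x r r.i r.inserts ∧ CurrentOk g x r r.i ∧ x.ptok = 0 ∧
      (x.rtok ≠ 0 → g.Counting x.rref)
  | .retCAS r hd => RetireOk P g x r r.i r.inserts ∧ CurrentOk g x r r.i ∧ x.ptok = 0 ∧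
      (x.rtok ≠ 0 → g.Counting x.rref) ∧ r.cur ∈ x.rest ∧ (node r.cur).next = hd.hptr
  | .retAdvance r hd =>
      RetireOk P g x r (r.i + 1) (r.inserts + 1) ∧ CurrentUsed g x r (r.i + 1) ∧
      (x.rtok ≠ 0 → g.Counting x.rref) ∧
      (∀ p, P.variant.single = false → hd.hptr = some p →
        x.ptok = 1 ∧ x.powe = hd.href ∧ g.Counting x.pref ∧ p ∈ (g.batch x.pref).nodes) ∧
      (P.variant.single = true ∨ hd.hptr = none → x.ptok = 0)
  | .retAck r _ => RetireOk P g x r (r.i + 1) r.inserts ∧ CurrentOk g x r (r.i + 1) ∧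
      x.ptok = 0 ∧ (x.rtok ≠ 0 → g.Counting x.rref)

/-- The thread executes `init_node` for the node `a`. -/
def Initializing (pc : PC P.bits) (a : Addr) : Prop :=
  pc = .initTest a ∨ pc = .initFAA a ∨ pc = .initBirth a

/-- The invariant that relates the auxiliary state to the state. -/
structure Inv (s : State P) (g : Ghost P) : Prop where
  href : ∀ i, (s.heads i).href =
    (Finset.univ.filter fun t => (g.thr t).inside = true ∧ (s.thr t).slot = i).card
  null : ∀ i, (s.heads i).href = 0 → (s.heads i).hptr = none
  path : ∀ t, (g.thr t).inside = true → (s.thr t).active = true ∧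
    Path s.node (s.thr t).handle (s.heads (s.thr t).slot).hptr (g.thr t).todo
  live : ∀ t, ∀ a ∈ (g.thr t).todo, g.Live s.node a
  alive : ∀ t r, (g.thr t).tok r ≠ 0 → g.Alive r
  owner : ∀ t t', (g.thr t).rtok ≠ 0 → (g.thr t').rtok ≠ 0 →
    (g.thr t).rref = (g.thr t').rref → t = t'
  owe_le : ∀ t, (g.thr t).rowe ≤ P.grain * (g.thr t).rtok ∧
    (g.thr t).powe ≤ P.grain * (g.thr t).ptok
  -- That unused nodes lie on nobody's list is what allows `retire` to overwrite their `Next`.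
  rest : ∀ t, ∀ a ∈ (g.thr t).rest, (g.thr t).rtok ≠ 0 ∧
    a ∈ (g.batch (g.thr t).rref).nodes ∧ ∀ t', a ∉ (g.thr t').todo
  batch : ∀ r, (g.batch r).nodes ≠ [] → BatchOk P s.node s.status r (g.batch r)
  balance : ∀ r, g.Alive r → Balance s.heads s.node g.thr r (g.batch r)
  fresh : ∀ t a, Initializing (s.thr t).pc a → s.status a = .fresh
  fresh_unique : ∀ t t' a, Initializing (s.thr t).pc a → Initializing (s.thr t').pc a → t = t'
  pc : ∀ t, PcOk P s.node g t (s.thr t)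

/-! ## Stability of the invariant -/

theorem Path.frame {N : ℕ} {node node' : Addr → Node N} {handle p : Ptr} {l : List Addr}
    (h : Path node handle p l) (hn : ∀ a ∈ l, (node' a).next = (node a).next) :
    Path node' handle p l := by
  induction l generalizing p with
  | nil => exact h
  | cons a l ih =>
    refine ⟨h.1, ?_⟩
    have h2 := h.2
    split_ifs at h2 ⊢
    · exact h2
    · rw [hn a (by simp)]
      exact ih h2 fun b hb => hn b (by simp [hb])

theorem PathAfter.frame {N : ℕ} {node node' : Addr → Node N} {handle p q : Ptr} {l : List Addr}
    (h : PathAfter node handle p q l) (hn : ∀ a ∈ l, (node' a).next = (node a).next) :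
    PathAfter node' handle p q l := by
  unfold PathAfter at *
  split_ifs at h ⊢
  · exact h
  · exact Path.frame h hn

/-- Since an unused node lies on no list, it cannot be a handle; an insertion therefore never cuts
short the list of a thread. -/
theorem Path.mem_handle {N : ℕ} {node : Addr → Node N} {p : Ptr} {h : Addr} {l : List Addr}
    (hp : Path node (some h) p l) : h ∈ l := by
  induction l generalizing p with
  | nil => exact absurd hp.2 (by simp)
  | cons a l ih =>
    have h2 := hp.2
    split_ifs at h2 with h3
    · have : a = h := by simpa [hp.1] using h3
      simp [this]
    · simp [ih h2]

theorem Path.of_none {N : ℕ} {node : Addr → Node N} {handle : Ptr} {l : List Addr}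
    (hp : Path node handle none l) : l = [] ∧ handle = none := by
  cases l with
  | nil => exact ⟨rfl, hp.2⟩
  | cons a l => exact absurd hp.1 (by simp)

theorem Path.of_some {N : ℕ} {node : Addr → Node N} {handle : Ptr} {c : Addr} {l : List Addr}
    (hp : Path node handle (some c) l) :
    ∃ l', l = c :: l' ∧ PathAfter node handle (some c) (node c).next l' := by
  cases l with
  | nil => exact absurd hp.1 (by simp)
  | cons a l =>
    obtain rfl : c = a := by simpa using hp.1
    exact ⟨l, rfl, hp.2⟩

theorem Ring.frame {N : ℕ} {node node' : Addr → Node N} {first : Addr} {l : List Addr}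
    (h : Ring node first l) (hn : ∀ a ∈ l, (node' a).batchNext = (node a).batchNext) :
    Ring node' first l := by
  induction l with
  | nil => trivial
  | cons a l ih =>
    cases l with
    | nil => simpa [Ring, hn a] using h
    | cons b l =>
      refine ⟨by rw [hn a (by simp)]; exact h.1, h.2.1, ih h.2.2 fun c hc => hn c ?_⟩
      simp [List.mem_cons] at hc ⊢
      tauto

theorem Account.tok_rref {x : Account} (h : x.rtok ≠ 0) : x.tok x.rref ≠ 0 := by
  simp [Account.tok, h]

theorem Account.tok_pref {x : Account} (h : x.ptok ≠ 0) : x.tok x.pref ≠ 0 := by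
  simp [Account.tok, h]

theorem Account.Quiet.tok {x : Account} (h : x.Quiet) (r : Addr) : x.tok r = 0 := by
  simp [Account.tok, h.1, h.2.1]

theorem RetireOk.rtok_ne {g : Ghost P} {x : Account} {r : RLocals P.bits} {i inserts : ℕ}
    (h : RetireOk P g x r i inserts) (hi : i < r.k) : x.rtok ≠ 0 := by
  rw [h.tok]; split_ifs <;> omega

/-- No condition mentions `todo`, so the list may be replaced by any other. This covers nodes that
other threads put at its front. -/
theorem RetireOk.frame {g g' : Ghost P} {x : Account} {r : RLocals P.bits} {i inserts : ℕ}
    {todo : List Addr} (h : RetireOk P g x r i inserts)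
    (hb : x.rtok ≠ 0 → (g'.batch x.rref).nodes = (g.batch x.rref).nodes ∧
      (g'.batch x.rref).k = (g.batch x.rref).k) :
    RetireOk P g' { x with todo := todo } r i inserts :=
  { h with batch := fun h0 => by rw [(hb h0).1, (hb h0).2]; exact h.batch h0 }

theorem CurrentOk.frame {g g' : Ghost P} {x : Account} {r : RLocals P.bits} {i : ℕ}
    {todo : List Addr} (h : CurrentOk g x r i)
    (hb : i < r.k → (g'.batch x.rref).nodes = (g.batch x.rref).nodes) :
    CurrentOk g' { x with todo := todo } r i := by
  unfold CurrentOk at *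
  split_ifs with h1
  · simp only [h1, if_true] at h
    simpa only [hb h1] using h
  · simpa only [h1, if_false] using h

theorem CurrentUsed.frame {g g' : Ghost P} {x : Account} {r : RLocals P.bits} {i : ℕ}
    {todo : List Addr} (h : CurrentUsed g x r i)
    (hb : i < r.k → (g'.batch x.rref).nodes = (g.batch x.rref).nodes) :
    CurrentUsed g' { x with todo := todo } r i := by
  unfold CurrentUsed at *
  split_ifs with h1
  · simp only [h1, if_true] at h
    simpa only [hb h1] using h
  · simpa only [h1, if_false] using h

/-- What a thread may rely on when other threads make steps. -/
structure Frame (node node' : Addr → Node P.bits) (g g' : Ghost P) (t : Fin P.threads) :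
    Prop where
  -- The only thing others may do to the account of a thread is to prepend a node, by an insertion
  -- into its slot while it is inside.
  thr : ∃ todo, g'.thr t = { g.thr t with todo := todo } ∧ (todo = (g.thr t).todo ∨
    ((g.thr t).inside = true ∧ ∃ a, todo = a :: (g.thr t).todo))
  todo : ∀ a ∈ (g.thr t).todo,
    (node' a).next = (node a).next ∧ (node' a).nrefNode = (node a).nrefNode
  tok : ∀ r, (g.thr t).tok r ≠ 0 → (g'.batch r).nodes = (g.batch r).nodes ∧
    (g'.batch r).k = (g.batch r).k ∧ (g'.batch r).phase = (g.batch r).phase ∧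
    ((g.batch r).phase = .fresh → g'.batch r = g.batch r)
  freeing : ∀ r, (g.batch r).phase = .freeing t → (g.batch r).nodes ≠ [] →
    (g'.batch r).nodes = (g.batch r).nodes ∧
    (g'.batch r).phase = (g.batch r).phase ∧
    ∀ a ∈ (g.batch r).nodes, (node' a).batchNext = (node a).batchNext
  rest : ∀ a ∈ (g.thr t).rest, (node' a).next = (node a).next

section

variable {node node' : Addr → Node P.bits} {g g' : Ghost P} {t : Fin P.threads}

theorem ContOk.frame (hf : Frame node node' g g' t) {handle : Ptr} {c : Cont P.bits}
    (h : ContOk P node g (g.thr t) handle c) : ContOk P node' g' (g'.thr t) handle c := by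
  obtain ⟨todo, htodo, hcase⟩ := hf.thr
  have hr : (g.thr t).rtok ≠ 0 → _ := fun h0 => hf.tok _ (Account.tok_rref h0)
  rw [htodo]
  cases c with
  | leave curr next =>
    obtain ⟨h1, h2, h3, h4⟩ := h
    refine ⟨h1, h2, h3, ?_⟩
    rcases hcase with rfl | ⟨h5, -⟩
    · exact h4.frame fun a ha => (hf.todo a ha).1
    · simp [h3] at h5
  | slot r href =>
    obtain ⟨h1, h2, h3⟩ := h
    refine ⟨h1.frame fun h0 => ⟨(hr h0).1, (hr h0).2.1⟩, h2.frame fun h0 => ?_, fun h0 => ?_⟩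
    · exact (hr (h1.rtok_ne h0)).1
    · exact (hr h0).2.2.1.trans (h3 h0)
  | done => exact h
  | trav curr next n =>
    obtain ⟨h1, h2, h3, h4⟩ := h
    refine ⟨h1, h2, h3, ?_⟩
    rcases hcase with rfl | ⟨h5, -⟩
    · exact h4.frame fun a ha => (hf.todo a ha).1
    · simp [h3] at h5

/-- A program counter relies only on nodes of the thread's own list, on its unused nodes, on batches
to which it owes a contribution, and on a batch that it is freeing. `Frame` grants stability of
exactly these. -/
theorem PcOk.frame (hf : Frame node node' g g' t) {th : Thread P.bits}
    (h : PcOk P node g t th) : PcOk P node' g' t th := by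
  obtain ⟨todo, htodo, hcase⟩ := hf.thr
  have hr : (g.thr t).rtok ≠ 0 → _ := fun h0 => hf.tok _ (Account.tok_rref h0)
  have hp : (g.thr t).ptok ≠ 0 → _ := fun h0 => hf.tok _ (Account.tok_pref h0)
  have hC : ∀ {handle c}, ContOk P node g (g.thr t) handle c →
      ContOk P node' g' { g.thr t with todo := todo } handle c := by
    intro handle c hc
    have := ContOk.frame hf hc
    rwa [htodo] at this
  have hmem : ∀ a ∈ (g.thr t).todo, a ∈ todo := by
    rcases hcase with rfl | ⟨-, b, rfl⟩ <;> simp +contextual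
  have hout : (g.thr t).inside = false → todo = (g.thr t).todo := by
    rcases hcase with rfl | ⟨h, -⟩ <;> simp_all
  unfold PcOk at *
  rw [htodo]
  dsimp only at h ⊢
  split at h
  case h_5 | h_6 | h_7 | h_8 | h_9 | h_10 | h_11 => exact ⟨h.1, h.2.1, (hout h.2.1).trans h.2.2⟩
  case h_19 hd heq =>
    exact ⟨h.1, h.2.1, fun c h1 h2 => hmem _ (h.2.2 c h1 h2)⟩
  case h_20 hd next heq =>
    refine ⟨h.1, h.2.1, fun c h1 h2 => ?_⟩
    obtain ⟨h3, h4⟩ := h.2.2 c h1 h2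
    exact ⟨hmem _ h3, by rw [h4, (hf.todo c h3).1]⟩
  case h_21 a useAdjs v c heq =>
    obtain ⟨h1, h2, h3, h4, h5⟩ := h
    obtain ⟨e1, e2, e3, -⟩ := hp h2
    refine ⟨hC h1, h2, e3.trans h3, ?_, ?_⟩
    · simpa only [e1] using h4
    · simpa only [e2] using h5
  case h_22 ref v c heq =>
    obtain ⟨h1, h2, h3, h4, h5⟩ := h
    obtain ⟨e1, e2, e3, -⟩ := hp h2
    refine ⟨hC h1, h2, e3.trans h3, h4, ?_⟩
    simpa only [e2] using h5
  case h_23 ref c heq =>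
    obtain ⟨h1, h2, h3, h4, h5, h6⟩ := h
    obtain ⟨e1, e2, e3⟩ := hf.freeing _ h3 (h4 ▸ h5)
    exact ⟨hC h1, h2, e2.trans h3, e1.trans h4, h5, h6.frame fun a ha => e3 a (h4 ▸ ha)⟩
  case h_24 first cur c heq =>
    obtain ⟨h1, h2, r, l, h3, h4, h5, h6⟩ := h
    obtain ⟨e1, e2, e3⟩ := hf.freeing _ h3 (by rw [h4, h5]; simp)
    exact ⟨hC h1, h2, r, l, e2.trans h3, e1.trans h4, h5, h6.frame fun a ha => e3 a (h4 ▸ ha)⟩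
  case h_25 next n heq =>
    obtain ⟨h1, h2, h3⟩ := h
    refine ⟨h1, h2, ?_⟩
    rw [hout h2]
    exact h3.frame fun a ha => (hf.todo a ha).1
  case h_26 curr next n heq =>
    obtain ⟨h1, h2, l, h3, h4⟩ := h
    refine ⟨h1, h2, l, ?_, h4.frame fun a ha => (hf.todo a (by simp [h3, ha])).1⟩
    rw [← h3]; exact hout h2
  case h_27 curr next ref n heq =>
    obtain ⟨h1, h2, l, h3, h4, h5⟩ := h
    refine ⟨h1, h2, l, ?_, h4.frame fun a ha => (hf.todo a (by simp [h3, ha])).1, ?_⟩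
    · rw [← h3]; exact hout h2
    · rw [h5, (hf.todo curr (by simp [h3])).2]
  case h_28 n heq => exact ⟨h.1, h.2.1, (hout h.2.1).trans h.2.2⟩
  case h_29 r heq =>
    obtain ⟨h1, h2, h3, h4, h5, h6⟩ := h
    obtain ⟨e1, e2, e3, e4⟩ := hr h4
    refine ⟨h1.frame fun h0 => ⟨e1, e2⟩, h2.frame fun h0 => e1, h3, h4, e3.trans h5, ?_⟩
    rw [e4 h5]; exact h6
  case h_30 r heq | h_31 r hd heq | h_32 r hd heq =>
    obtain ⟨h1, h2, h3, h4⟩ := h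
    exact ⟨h1.frame fun h0 => ⟨(hr h0).1, (hr h0).2.1⟩,
      h2.frame fun h0 => (hr (h1.rtok_ne h0)).1, h3, fun h0 => (hr h0).2.2.1.trans (h4 h0)⟩
  case h_33 r hd heq =>
    obtain ⟨h1, h2, h3, h4, h5, h6⟩ := h
    exact ⟨h1.frame fun h0 => ⟨(hr h0).1, (hr h0).2.1⟩,
      h2.frame fun h0 => (hr (h1.rtok_ne h0)).1, h3, fun h0 => (hr h0).2.2.1.trans (h4 h0), h5,
      (hf.rest _ h5).trans h6⟩
  case h_34 r hd heq =>
    obtain ⟨h1, h2, h3, h4, h5⟩ := h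
    refine ⟨h1.frame fun h0 => ⟨(hr h0).1, (hr h0).2.1⟩,
      h2.frame fun h0 => (hr (h1.rtok_ne h0)).1, fun h0 => (hr h0).2.2.1.trans (h3 h0),
      fun p hs hp' => ?_, h5⟩
    obtain ⟨h6, h7, h8, h9⟩ := h4 p hs hp'
    obtain ⟨e1, e2, e3, -⟩ := hp (by omega)
    refine ⟨h6, h7, e3.trans h8, ?_⟩
    simpa only [e1] using h9
  case h_35 r hd heq =>
    obtain ⟨h1, h2, h3, h4⟩ := h
    exact ⟨h1.frame fun h0 => ⟨(hr h0).1, (hr h0).2.1⟩,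
      h2.frame fun h0 => (hr (h1.rtok_ne h0)).1, h3, fun h0 => (hr h0).2.2.1.trans (h4 h0)⟩
  case h_1 | h_2 | h_3 | h_4 => exact ⟨h.1, h.2.1, fun h0 => (hout h0).trans (h.2.2 h0)⟩
  all_goals exact h

end

/-! ## Consequences of the invariant -/

/-- The form without subtraction lets `omega` combine the changes of several sums over natural
numbers. -/
theorem sum_update_add {ι α : Type*} [DecidableEq ι] (f : ι → α) {S : Finset ι} {i : ι}
    (hi : i ∈ S) (x : α) (F : α → ℕ) :
    (∑ j ∈ S, F (Function.update f i x j)) + F (f i) = (∑ j ∈ S, F (f j)) + F x := by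
  rw [← Finset.add_sum_erase S _ hi, ← Finset.add_sum_erase S (fun j => F (f j)) hi]
  have : ∑ j ∈ S.erase i, F (Function.update f i x j) = ∑ j ∈ S.erase i, F (f j) :=
    Finset.sum_congr rfl fun j hj => by
      rw [Function.update_of_ne (Finset.ne_of_mem_erase hj)]
  rw [this, Function.update_self]; ring

theorem held_congr {node node' : Addr → Node P.bits} {x : Account} {r : Addr}
    (h : ∀ a ∈ x.todo, (node' a).nrefNode = (node a).nrefNode) :
    x.held P node' r = x.held P node r := by
  unfold Account.held
  apply List.countP_congr
  intro a ha
  have : a ∈ x.todo := by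
    unfold Account.counted at ha
    split_ifs at ha
    · exact List.mem_of_mem_tail ha
    · exact ha
  simp [h a this]

theorem counted_of_not_inside {x : Account} (h : x.inside = false) : x.counted P = x.todo := by
  simp [Account.counted, h]

theorem counted_subset {x : Account} {a : Addr} (h : a ∈ x.counted P) : a ∈ x.todo := by
  unfold Account.counted at h
  split_ifs at h
  · exact List.mem_of_mem_tail h
  · exact h

theorem headTok_congr {node node' : Addr → Node P.bits} {p : Ptr} {r : Addr}
    (h : ∀ a, p = some a → (node' a).nrefNode = (node a).nrefNode) :
    headTok P node' p r = headTok P node p r := by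
  cases p with
  | none => rfl
  | some a => simp [headTok, h a rfl]

section

variable {s : State P} {g : Ghost P}

theorem Inv.exists_inside (hI : Inv s g) {i : ℕ} (h : (s.heads i).href ≠ 0) :
    ∃ t, (g.thr t).inside = true ∧ (s.thr t).slot = i := by
  rw [hI.href i] at h
  obtain ⟨t, ht⟩ := Finset.card_ne_zero.1 h
  exact ⟨t, by simpa using ht⟩

theorem Inv.href_pos (hI : Inv s g) {t : Fin P.threads} (h : (g.thr t).inside = true) :
    0 < (s.heads (s.thr t).slot).href := by
  rw [hI.href]
  exact Finset.card_pos.2 ⟨t, by simp [h]⟩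

theorem Inv.href_le (hI : Inv s g) (i : ℕ) : (s.heads i).href ≤ P.threads := by
  rw [hI.href]
  exact (Finset.card_le_univ _).trans (by simp)

theorem Inv.head_mem_todo (hI : Inv s g) {t : Fin P.threads} (h : (g.thr t).inside = true)
    {a : Addr} (ha : (s.heads (s.thr t).slot).hptr = some a) : a ∈ (g.thr t).todo := by
  have := (hI.path t h).2
  rw [ha] at this
  obtain ⟨l, hl, -⟩ := this.of_some
  simp [hl]

/-- A nonempty list has `HRef ≠ 0`, so a thread is inside, and its list starts at the head. In this
way the first node of any list is protected by somebody. -/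
theorem Inv.exists_head_mem (hI : Inv s g) {i : ℕ} {a : Addr} (h : (s.heads i).hptr = some a) :
    ∃ t, (g.thr t).inside = true ∧ (s.thr t).slot = i ∧ a ∈ (g.thr t).todo := by
  have h0 : (s.heads i).href ≠ 0 := fun h0 => by simp [hI.null i h0] at h
  obtain ⟨t, ht, rfl⟩ := hI.exists_inside h0
  exact ⟨t, ht, rfl, hI.head_mem_todo ht h⟩

theorem Inv.head_live (hI : Inv s g) {i : ℕ} {a : Addr} (h : (s.heads i).hptr = some a) :
    g.Live s.node a := by
  obtain ⟨t, -, -, h⟩ := hI.exists_head_mem h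
  exact hI.live t a h

theorem Inv.eq_of_single (hP : P.Valid) (hs : s.WellFormed) (hI : Inv s g)
    (h1 : P.variant.single = true) {t t' : Fin P.threads} (ht : (g.thr t).inside = true)
    (ht' : (g.thr t').inside = true) (h : (s.thr t).slot = (s.thr t').slot) : t = t' := by
  have a1 := (hs.slot t (hI.path t ht).1).2 h1
  have a2 := (hs.slot t' (hI.path t' ht').1).2 h1
  exact hP.own_inj h1 (by rw [← a1, ← a2, h])

theorem Inv.href_le_one (hP : P.Valid) (hs : s.WellFormed) (hI : Inv s g)
    (h1 : P.variant.single = true) (i : ℕ) : (s.heads i).href ≤ 1 := by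
  rw [hI.href, Finset.card_le_one]
  intro t ht t' ht'
  simp only [Finset.mem_filter, Finset.mem_univ, true_and] at ht ht'
  exact hI.eq_of_single hP hs h1 ht.1 ht'.1 (ht.2.trans ht'.2.symm)

theorem Inv.rowe_eq_zero (hI : Inv s g) {t : Fin P.threads} (h : (g.thr t).rtok = 0) :
    (g.thr t).rowe = 0 := by
  have := (hI.owe_le t).1
  rw [h] at this; simpa using this

theorem Inv.powe_eq_zero (hI : Inv s g) {t : Fin P.threads} (h : (g.thr t).ptok = 0) :
    (g.thr t).powe = 0 := by
  have := (hI.owe_le t).2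
  rw [h] at this; simpa using this

theorem Account.owe_le_tok {x : Account} (h : x.rowe ≤ P.grain * x.rtok ∧
    x.powe ≤ P.grain * x.ptok) (r : Addr) : x.owe r ≤ P.grain * x.tok r := by
  unfold Account.owe Account.tok
  rw [mul_add]
  apply Nat.add_le_add <;> split_ifs <;> simp [h]

theorem Ghost.Live.alive {node : Addr → Node P.bits} {a : Addr} (h : g.Live node a) :
    g.Alive (node a).nrefNode :=
  ⟨List.ne_nil_of_mem h.1, fun t ht => by
    have := h.2; simp [Ghost.Counting] at this; simp [this] at ht⟩

end

/-! ### Preservation of the invariant by elementary changes of the memory -/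

/-- The auxiliary state after a change of the account of a thread. -/
def Ghost.setThread (g : Ghost P) (t : Fin P.threads) (x : Account) : Ghost P :=
  { g with thr := Function.update g.thr t x }

@[simp] theorem Ghost.setThread_self (g : Ghost P) (t : Fin P.threads) (x : Account) :
    (g.setThread t x).thr t = x := by simp [Ghost.setThread]

theorem Ghost.setThread_ne (g : Ghost P) {t t' : Fin P.threads} (h : t' ≠ t) (x : Account) :
    (g.setThread t x).thr t' = g.thr t' := by simp [Ghost.setThread, h]

@[simp] theorem Ghost.setThread_batch (g : Ghost P) (t : Fin P.threads) (x : Account) :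
    (g.setThread t x).batch = g.batch := rfl

theorem Frame.of_eq {node node' : Addr → Node P.bits} {g g' : Ghost P} {t : Fin P.threads}
    (h1 : g'.thr t = g.thr t) (h2 : g'.batch = g.batch)
    (h3 : ∀ a, (node' a).next = (node a).next) (h4 : ∀ a, (node' a).nrefNode = (node a).nrefNode)
    (h5 : ∀ a, (node' a).batchNext = (node a).batchNext) : Frame node node' g g' t where
  thr := ⟨_, h1, Or.inl rfl⟩
  todo a _ := ⟨h3 a, h4 a⟩
  tok r _ := by simp [h2]
  freeing r _ _ := by simp [h2, h5]
  rest a _ := h3 a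

/-- A step that changes the program counter of one thread and its account, without a change of
the references and contributions. -/
theorem Inv.of_local {s s' : State P} {g : Ghost P} {t : Fin P.threads} {x : Account}
    (hI : Inv s g) (hheads : s'.heads = s.heads) (hnode : s'.node = s.node)
    (hstatus : s'.status = s.status) (hother : ∀ t', t' ≠ t → s'.thr t' = s.thr t')
    (hin : x.inside = (g.thr t).inside)
    (hth : x.inside = true → (s'.thr t).active = true ∧ (s'.thr t).slot = (s.thr t).slot ∧
      (s'.thr t).handle = (s.thr t).handle)
    (htodo : x.todo = (g.thr t).todo) (htok : ∀ r, x.tok r = (g.thr t).tok r)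
    (howe : ∀ r, x.owe r = (g.thr t).owe r)
    (howner : x.rtok ≠ 0 → (g.thr t).rtok ≠ 0 ∧ x.rref = (g.thr t).rref)
    (hle : x.rowe ≤ P.grain * x.rtok ∧ x.powe ≤ P.grain * x.ptok)
    (hrest : ∀ a ∈ x.rest, a ∈ (g.thr t).rest ∧ x.rtok ≠ 0)
    (hini : ∀ a, Initializing (s'.thr t).pc a → Initializing (s.thr t).pc a)
    (hpc : PcOk P s.node (g.setThread t x) t (s'.thr t)) : Inv s' (g.setThread t x) := by
  have hini' : ∀ t' a, Initializing (s'.thr t').pc a → Initializing (s.thr t').pc a := by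
    intro t' a h
    by_cases ht : t' = t
    · subst ht; exact hini a h
    · rwa [hother t' ht] at h
  have hheld : ∀ r, x.held P s.node r = (g.thr t).held P s.node r := fun r => by
    simp only [Account.held, Account.counted, hin, htodo]
  have htodo' : ∀ t', ((g.setThread t x).thr t').todo = (g.thr t').todo := by
    intro t'
    by_cases ht : t' = t
    · subst ht; simpa using htodo
    · rw [Ghost.setThread_ne _ ht]
  have hsum : ∀ F : Account → ℕ, F x = F (g.thr t) →
      ∑ t', F ((g.setThread t x).thr t') = ∑ t', F (g.thr t') := by
    intro F hF
    have := sum_update_add g.thr (Finset.mem_univ t) x F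
    rw [hF] at this
    exact Nat.add_right_cancel this
  constructor
  case href =>
    intro i
    rw [hheads, hI.href]
    congr 1
    apply Finset.filter_congr
    intro t' _
    by_cases ht : t' = t
    · subst ht
      simp only [Ghost.setThread_self, hin]
      refine and_congr_right fun h => ?_
      rw [(hth (hin.trans h)).2.1]
    · rw [Ghost.setThread_ne _ ht, hother _ ht]
  case null => rw [hheads]; exact hI.null
  case path =>
    intro t' h
    by_cases ht : t' = t
    · subst ht
      simp only [Ghost.setThread_self] at h ⊢
      obtain ⟨h1, h2, h3⟩ := hth h
      rw [h2, h3, hheads, hnode, htodo]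
      exact ⟨h1, (hI.path t' (hin ▸ h)).2⟩
    · rw [Ghost.setThread_ne _ ht] at h ⊢
      rw [hother _ ht, hheads, hnode]
      exact hI.path t' h
  case live =>
    intro t' a ha
    rw [htodo'] at ha
    rw [hnode]
    exact hI.live t' a ha
  case alive =>
    intro t' r h
    by_cases ht : t' = t
    · subst ht
      simp only [Ghost.setThread_self, htok] at h
      exact hI.alive t' r h
    · rw [Ghost.setThread_ne _ ht] at h
      exact hI.alive t' r h
  case owner =>
    intro t₁ t₂ h1 h2 h3
    have key : ∀ t', ((g.setThread t x).thr t').rtok ≠ 0 → (g.thr t').rtok ≠ 0 ∧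
        ((g.setThread t x).thr t').rref = (g.thr t').rref := by
      intro t' h
      by_cases ht : t' = t
      · subst ht
        simp only [Ghost.setThread_self] at h ⊢
        exact howner h
      · rw [Ghost.setThread_ne _ ht] at h ⊢
        exact ⟨h, rfl⟩
    exact hI.owner t₁ t₂ (key _ h1).1 (key _ h2).1 (by rw [← (key _ h1).2, ← (key _ h2).2, h3])
  case owe_le =>
    intro t'
    by_cases ht : t' = t
    · subst ht; simpa using hle
    · rw [Ghost.setThread_ne _ ht]; exact hI.owe_le t'
  case rest =>
    intro t' a ha
    by_cases ht : t' = t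
    · subst ht
      simp only [Ghost.setThread_self] at ha ⊢
      obtain ⟨h1, h2⟩ := hrest a ha
      refine ⟨h2, ?_, fun t'' => by rw [htodo']; exact (hI.rest t' a h1).2.2 t''⟩
      rw [(howner h2).2]; exact (hI.rest t' a h1).2.1
    · rw [Ghost.setThread_ne _ ht] at ha ⊢
      obtain ⟨h1, h2, h3⟩ := hI.rest t' a ha
      exact ⟨h1, h2, fun t'' => by rw [htodo']; exact h3 t''⟩
  case batch => rw [hnode, hstatus]; exact hI.batch
  case balance =>
    intro r hr
    have hb := hI.balance r hr
    rw [hheads, hnode]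
    have e1 := hsum (fun y => y.tok r) (htok r)
    have e2 := hsum (fun y => y.owe r) (howe r)
    have e3 := hsum (fun y => y.held P s.node r) (hheld r)
    exact ⟨by rw [missing, e1]; exact hb.tokens, by rw [e2, e3]; exact hb.refs, hb.granted_le,
      hb.nref⟩
  case fresh =>
    intro t' a h
    rw [hstatus]; exact hI.fresh t' a (hini' t' a h)
  case fresh_unique =>
    intro t₁ t₂ a h1 h2
    exact hI.fresh_unique t₁ t₂ a (hini' _ _ h1) (hini' _ _ h2)
  case pc =>
    intro t'
    rw [hnode]
    by_cases ht : t' = t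
    · subst ht; exact hpc
    · rw [hother _ ht]
      exact (hI.pc t').frame (Frame.of_eq (Ghost.setThread_ne _ ht _) rfl (fun _ => rfl)
        (fun _ => rfl) fun _ => rfl)

/-- A step that changes nothing but the program counter of one thread, as far as the invariant is
concerned. -/
theorem Inv.of_pc {s s' : State P} {g : Ghost P} {t : Fin P.threads}
    (hI : Inv s g) (hheads : s'.heads = s.heads) (hnode : s'.node = s.node)
    (hstatus : s'.status = s.status) (hother : ∀ t', t' ≠ t → s'.thr t' = s.thr t')
    (hth : (g.thr t).inside = true → (s'.thr t).active = true ∧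
      (s'.thr t).slot = (s.thr t).slot ∧ (s'.thr t).handle = (s.thr t).handle)
    (hini : ∀ a, Initializing (s'.thr t).pc a → Initializing (s.thr t).pc a)
    (hpc : PcOk P s.node g t (s'.thr t)) : Inv s' g := by
  have h0 : g.setThread t (g.thr t) = g := by simp [Ghost.setThread]
  have := hI.of_local (s' := s') (x := g.thr t) hheads hnode hstatus hother rfl hth rfl
    (fun _ => rfl) (fun _ => rfl) (fun h => ⟨h, rfl⟩) (hI.owe_le t)
    (fun a ha => ⟨ha, (hI.rest t a ha).1⟩) hini (by rwa [h0])
  rwa [h0] at this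

theorem missing_congr {heads heads' : ℕ → Head} {node node' : Addr → Node P.bits}
    {thr thr' : Fin P.threads → Account} {r : Addr}
    (h1 : ∀ i, headTok P node' (heads' i).hptr r = headTok P node (heads i).hptr r)
    (h2 : ∑ t, (thr' t).tok r = ∑ t, (thr t).tok r) :
    missing heads' node' thr' r = missing heads node thr r := by
  rw [missing, missing, h2, Finset.sum_congr rfl fun i _ => h1 i]

theorem setThread_sum (g : Ghost P) {t : Fin P.threads} {x : Account} {F : Account → ℕ}
    (hF : F x = F (g.thr t)) :
    ∑ t', F ((g.setThread t x).thr t') = ∑ t', F (g.thr t') := by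
  have := sum_update_add g.thr (Finset.mem_univ t) x F
  rw [hF] at this
  exact Nat.add_right_cancel this

section

variable {s s' : State P} {g : Ghost P} {t : Fin P.threads}

/-- In the variants in which every thread has its own slot, this slot is empty outside. -/
theorem Inv.own_head (hP : P.Valid) (hs : s.WellFormed) (hI : Inv s g)
    (h1 : P.variant.single = true) (hout : (g.thr t).inside = false) :
    (s.heads (P.own t)).href = 0 := by
  by_contra h
  obtain ⟨t', ht', hslot⟩ := hI.exists_inside h
  have := (hs.slot t' (hI.path t' ht').1).2 h1
  rw [hslot] at this
  have := hP.own_inj h1 this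
  subst this
  simp [hout] at ht'

/-- `enter` modifies a head. -/
theorem Inv.enter (hI : Inv s g) {slot : ℕ} (hq : (g.thr t).Quiet)
    (hout : (g.thr t).inside = false) (htodo : (g.thr t).todo = [])
    (hsing : P.variant.single = true → (s.heads slot).hptr = none)
    (hheads : s'.heads =
      Function.update s.heads slot ⟨(s.heads slot).href + 1, (s.heads slot).hptr⟩)
    (hnode : s'.node = s.node) (hstatus : s'.status = s.status)
    (hother : ∀ t', t' ≠ t → s'.thr t' = s.thr t')
    (hth : s'.thr t = { s.thr t with
      pc := .idle, active := true, slot := slot, handle := (s.heads slot).hptr }) :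
    Inv s' (g.setThread t
      { g.thr t with inside := true, todo := (s.heads slot).hptr.toList }) := by
  set x : Account := { g.thr t with inside := true, todo := (s.heads slot).hptr.toList } with hx
  have hini : ∀ t' a, Initializing (s'.thr t').pc a → Initializing (s.thr t').pc a := by
    intro t' a h
    by_cases ht : t' = t
    · subst ht; simp [hth, Initializing] at h
    · rwa [hother t' ht] at h
  -- Entering creates no counted reference: with shared slots the new list consists of at most the
  -- first node, which is not counted, and an own slot is empty.
  have hheld : ∀ r, x.held P s.node r = (g.thr t).held P s.node r := fun r => by
    rw [Account.held, Account.held, counted_of_not_inside hout, htodo]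
    by_cases h1 : P.variant.single = true
    · simp [hx, Account.counted, h1, hsing h1]
    · rw [Bool.not_eq_true] at h1
      cases h : (s.heads slot).hptr <;> simp [hx, Account.counted, h1, h]
  have hhptr : ∀ i, (s'.heads i).hptr = (s.heads i).hptr := by
    intro i
    rw [hheads, Function.update_apply]
    split_ifs with h
    · rw [h]
    · rfl
  have hthr : ∀ t', ((g.setThread t x).thr t').todo = (g.thr t').todo ∨
      t' = t ∧ ((g.setThread t x).thr t').todo = (s.heads slot).hptr.toList := by
    intro t'
    by_cases ht : t' = t
    · subst ht; simp [hx]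
    · rw [Ghost.setThread_ne _ ht]; exact Or.inl rfl
  have hlive : ∀ t', ∀ a ∈ ((g.setThread t x).thr t').todo,
      ∃ t'', a ∈ (g.thr t'').todo := by
    intro t' a ha
    rcases hthr t' with h | ⟨-, h⟩ <;> rw [h] at ha
    · exact ⟨t', ha⟩
    · obtain ⟨t'', -, -, h⟩ := hI.exists_head_mem (Option.mem_toList.1 ha)
      exact ⟨t'', h⟩
  constructor
  case href =>
    intro i
    by_cases hi : i = slot
    · subst hi
      have : (Finset.univ.filter fun t' => ((g.setThread t x).thr t').inside = true ∧
          (s'.thr t').slot = i) = insert t (Finset.univ.filter fun t' =>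
          (g.thr t').inside = true ∧ (s.thr t').slot = i) := by
        ext t'
        by_cases ht : t' = t
        · subst ht; simp [hx, hth]
        · simp [Ghost.setThread_ne _ ht, hother _ ht, ht]
      rw [this, Finset.card_insert_of_notMem (by simp [hout]), ← hI.href i, hheads]
      simp
    · rw [hheads, Function.update_of_ne hi, hI.href]
      congr 1
      apply Finset.filter_congr
      intro t' _
      by_cases ht : t' = t
      · subst ht; simp [hout, hth, Ne.symm hi]
      · rw [Ghost.setThread_ne _ ht, hother _ ht]
  case null =>
    intro i h
    rw [hhptr]
    apply hI.null
    rw [hheads, Function.update_apply] at h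
    split_ifs at h
    exact h
  case path =>
    intro t' h
    by_cases ht : t' = t
    · subst ht
      rw [hhptr, hth, hnode]
      refine ⟨rfl, ?_⟩
      rw [Ghost.setThread_self, hx]
      cases (s.heads slot).hptr <;> simp [Path]
    · rw [Ghost.setThread_ne _ ht] at h ⊢
      rw [hother _ ht, hhptr, hnode]
      exact hI.path t' h
  case live =>
    intro t' a ha
    obtain ⟨t'', h⟩ := hlive t' a ha
    rw [hnode]
    exact hI.live t'' a h
  case alive =>
    intro t' r h
    by_cases ht : t' = t
    · subst ht
      exact absurd (hq.tok r) (by rw [Ghost.setThread_self] at h; exact h)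
    · rw [Ghost.setThread_ne _ ht] at h
      exact hI.alive t' r h
  case owner =>
    intro t₁ t₂ h1 h2 h3
    have key : ∀ t', ((g.setThread t x).thr t').rtok = (g.thr t').rtok ∧
        ((g.setThread t x).thr t').rref = (g.thr t').rref := by
      intro t'
      by_cases ht : t' = t
      · subst ht; simp [hx]
      · rw [Ghost.setThread_ne _ ht]; exact ⟨rfl, rfl⟩
    rw [(key _).1] at h1 h2
    rw [(key _).2, (key _).2] at h3
    exact hI.owner t₁ t₂ h1 h2 h3
  case owe_le =>
    intro t'
    by_cases ht : t' = t
    · subst ht; simpa [hx] using hI.owe_le t'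
    · rw [Ghost.setThread_ne _ ht]; exact hI.owe_le t'
  case rest =>
    intro t' a ha
    by_cases ht : t' = t
    · subst ht
      rw [Ghost.setThread_self, hx, show (g.thr t').rest = [] from hq.2.2] at ha
      simp at ha
    · rw [Ghost.setThread_ne _ ht] at ha ⊢
      obtain ⟨h1, h2, h3⟩ := hI.rest t' a ha
      refine ⟨h1, h2, fun t'' h => ?_⟩
      obtain ⟨t₃, h⟩ := hlive _ _ h
      exact h3 t₃ h
  case batch => rw [hnode, hstatus]; exact hI.batch
  case balance =>
    intro r hr
    have hb := hI.balance r hr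
    rw [hnode]
    have e1 := setThread_sum g (x := x) (t := t) (F := fun y => y.tok r) rfl
    have e2 := setThread_sum g (x := x) (t := t) (F := fun y => y.owe r) rfl
    have e3 := setThread_sum g (F := fun y => y.held P s.node r) (hheld r)
    have e4 : missing s'.heads s.node (g.setThread t x).thr r = missing s.heads s.node g.thr r :=
      missing_congr (fun i => by rw [hhptr]) e1
    exact ⟨by rw [e4]; exact hb.tokens, by rw [e2, e3]; exact hb.refs, hb.granted_le, hb.nref⟩
  case fresh =>
    intro t' a h
    rw [hstatus]; exact hI.fresh t' a (hini t' a h)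
  case fresh_unique =>
    intro t₁ t₂ a h1 h2
    exact hI.fresh_unique t₁ t₂ a (hini _ _ h1) (hini _ _ h2)
  case pc =>
    intro t'
    rw [hnode]
    by_cases ht : t' = t
    · subst ht
      simp [PcOk, hth, hx]
      exact hq
    · rw [hother _ ht]
      exact (hI.pc t').frame (Frame.of_eq (Ghost.setThread_ne _ ht _) rfl (fun _ => rfl)
        (fun _ => rfl) fun _ => rfl)

/-- `leave` modifies a head. If the list becomes empty, the thread owes a contribution to the
batch of the former first node. -/
theorem Inv.leave (hs : s.WellFormed) (hI : Inv s g) {x : Account} (hq : (g.thr t).Quiet)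
    (hin : (g.thr t).inside = true)
    (hx1 : x.inside = false) (hx2 : x.todo = (g.thr t).counted P) (hx3 : x.rtok = 0)
    (hx4 : x.rowe = 0) (hx5 : x.powe = 0) (hx6 : x.rest = [])
    -- The contribution for which the first node stands stays with the head, or passes to the
    -- account of the thread when the list is emptied.
    (hx7 : ∀ r, (if x.pref = r then x.ptok else 0) +
      headTok P s.node (s'.heads (s.thr t).slot).hptr r =
      headTok P s.node (s.heads (s.thr t).slot).hptr r)
    (hheads : s'.heads = Function.update s.heads (s.thr t).slot
      ⟨(s.heads (s.thr t).slot).href - 1,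
        if (s.heads (s.thr t).slot).href = 1 then none else (s.heads (s.thr t).slot).hptr⟩)
    (hnode : s'.node = s.node) (hstatus : s'.status = s.status)
    (hother : ∀ t', t' ≠ t → s'.thr t' = s.thr t')
    (hini : ∀ a, ¬ Initializing (s'.thr t).pc a)
    (hpc : PcOk P s.node (g.setThread t x) t (s'.thr t)) : Inv s' (g.setThread t x) := by
  have hini : ∀ t' a, Initializing (s'.thr t').pc a → Initializing (s.thr t').pc a := by
    intro t' a h
    by_cases ht : t' = t
    · subst ht; exact absurd h (hini a)
    · rwa [hother t' ht] at h
  have hslot := (hs.slot t (hI.path t hin).1).1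
  have hpos := hI.href_pos hin
  have htok : ∀ r, x.tok r = if x.pref = r then x.ptok else 0 := by
    intro r; simp [Account.tok, hx3]
  have htok0 : ∀ r, (g.thr t).tok r = 0 := hq.tok
  have howe : ∀ r, x.owe r = (g.thr t).owe r := by
    intro r
    simp [Account.owe, hx4, hx5, hI.rowe_eq_zero hq.1, hI.powe_eq_zero hq.2.1]
  have hheld : ∀ r, x.held P s.node r = (g.thr t).held P s.node r := fun r => by
    rw [Account.held, Account.held, counted_of_not_inside hx1, hx2]
  have htodo : ∀ t', ∀ a ∈ ((g.setThread t x).thr t').todo, a ∈ (g.thr t').todo := by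
    intro t' a ha
    by_cases ht : t' = t
    · subst ht
      rw [Ghost.setThread_self, hx2] at ha
      exact counted_subset ha
    · rwa [Ghost.setThread_ne _ ht] at ha
  have hsub : ∀ i a, (s'.heads i).hptr = some a → (s.heads i).hptr = some a := by
    intro i a
    rw [hheads, Function.update_apply]
    split_ifs with h1 h2
    · simp
    · subst h1; exact id
    · exact id
  constructor
  case href =>
    intro i
    by_cases hi : i = (s.thr t).slot
    · have : (Finset.univ.filter fun t' => ((g.setThread t x).thr t').inside = true ∧
          (s'.thr t').slot = i) = (Finset.univ.filter fun t' =>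
          (g.thr t').inside = true ∧ (s.thr t').slot = i).erase t := by
        ext t'
        by_cases ht : t' = t
        · subst ht; simp [hx1]
        · simp [Ghost.setThread_ne _ ht, hother _ ht, ht]
      rw [this, Finset.card_erase_of_mem (by simp [hin, hi]), ← hI.href i, hheads, hi]
      simp
    · rw [hheads, Function.update_of_ne hi, hI.href]
      congr 1
      apply Finset.filter_congr
      intro t' _
      by_cases ht : t' = t
      · subst ht; simp [hx1, Ne.symm hi]
      · rw [Ghost.setThread_ne _ ht, hother _ ht]
  case null =>
    intro i h
    rw [hheads, Function.update_apply] at h ⊢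
    split_ifs at h ⊢ with h1 h2
    · rfl
    · simp only at h
      omega
    · exact hI.null i h
  case path =>
    intro t' h
    by_cases ht : t' = t
    · subst ht; simp [hx1] at h
    · rw [Ghost.setThread_ne _ ht] at h ⊢
      rw [hother _ ht, hnode]
      refine ⟨(hI.path t' h).1, ?_⟩
      have : (s'.heads (s.thr t').slot).hptr = (s.heads (s.thr t').slot).hptr := by
        rw [hheads, Function.update_apply]
        split_ifs with h1 h2
        · exfalso
          -- Another thread inside the same slot makes `HRef` at least `2`, so its list is not
          -- dropped.
          rw [hI.href, Finset.card_eq_one] at h2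
          obtain ⟨u, hu⟩ := h2
          have a1 : t ∈ ({u} : Finset _) := by rw [← hu]; simp [hin]
          have a2 : t' ∈ ({u} : Finset _) := by rw [← hu]; simp [h, h1]
          simp only [Finset.mem_singleton] at a1 a2
          exact ht (a2.trans a1.symm)
        · rw [h1]
        · rfl
      rw [this]
      exact (hI.path t' h).2
  case live =>
    intro t' a ha
    rw [hnode]
    exact hI.live t' a (htodo t' a ha)
  case alive =>
    intro t' r h
    by_cases ht : t' = t
    · subst ht
      rw [Ghost.setThread_self, htok] at h
      have h7 := hx7 r
      have : headTok P s.node (s.heads (s.thr t').slot).hptr r ≠ 0 := by omega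
      cases hp : (s.heads (s.thr t').slot).hptr with
      | none => simp [hp, headTok] at this
      | some a =>
        simp only [hp, headTok] at this
        split_ifs at this with h1 h2
        · simp at this
        · exact h2 ▸ (hI.head_live hp).alive
        · simp at this
    · rw [Ghost.setThread_ne _ ht] at h
      exact hI.alive t' r h
  case owner =>
    intro t₁ t₂ h1 h2 h3
    have key : ∀ t', ((g.setThread t x).thr t').rtok ≠ 0 → t' ≠ t := by
      rintro t' h rfl
      simp [hx3] at h
    have k1 := key _ h1
    have k2 := key _ h2
    rw [Ghost.setThread_ne _ k1] at h1 h3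
    rw [Ghost.setThread_ne _ k2] at h2 h3
    exact hI.owner t₁ t₂ h1 h2 h3
  case owe_le =>
    intro t'
    by_cases ht : t' = t
    · subst ht; simp [hx4, hx5]
    · rw [Ghost.setThread_ne _ ht]; exact hI.owe_le t'
  case rest =>
    intro t' a ha
    by_cases ht : t' = t
    · subst ht
      simp [hx6] at ha
    · rw [Ghost.setThread_ne _ ht] at ha ⊢
      obtain ⟨h1, h2, h3⟩ := hI.rest t' a ha
      exact ⟨h1, h2, fun t'' h => h3 t'' (htodo _ _ h)⟩
  case batch => rw [hnode, hstatus]; exact hI.batch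
  case balance =>
    intro r hr
    have hb := hI.balance r hr
    rw [hnode]
    have e2 := setThread_sum g (F := fun y => y.owe r) (howe r)
    have e3 := setThread_sum g (F := fun y => y.held P s.node r) (hheld r)
    have e4 : missing s'.heads s.node (g.setThread t x).thr r
        = missing s.heads s.node g.thr r := by
      have a1 := sum_update_add g.thr (Finset.mem_univ t) x (fun y => y.tok r)
      have a2 := sum_update_add s.heads (Finset.mem_range.2 hslot) (s'.heads (s.thr t).slot)
        (fun h => headTok P s.node h.hptr r)
      have a3 : Function.update s.heads (s.thr t).slot (s'.heads (s.thr t).slot) = s'.heads := by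
        rw [hheads]; simp
      rw [a3] at a2
      simp only [htok, htok0] at a1
      have a4 := hx7 r
      simp only [missing, Ghost.setThread]
      omega
    exact ⟨by rw [e4]; exact hb.tokens, by rw [e2, e3]; exact hb.refs, hb.granted_le, hb.nref⟩
  case fresh =>
    intro t' a h
    rw [hstatus]; exact hI.fresh t' a (hini t' a h)
  case fresh_unique =>
    intro t₁ t₂ a h1 h2
    exact hI.fresh_unique t₁ t₂ a (hini _ _ h1) (hini _ _ h2)
  case pc =>
    intro t'
    rw [hnode]
    by_cases ht : t' = t
    · subst ht; exact hpc
    · rw [hother _ ht]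
      exact (hI.pc t').frame (Frame.of_eq (Ghost.setThread_ne _ ht _) rfl (fun _ => rfl)
        (fun _ => rfl) fun _ => rfl)

end

section

variable {s s' : State P} {g : Ghost P} {t : Fin P.threads}

@[simp] theorem addNRef_next (s : State P) (r a : Addr) (v : UWord P.bits) :
    ((s.addNRef r v).node a).next = (s.node a).next := by
  simp only [State.addNRef, State.setNode, Function.update_apply]; split_ifs with h <;> simp [h]
@[simp] theorem addNRef_nrefNode (s : State P) (r a : Addr) (v : UWord P.bits) :
    ((s.addNRef r v).node a).nrefNode = (s.node a).nrefNode := by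
  simp only [State.addNRef, State.setNode, Function.update_apply]; split_ifs with h <;> simp [h]
@[simp] theorem addNRef_batchNext (s : State P) (r a : Addr) (v : UWord P.bits) :
    ((s.addNRef r v).node a).batchNext = (s.node a).batchNext := by
  simp only [State.addNRef, State.setNode, Function.update_apply]; split_ifs with h <;> simp [h]
@[simp] theorem addNRef_adjs (s : State P) (r a : Addr) (v : UWord P.bits) :
    ((s.addNRef r v).node a).adjs = (s.node a).adjs := by
  simp only [State.addNRef, State.setNode, Function.update_apply]; split_ifs with h <;> simp [h]
theorem addNRef_nref (s : State P) (r a : Addr) (v : UWord P.bits) :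
    ((s.addNRef r v).node a).nref = (s.node a).nref + if a = r then v else 0 := by
  simp only [State.addNRef, State.setNode, Function.update_apply]; split_ifs with h <;> simp [h]

/-- If nobody owes anything to a batch and no references are left, then no thread has to traverse
a node of the batch. -/
theorem no_todo {heads : ℕ → Head} {node : Addr → Node P.bits} {slot : ℕ} {handle : Ptr}
    {x : Account} {r : Addr} (hslot : x.inside = true → slot < P.kmax)
    (hpath : x.inside = true → Path node handle (heads slot).hptr x.todo)
    (hheld : x.held P node r = 0)
    (hhead : ∀ i < P.kmax, headTok P node (heads i).hptr r = 0) :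
    ∀ a ∈ x.todo, (node a).nrefNode ≠ r := by
  have h1 : ∀ a ∈ x.counted P, (node a).nrefNode ≠ r := by
    rw [Account.held, List.countP_eq_zero] at hheld
    simpa using hheld
  intro a ha
  -- Inside a shared slot `held` ignores the first node, but that node is the head of the slot and
  -- is excluded by `hhead`.
  by_cases hc : x.inside = true ∧ P.variant.single = false
  · have hp := hpath hc.1
    have hh := hhead slot (hslot hc.1)
    cases hx : x.todo with
    | nil => simp [hx] at ha
    | cons b l =>
      rw [hx] at ha hp
      rw [hp.1] at hh
      rcases List.mem_cons.1 ha with rfl | hl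
      · intro h
        simp [headTok, hc.2, h] at hh
      · exact h1 a (by simp [Account.counted, hc, hx, hl])
  · exact h1 a (by rw [Account.counted, if_neg hc]; exact ha)

/-- A fetch-and-add on the counter of a batch: the thread makes `df` contributions with `dR`
references, and gives up `dd` references. Whoever brings the counter to `0` may free the
batch. -/
theorem Inv.faa (hP : P.Valid) (hs : s.WellFormed) (hI : Inv s g) {ref : Addr}
    {val : UWord P.bits} {x : Account} {df dR dd : ℕ} {ph : Phase P}
    (hcount : g.Counting ref) (hne : (g.batch ref).nodes ≠ [])
    (hph : ph = .counting ∨ ph = .freeing t ∧ (s.node ref).nref + val = 0)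
    (hheads : s'.heads = s.heads) (hnode : s'.node = (s.addNRef ref val).node)
    (hstatus : s'.status = s.status) (hother : ∀ t', t' ≠ t → s'.thr t' = s.thr t')
    (hin : x.inside = (g.thr t).inside)
    (hth : x.inside = true → (s'.thr t).active = true ∧ (s'.thr t).slot = (s.thr t).slot ∧
      (s'.thr t).handle = (s.thr t).handle ∧ x.todo = (g.thr t).todo)
    (htodo : ∀ a ∈ x.todo, a ∈ (g.thr t).todo)
    (htok : ∀ r, x.tok r + (if r = ref then df else 0) = (g.thr t).tok r)
    (howe : ∀ r, x.owe r + (if r = ref then dR else 0) = (g.thr t).owe r)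
    (hheld : ∀ r, x.held P s.node r + (if r = ref then dd else 0) = (g.thr t).held P s.node r)
    (hdR : dR ≤ P.grain * df) (hpos : 0 < df ∨ 0 < dd)
    (hval : val = P.weight (g.batch ref).k * (df : UWord P.bits) + (dR : UWord P.bits)
      - (dd : UWord P.bits))
    (hrtok : x.rtok = (g.thr t).rtok) (hrref : x.rref = (g.thr t).rref)
    (hle : x.rowe ≤ P.grain * x.rtok ∧ x.powe ≤ P.grain * x.ptok)
    (hrest : x.rest = (g.thr t).rest)
    (hini : ∀ a, ¬ Initializing (s'.thr t).pc a)
    {g' : Ghost P}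
    (hg' : g' = ⟨Function.update g.thr t x, Function.update g.batch ref
      { g.batch ref with
        phase := ph
        settled := (g.batch ref).settled + df
        granted := (g.batch ref).granted + dR
        dropped := (g.batch ref).dropped + dd }⟩)
    (hpc : (ph = .freeing t → x.tok ref = 0) → PcOk P s'.node g' t (s'.thr t)) : Inv s' g' := by
  have hini : ∀ t' a, Initializing (s'.thr t').pc a → Initializing (s.thr t').pc a := by
    intro t' a h
    by_cases ht : t' = t
    · subst ht; exact absurd h (hini a)
    · rwa [hother t' ht] at h
  have n1 : ∀ a, (s'.node a).next = (s.node a).next := by simp [hnode]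
  have n2 : ∀ a, (s'.node a).nrefNode = (s.node a).nrefNode := by simp [hnode]
  have n3 : ∀ a, (s'.node a).batchNext = (s.node a).batchNext := by simp [hnode]
  have n4 : ∀ a, (s'.node a).adjs = (s.node a).adjs := by simp [hnode]
  have hself : g'.thr t = x := by rw [hg']; simp
  have hne' : ∀ t', t' ≠ t → g'.thr t' = g.thr t' := fun t' h => by rw [hg']; simp [h]
  have hbr : ∀ r, r ≠ ref → g'.batch r = g.batch r := fun r h => by rw [hg']; simp [h]
  have hb1 : ∀ r, (g'.batch r).nodes = (g.batch r).nodes := by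
    intro r
    by_cases h : r = ref
    · subst h; rw [hg']; simp
    · rw [hbr r h]
  have hb2 : ∀ r, (g'.batch r).k = (g.batch r).k := by
    intro r
    by_cases h : r = ref
    · subst h; rw [hg']; simp
    · rw [hbr r h]
  have hphase : (g'.batch ref).phase = ph := by rw [hg']; simp
  have halive : g.Alive ref := ⟨hne, fun t' h => by
    simp only [Ghost.Counting] at hcount; simp [hcount] at h⟩
  have htodo' : ∀ t', ∀ a ∈ (g'.thr t').todo, a ∈ (g.thr t').todo := by
    intro t' a ha
    by_cases ht : t' = t
    · subst ht
      rw [hself] at ha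
      exact htodo a ha
    · rwa [hne' _ ht] at ha
  have htokle : ∀ t' r, (g'.thr t').tok r ≤ (g.thr t').tok r := by
    intro t' r
    by_cases ht : t' = t
    · subst ht; rw [hself]; have := htok r; omega
    · rw [hne' _ ht]
  have hslot : ∀ t', (g'.thr t').inside = true → (s'.thr t').slot < P.kmax ∧
      (s'.thr t').active = true ∧
      Path s'.node (s'.thr t').handle (s'.heads (s'.thr t').slot).hptr (g'.thr t').todo := by
    intro t' h
    rw [hheads]
    by_cases ht : t' = t
    · subst ht
      rw [hself] at h ⊢
      obtain ⟨h1, h2, h3, h4⟩ := hth h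
      have h5 := hI.path t' (hin ▸ h)
      rw [h2, h3, h4]
      exact ⟨(hs.slot _ h5.1).1, h1, h5.2.frame fun a _ => n1 a⟩
    · rw [hne' _ ht] at h ⊢
      rw [hother _ ht]
      have h5 := hI.path t' h
      exact ⟨(hs.slot _ h5.1).1, h5.1, h5.2.frame fun a _ => n1 a⟩
  have hbal : ∀ r, g.Alive r → Balance s'.heads s'.node g'.thr r (g'.batch r) ∧
      (r = ref → (s'.node r).nref = P.weight (g.batch r).k *
        (((g'.batch r).settled : ℕ) : UWord P.bits) + ((g'.batch r).granted : UWord P.bits)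
          - ((g'.batch r).dropped : UWord P.bits)) := by
    intro r hr
    have hb := hI.balance r hr
    have a1 := sum_update_add g.thr (Finset.mem_univ t) x (fun y => y.tok r)
    have a2 := sum_update_add g.thr (Finset.mem_univ t) x (fun y => y.owe r)
    have a3 := sum_update_add g.thr (Finset.mem_univ t) x (fun y => y.held P s.node r)
    have e0 : Function.update g.thr t x = g'.thr := by rw [hg']
    rw [e0] at a1 a2 a3
    have e1 : ∑ t', (g'.thr t').held P s'.node r = ∑ t', (g'.thr t').held P s.node r :=
      Finset.sum_congr rfl fun t' _ => held_congr fun a _ => n2 a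
    have e2 : ∑ i ∈ Finset.range P.kmax, headTok P s'.node (s'.heads i).hptr r =
        ∑ i ∈ Finset.range P.kmax, headTok P s.node (s.heads i).hptr r :=
      Finset.sum_congr rfl fun i _ => by rw [hheads]; exact headTok_congr fun a _ => n2 a
    have b1 := hb.tokens
    have b2 := hb.refs
    have b3 := hb.granted_le
    have c1 := htok r
    have c2 := howe r
    have c3 := hheld r
    simp only [missing] at b1
    by_cases hrr : r = ref
    · subst hrr
      simp only [if_true] at c1 c2 c3
      have f1 : (g'.batch r).settled = (g.batch r).settled + df := by rw [hg']; simp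
      have f2 : (g'.batch r).granted = (g.batch r).granted + dR := by rw [hg']; simp
      have f3 : (g'.batch r).dropped = (g.batch r).dropped + dd := by rw [hg']; simp
      have hnref : (s'.node r).nref = P.weight (g.batch r).k *
          (((g'.batch r).settled : ℕ) : UWord P.bits) + ((g'.batch r).granted : UWord P.bits)
            - ((g'.batch r).dropped : UWord P.bits) := by
        rw [hnode, addNRef_nref, if_pos rfl, hb.nref hcount, hval, f1, f2, f3]
        push_cast; ring
      refine ⟨⟨?_, ?_, ?_, fun _ => ?_⟩, fun _ => hnref⟩
      · rw [missing, e2, f1, hb2]; omega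
      · rw [e1, f2, f3]; omega
      · rw [f1, f2, mul_add]; omega
      · rw [hb2]; exact hnref
    · simp only [hrr, if_false, add_zero] at c1 c2 c3
      rw [hbr r hrr]
      refine ⟨⟨?_, ?_, b3, fun h => ?_⟩, fun h => absurd h hrr⟩
      · rw [missing, e2]; omega
      · rw [e1]; omega
      · rw [← hb.nref h, hnode, addNRef_nref, if_neg hrr, add_zero]
  -- This is where safety is decided. When the counter becomes `0`, `zero_test` shows that no
  -- contribution is missing and that all granted references were dropped. Without outstanding
  -- contributions nothing is owed, so the balance of references leaves none held, and `no_todo`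
  -- applies.
  have hzero : ph = .freeing t → (∀ t', (g'.thr t').tok ref = 0) ∧
      (∀ t', ∀ a ∈ (g'.thr t').todo, (s'.node a).nrefNode ≠ ref) := by
    intro hf
    have hz : (s'.node ref).nref = 0 := by
      rw [hnode, addNRef_nref, if_pos rfl]
      rcases hph with h | ⟨-, h⟩
      · rw [h] at hf; exact absurd hf (by simp)
      · exact h
    obtain ⟨hb, hn⟩ := hbal ref halive
    have hB := hI.batch ref hne
    have hle' : ∑ t', (g'.thr t').owe ref ≤ P.grain * ∑ t', (g'.thr t').tok ref := by
      rw [Finset.mul_sum]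
      refine Finset.sum_le_sum fun t' _ => Account.owe_le_tok ?_ _
      by_cases ht : t' = t
      · subst ht; rw [hself]; exact hle
      · rw [hne' _ ht]; exact hI.owe_le t'
    have b1 := hb.tokens
    have b2 := hb.refs
    have b3 := hb.granted_le
    have hn := hn rfl
    rw [hz] at hn
    rw [hb2] at b1
    have f1 : (g'.batch ref).settled = (g.batch ref).settled + df := by rw [hg']; simp
    have f3 : (g'.batch ref).dropped = (g.batch ref).dropped + dd := by rw [hg']; simp
    -- Dropped references were granted or are still owed, and each contribution, made or
    -- outstanding, accounts for at most `grain` of them.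
    have hD : (g'.batch ref).dropped ≤ P.grain * P.total (g.batch ref).k := by
      rw [← b1, missing, mul_add, mul_add]
      omega
    obtain ⟨z1, z2⟩ := zero_test hP t hB.count hB.count_single (by omega) b3 hD (by omega) hn.symm
    have z3 : missing s'.heads s'.node g'.thr ref = 0 := by omega
    rw [missing] at z3
    have z4 : ∑ t', (g'.thr t').tok ref = 0 := by omega
    have z5 : ∑ i ∈ Finset.range P.kmax, headTok P s'.node (s'.heads i).hptr ref = 0 := by omega
    rw [z4] at hle'
    have z6 : ∑ t', (g'.thr t').held P s'.node ref = 0 := by omega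
    rw [Finset.sum_eq_zero_iff] at z4 z5 z6
    refine ⟨fun t' => z4 t' (Finset.mem_univ _), fun t' => ?_⟩
    exact no_todo (heads := s'.heads) (fun h => (hslot t' h).1) (fun h => (hslot t' h).2.2)
      (z6 t' (Finset.mem_univ _)) fun i hi => z5 i (Finset.mem_range.2 hi)
  constructor
  case href =>
    intro i
    rw [hheads, hI.href]
    congr 1
    apply Finset.filter_congr
    intro t' _
    by_cases ht : t' = t
    · subst ht
      rw [hself, hin]
      refine and_congr_right fun h => ?_
      rw [(hth (hin.trans h)).2.1]
    · rw [hne' _ ht, hother _ ht]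
  case null => rw [hheads]; exact hI.null
  case path => exact fun t' h => (hslot t' h).2
  case live =>
    intro t' a ha
    obtain ⟨h1, h2⟩ := hI.live t' a (htodo' t' a ha)
    refine ⟨by rw [n2, hb1]; exact h1, ?_⟩
    rw [n2, Ghost.Counting]
    by_cases hr : (s.node a).nrefNode = ref
    · rw [hr, hphase]
      rcases hph with h | ⟨h, -⟩
      · exact h
      · exact absurd ((n2 a).trans hr) ((hzero h).2 t' a ha)
    · rw [hbr _ hr]; exact h2
  case alive =>
    intro t' r h
    have h1 := htokle t' r
    obtain ⟨h2, h3⟩ := hI.alive t' r (by omega)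
    refine ⟨by rw [hb1]; exact h2, fun t'' => ?_⟩
    by_cases hr : r = ref
    · subst hr
      rw [hphase]
      rcases hph with h' | ⟨h', -⟩
      · rw [h']; simp
      · exact absurd ((hzero h').1 t') h
    · rw [hbr _ hr]; exact h3 t''
  case owner =>
    have key : ∀ t', (g'.thr t').rtok = (g.thr t').rtok ∧
        (g'.thr t').rref = (g.thr t').rref := by
      intro t'
      by_cases ht : t' = t
      · subst ht; rw [hself]; exact ⟨hrtok, hrref⟩
      · rw [hne' _ ht]; exact ⟨rfl, rfl⟩
    intro t₁ t₂ h1 h2 h3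
    rw [(key _).1] at h1 h2
    rw [(key _).2, (key _).2] at h3
    exact hI.owner t₁ t₂ h1 h2 h3
  case owe_le =>
    intro t'
    by_cases ht : t' = t
    · subst ht; rw [hself]; exact hle
    · rw [hne' _ ht]; exact hI.owe_le t'
  case rest =>
    have key : ∀ t', (g'.thr t').rtok = (g.thr t').rtok ∧
        (g'.thr t').rref = (g.thr t').rref ∧ (g'.thr t').rest = (g.thr t').rest := by
      intro t'
      by_cases ht : t' = t
      · subst ht; rw [hself]; exact ⟨hrtok, hrref, hrest⟩
      · rw [hne' _ ht]; exact ⟨rfl, rfl, rfl⟩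
    intro t' a ha
    obtain ⟨k1, k2, k3⟩ := key t'
    rw [k3] at ha
    obtain ⟨h1, h2, h3⟩ := hI.rest t' a ha
    rw [k1, k2, hb1]
    exact ⟨h1, h2, fun t'' h => h3 t'' (htodo' _ _ h)⟩
  case batch =>
    intro r hr
    rw [hb1] at hr
    have hB := hI.batch r hr
    refine ⟨by rw [hb1]; exact hB.last, fun a ha => ?_, fun a ha => ?_, by rw [hb1]; exact hB.nodup,
      by rw [hb2]; exact hB.count, by rw [hb2]; exact hB.count_single,
      by rw [hb2, n4]; exact hB.adjs, fun h => ?_⟩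
    · rw [n2]; rw [hb1] at ha; exact hB.ref a ha
    · rw [hstatus]; rw [hb1] at ha; exact hB.retired a ha
    · rw [hb1]
      refine (hB.ring ?_).frame fun a _ => n3 a
      by_cases hrr : r = ref
      · subst hrr; exact halive.2
      · rwa [hbr r hrr] at h
  case balance =>
    intro r hr
    refine (hbal r ⟨by rw [← hb1]; exact hr.1, ?_⟩).1
    by_cases hrr : r = ref
    · subst hrr; exact halive.2
    · rw [← hbr r hrr]; exact hr.2
  case fresh =>
    intro t' a h
    rw [hstatus]; exact hI.fresh t' a (hini t' a h)
  case fresh_unique =>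
    intro t₁ t₂ a h1 h2
    exact hI.fresh_unique t₁ t₂ a (hini _ _ h1) (hini _ _ h2)
  case pc =>
    intro t'
    by_cases ht : t' = t
    · subst ht
      exact hpc fun h => by rw [← hself]; exact (hzero h).1 t'
    · rw [hother _ ht]
      refine (hI.pc t').frame ⟨⟨_, hne' _ ht, Or.inl rfl⟩, fun a _ => ⟨n1 a, n2 a⟩, ?_, ?_,
        fun a _ => n1 a⟩
      · intro r hr
        refine ⟨hb1 r, hb2 r, ?_⟩
        by_cases hrr : r = ref
        · subst hrr
          have hc : (g.batch r).phase = .counting := hcount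
          rw [hphase, hc]
          refine ⟨?_, by simp⟩
          rcases hph with h' | ⟨h', -⟩
          · exact h'
          · have := (hzero h').1 t'
            rw [hne' _ ht] at this
            exact absurd this hr
        · rw [hbr r hrr]; exact ⟨rfl, fun _ => rfl⟩
      · intro r hr _
        refine ⟨hb1 r, ?_, fun a _ => n3 a⟩
        by_cases hrr : r = ref
        · subst hrr; exact absurd hr (halive.2 t')
        · rw [hbr r hrr]

end

section

variable {s s' : State P} {g : Ghost P} {t : Fin P.threads}

/-- Through `adjust` a thread owes only to batches that already count, so a batch in its initial
phase is known to its retiring thread alone. -/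
theorem PcOk.counting_pref {node : Addr → Node P.bits} {th : Thread P.bits}
    (h : PcOk P node g t th) (hp : (g.thr t).ptok ≠ 0) : g.Counting (g.thr t).pref := by
  unfold PcOk at h
  dsimp only at h
  split at h <;> simp_all [Account.Quiet]
  rename_i r hd _
  rcases hs : P.variant.single <;> cases hp' : hd.hptr <;> simp_all

theorem Inv.rest_nrefNode (hI : Inv s g) {a : Addr} (h : a ∈ (g.thr t).rest) :
    (s.node a).nrefNode = (g.thr t).rref := by
  obtain ⟨-, h2, -⟩ := hI.rest t a h
  exact (hI.batch _ (List.ne_nil_of_mem h2)).ref a h2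

/-- An unused node determines its batch by `NRefNode`, and a batch has one retiring thread. -/
theorem Inv.rest_unique (hI : Inv s g) {t' : Fin P.threads} {a : Addr}
    (h : a ∈ (g.thr t).rest) (h' : a ∈ (g.thr t').rest) : t = t' :=
  hI.owner t t' (hI.rest t a h).1 (hI.rest t' a h').1
    ((hI.rest_nrefNode h).symm.trans (hI.rest_nrefNode h'))

theorem Inv.todo_retired (hI : Inv s g) {a : Addr} (h : a ∈ (g.thr t).todo) :
    s.status a = .retired := by
  obtain ⟨h1, -⟩ := hI.live t a h
  exact (hI.batch _ (List.ne_nil_of_mem h1)).retired a h1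

/-- A node of a batch that is being freed is freed. -/
theorem Inv.freeNode (hI : Inv s g) {r cur : Addr} {l : List Addr}
    (hphase : (g.batch r).phase = .freeing t) (hnodes : (g.batch r).nodes = cur :: l)
    (hheads : s'.heads = s.heads) (hnode : s'.node = s.node)
    (hstatus : s'.status = Function.update s.status cur .free)
    (hother : ∀ t', t' ≠ t → s'.thr t' = s.thr t')
    (hth : (g.thr t).inside = true → (s'.thr t).active = true ∧
      (s'.thr t).slot = (s.thr t).slot ∧ (s'.thr t).handle = (s.thr t).handle)
    (hini : ∀ a, ¬ Initializing (s'.thr t).pc a)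
    {g' : Ghost P}
    (hg' : g' = ⟨Function.update g.thr t { g.thr t with frees := l },
      Function.update g.batch r { g.batch r with
        nodes := l
        -- With no nodes left the address no longer stands for a batch, and the phase is a mere
        -- default value.
        phase := if l = [] then .counting else .freeing t }⟩)
    (hpc : PcOk P s.node g' t (s'.thr t)) : Inv s' g' := by
  have hini : ∀ t' a, Initializing (s'.thr t').pc a → Initializing (s.thr t').pc a := by
    intro t' a h
    by_cases ht : t' = t
    · subst ht; exact absurd h (hini a)
    · rwa [hother t' ht] at h
  have hself : g'.thr t = { g.thr t with frees := l } := by rw [hg']; simp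
  have hne' : ∀ t', t' ≠ t → g'.thr t' = g.thr t' := fun t' h => by rw [hg']; simp [h]
  have hbr : ∀ q, q ≠ r → g'.batch q = g.batch q := fun q h => by rw [hg']; simp [h]
  have hb := hI.batch r (by simp [hnodes])
  -- Contributions are owed, and lists point, to alive batches only, so nothing in the invariant
  -- outside the entry of `r` and its freeing thread is affected.
  have hnot : ¬ g.Alive r := fun h => h.2 t hphase
  have hnot' : ¬ g'.Alive r := by
    rintro ⟨h1, h2⟩
    rw [hg'] at h1 h2
    simp only [Function.update_self] at h1 h2
    exact h2 t (by rw [if_neg h1])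
  have halive : ∀ q, g.Alive q → g'.batch q = g.batch q := fun q h =>
    hbr q fun e => hnot (e ▸ h)
  have halive' : ∀ q, g.Alive q → g'.Alive q := fun q h => by
    have := halive q h
    exact ⟨by rw [this]; exact h.1, by rw [this]; exact h.2⟩
  have key : ∀ t', (g'.thr t').inside = (g.thr t').inside ∧ (g'.thr t').todo = (g.thr t').todo ∧
      (∀ q, (g'.thr t').tok q = (g.thr t').tok q) ∧ (∀ q, (g'.thr t').owe q = (g.thr t').owe q) ∧
      (g'.thr t').rtok = (g.thr t').rtok ∧ (g'.thr t').rref = (g.thr t').rref ∧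
      (g'.thr t').rest = (g.thr t').rest ∧
      (∀ node q, (g'.thr t').held P node q = (g.thr t').held P node q) := by
    intro t'
    by_cases ht : t' = t
    · subst ht; rw [hself]; exact ⟨rfl, rfl, fun _ => rfl, fun _ => rfl, rfl, rfl, rfl,
        fun _ _ => rfl⟩
    · rw [hne' _ ht]; exact ⟨rfl, rfl, fun _ => rfl, fun _ => rfl, rfl, rfl, rfl, fun _ _ => rfl⟩
  constructor
  case href =>
    intro i
    rw [hheads, hI.href]
    congr 1
    apply Finset.filter_congr
    intro t' _
    rw [(key t').1]
    refine and_congr_right fun h => ?_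
    by_cases ht : t' = t
    · subst ht; rw [(hth h).2.1]
    · rw [hother _ ht]
  case null => rw [hheads]; exact hI.null
  case path =>
    intro t' h
    rw [(key t').1] at h
    rw [(key t').2.1, hheads, hnode]
    by_cases ht : t' = t
    · subst ht
      rw [(hth h).2.1, (hth h).2.2]
      exact ⟨(hth h).1, (hI.path t' h).2⟩
    · rw [hother _ ht]
      exact hI.path t' h
  case live =>
    intro t' a ha
    rw [(key t').2.1] at ha
    have h := hI.live t' a ha
    have := halive _ h.alive
    rw [hnode]
    exact ⟨by rw [this]; exact h.1, by rw [Ghost.Counting, this]; exact h.2⟩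
  case alive =>
    intro t' q h
    rw [(key t').2.2.1] at h
    exact halive' q (hI.alive t' q h)
  case owner =>
    intro t₁ t₂ h1 h2 h3
    rw [(key _).2.2.2.2.1] at h1 h2
    rw [(key _).2.2.2.2.2.1, (key _).2.2.2.2.2.1] at h3
    exact hI.owner t₁ t₂ h1 h2 h3
  case owe_le =>
    intro t'
    by_cases ht : t' = t
    · subst ht; rw [hself]; exact hI.owe_le t'
    · rw [hne' _ ht]; exact hI.owe_le t'
  case rest =>
    intro t' a ha
    rw [(key t').2.2.2.2.2.2.1] at ha
    rw [(key t').2.2.2.2.1, (key t').2.2.2.2.2.1]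
    obtain ⟨h1, h2, h3⟩ := hI.rest t' a ha
    refine ⟨h1, ?_, fun t'' => by rw [(key t'').2.1]; exact h3 t''⟩
    rw [halive _ (hI.alive t' _ (Account.tok_rref h1))]
    exact h2
  case batch =>
    intro q hq
    by_cases hqr : q = r
    · subst hqr
      rw [hg'] at hq ⊢
      simp only [Function.update_self] at hq ⊢
      rw [hnode, hstatus]
      have hnd := hb.nodup
      have hl := hb.last
      rw [hnodes] at hnd hl
      refine ⟨?_, fun a ha => hb.ref a (by simp [hnodes, ha]), fun a ha => ?_,
        (List.nodup_cons.1 hnd).2, hb.count, hb.count_single, hb.adjs, fun h => ?_⟩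
      · rw [← hl]
        obtain ⟨b, l', rfl⟩ := List.exists_cons_of_ne_nil hq
        simp
      · have : a ≠ cur := by rintro rfl; exact (List.nodup_cons.1 hnd).1 ha
        rw [Function.update_of_ne this]
        exact hb.retired a (by simp [hnodes, ha])
      · exact absurd (by rw [if_neg hq]) (h t)
    · rw [hbr q hqr] at hq ⊢
      have hB := hI.batch q hq
      rw [hnode, hstatus]
      refine { hB with retired := fun a ha => ?_ }
      -- Batches are disjoint, because each node names its batch by `NRefNode`.
      have : a ≠ cur := by
        rintro rfl
        exact hqr ((hB.ref a ha).symm.trans (hb.ref a (by simp [hnodes])))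
      rw [Function.update_of_ne this]
      exact hB.retired a ha
  case balance =>
    intro q hq
    have hqr : q ≠ r := by rintro rfl; exact hnot' hq
    have hq' : g.Alive q := by
      have := hbr q hqr
      exact ⟨by rw [← this]; exact hq.1, by rw [← this]; exact hq.2⟩
    have hB := hI.balance q hq'
    rw [halive q hq', hheads, hnode]
    have e1 : ∑ t', (g'.thr t').tok q = ∑ t', (g.thr t').tok q :=
      Finset.sum_congr rfl fun t' _ => (key t').2.2.1 q
    have e2 : ∑ t', (g'.thr t').owe q = ∑ t', (g.thr t').owe q :=
      Finset.sum_congr rfl fun t' _ => (key t').2.2.2.1 q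
    have e3 : ∑ t', (g'.thr t').held P s.node q = ∑ t', (g.thr t').held P s.node q :=
      Finset.sum_congr rfl fun t' _ => (key t').2.2.2.2.2.2.2 _ q
    exact ⟨by rw [missing, e1]; exact hB.tokens, by rw [e2, e3]; exact hB.refs, hB.granted_le,
      hB.nref⟩
  case fresh =>
    intro t' a h
    have h1 := hI.fresh t' a (hini t' a h)
    have : a ≠ cur := by
      rintro rfl
      have := hb.retired a (by simp [hnodes])
      rw [h1] at this
      exact absurd this (by simp)
    rw [hstatus, Function.update_of_ne this]
    exact h1
  case fresh_unique =>
    intro t₁ t₂ a h1 h2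
    exact hI.fresh_unique t₁ t₂ a (hini _ _ h1) (hini _ _ h2)
  case pc =>
    intro t'
    rw [hnode]
    by_cases ht : t' = t
    · subst ht; exact hpc
    · rw [hother _ ht]
      refine (hI.pc t').frame ⟨⟨_, hne' _ ht, Or.inl rfl⟩, fun a _ => ⟨rfl, rfl⟩, ?_, ?_,
        fun a _ => rfl⟩
      · intro q hq
        rw [halive q (hI.alive t' q hq)]
        exact ⟨rfl, rfl, rfl, fun _ => rfl⟩
      · intro q hq _
        have : q ≠ r := by
          rintro rfl
          rw [hphase] at hq
          simp only [Phase.freeing.injEq] at hq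
          exact ht hq.symm
        rw [hbr q this]
        exact ⟨rfl, rfl, fun _ _ => rfl⟩

/-- `retire` initializes `NRef`. -/
theorem Inv.retInit (hI : Inv s g) {ref : Addr} (hrref : (g.thr t).rref = ref)
    (hrtok : (g.thr t).rtok ≠ 0) (hphase : (g.batch ref).phase = .fresh)
    (hset : (g.batch ref).settled = 0) (hgr : (g.batch ref).granted = 0)
    (hdr : (g.batch ref).dropped = 0)
    (hheads : s'.heads = s.heads)
    (hnode : s'.node = Function.update s.node ref { s.node ref with nref := 0 })
    (hstatus : s'.status = s.status) (hother : ∀ t', t' ≠ t → s'.thr t' = s.thr t')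
    (hth : (s'.thr t).active = (s.thr t).active ∧ (s'.thr t).slot = (s.thr t).slot ∧
      (s'.thr t).handle = (s.thr t).handle)
    (hini : ∀ a, ¬ Initializing (s'.thr t).pc a)
    {g' : Ghost P}
    (hg' : g' = ⟨g.thr, Function.update g.batch ref { g.batch ref with phase := .counting }⟩)
    (hpc : PcOk P s'.node g' t (s'.thr t)) : Inv s' g' := by
  have hini : ∀ t' a, Initializing (s'.thr t').pc a → Initializing (s.thr t').pc a := by
    intro t' a h
    by_cases ht : t' = t
    · subst ht; exact absurd h (hini a)
    · rwa [hother t' ht] at h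
  have hthr : ∀ t', (s'.thr t').active = (s.thr t').active ∧
      (s'.thr t').slot = (s.thr t').slot ∧ (s'.thr t').handle = (s.thr t').handle := by
    intro t'
    by_cases ht : t' = t
    · subst ht; exact hth
    · rw [hother _ ht]; exact ⟨rfl, rfl, rfl⟩
  have hg : g'.thr = g.thr := by rw [hg']
  have n0 : ∀ a, s'.node a = s.node a ∨ s'.node a = { s.node a with nref := 0 } := by
    intro a
    rw [hnode, Function.update_apply]
    split_ifs with h
    · subst h; exact Or.inr rfl
    · exact Or.inl rfl
  have n1 : ∀ a, (s'.node a).next = (s.node a).next := fun a => by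
    rcases n0 a with h | h <;> rw [h]
  have n2 : ∀ a, (s'.node a).nrefNode = (s.node a).nrefNode := fun a => by
    rcases n0 a with h | h <;> rw [h]
  have n3 : ∀ a, (s'.node a).batchNext = (s.node a).batchNext := fun a => by
    rcases n0 a with h | h <;> rw [h]
  have n4 : ∀ a, (s'.node a).adjs = (s.node a).adjs := fun a => by
    rcases n0 a with h | h <;> rw [h]
  have hbr : ∀ q, q ≠ ref → g'.batch q = g.batch q := fun q h => by rw [hg']; simp [h]
  have hbref : g'.batch ref = { g.batch ref with phase := .counting } := by rw [hg']; simp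
  have hbn : ∀ q, (g'.batch q).nodes = (g.batch q).nodes ∧ (g'.batch q).k = (g.batch q).k := by
    intro q
    by_cases h : q = ref
    · subst h; rw [hbref]; exact ⟨rfl, rfl⟩
    · rw [hbr q h]; exact ⟨rfl, rfl⟩
  have hal : ∀ q, g'.Alive q ↔ g.Alive q := by
    intro q
    by_cases h : q = ref
    · subst h; simp [Ghost.Alive, hbref, hphase]
    · simp [Ghost.Alive, hbr q h]
  constructor
  case href =>
    intro i
    rw [hheads, hI.href, hg]
    congr 1
    apply Finset.filter_congr
    intro t' _
    rw [(hthr t').2.1]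
  case null => rw [hheads]; exact hI.null
  case path =>
    intro t' h
    rw [hg] at h ⊢
    rw [hheads, (hthr t').1, (hthr t').2.1, (hthr t').2.2]
    exact ⟨(hI.path t' h).1, (hI.path t' h).2.frame fun a _ => n1 a⟩
  case live =>
    intro t' a ha
    rw [hg] at ha
    obtain ⟨h1, h2⟩ := hI.live t' a ha
    refine ⟨by rw [n2, (hbn _).1]; exact h1, ?_⟩
    rw [n2, Ghost.Counting]
    by_cases h : (s.node a).nrefNode = ref
    · rw [h, hbref]
    · rw [hbr _ h]; exact h2
  case alive =>
    intro t' q h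
    rw [hg] at h
    exact (hal q).2 (hI.alive t' q h)
  case owner => rw [hg]; exact hI.owner
  case owe_le => rw [hg]; exact hI.owe_le
  case rest =>
    intro t' a ha
    rw [hg] at ha ⊢
    rw [(hbn _).1]
    exact hI.rest t' a ha
  case batch =>
    intro q hq
    rw [(hbn q).1] at hq
    have hB := hI.batch q hq
    refine ⟨by rw [(hbn q).1]; exact hB.last, fun a ha => ?_, fun a ha => ?_,
      by rw [(hbn q).1]; exact hB.nodup, by rw [(hbn q).2]; exact hB.count,
      by rw [(hbn q).2]; exact hB.count_single, by rw [(hbn q).2, n4]; exact hB.adjs, fun h => ?_⟩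
    · rw [n2]; rw [(hbn q).1] at ha; exact hB.ref a ha
    · rw [hstatus]; rw [(hbn q).1] at ha; exact hB.retired a ha
    · rw [(hbn q).1]
      exact (hB.ring ((hal q).1 ⟨by rw [(hbn q).1]; exact hq, h⟩).2).frame fun a _ => n3 a
  case balance =>
    intro q hq
    have hB := hI.balance q ((hal q).1 hq)
    have e1 : ∑ t', (g.thr t').held P s'.node q = ∑ t', (g.thr t').held P s.node q :=
      Finset.sum_congr rfl fun t' _ => held_congr fun a _ => n2 a
    have e2 : missing s'.heads s'.node g.thr q = missing s.heads s.node g.thr q :=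
      missing_congr (fun i => by rw [hheads]; exact headTok_congr fun a _ => n2 a) rfl
    rw [hg]
    by_cases h : q = ref
    · subst h
      rw [hbref]
      refine ⟨by rw [e2]; exact hB.tokens, by rw [e1]; exact hB.refs, hB.granted_le, fun _ => ?_⟩
      simp [hset, hgr, hdr, hnode]
    · rw [hbr q h]
      refine ⟨by rw [e2]; exact hB.tokens, by rw [e1]; exact hB.refs, hB.granted_le, fun h1 => ?_⟩
      rw [← hB.nref h1, hnode, Function.update_of_ne h]
  case fresh =>
    intro t' a h
    rw [hstatus]; exact hI.fresh t' a (hini t' a h)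
  case fresh_unique =>
    intro t₁ t₂ a h1 h2
    exact hI.fresh_unique t₁ t₂ a (hini _ _ h1) (hini _ _ h2)
  case pc =>
    intro t'
    by_cases ht : t' = t
    · subst ht; exact hpc
    · rw [hother _ ht]
      refine (hI.pc t').frame ⟨⟨_, by rw [hg], Or.inl rfl⟩, fun a _ => ⟨n1 a, n2 a⟩, ?_, ?_,
        fun a _ => n1 a⟩
      · intro q hq
        -- Another thread that owes to the new batch would have to be its owner too, or would adjust
        -- it, which presupposes that the batch counts.
        have : q ≠ ref := by
          rintro rfl
          simp only [Account.tok] at hq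
          by_cases h1 : (g.thr t').rref = q ∧ (g.thr t').rtok ≠ 0
          · exact ht (hI.owner t' t h1.2 hrtok (h1.1.trans hrref.symm))
          · have h2 : (g.thr t').pref = q ∧ (g.thr t').ptok ≠ 0 := by
              by_contra h3
              apply hq
              split_ifs <;> simp_all
            have h3 := (hI.pc t').counting_pref h2.2
            rw [h2.1, Ghost.Counting, hphase] at h3
            exact absurd h3 (by simp)
        rw [hbr q this]
        exact ⟨rfl, rfl, rfl, fun _ => rfl⟩
      · intro q hq _
        have : q ≠ ref := by rintro rfl; simp [hphase] at hq
        rw [hbr q this]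
        exact ⟨rfl, rfl, fun a _ => n3 a⟩

/-- `retire` links the current node to the list of a slot. -/
theorem Inv.retLink (hI : Inv s g) {cur : Addr} {p : Ptr} (hcur : cur ∈ (g.thr t).rest)
    (hheads : s'.heads = s.heads)
    (hnode : s'.node = Function.update s.node cur { s.node cur with next := p })
    (hstatus : s'.status = s.status) (hother : ∀ t', t' ≠ t → s'.thr t' = s.thr t')
    (hth : (s'.thr t).active = (s.thr t).active ∧ (s'.thr t).slot = (s.thr t).slot ∧
      (s'.thr t).handle = (s.thr t).handle)
    (hini : ∀ a, ¬ Initializing (s'.thr t).pc a)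
    (hpc : PcOk P s'.node g t (s'.thr t)) : Inv s' g := by
  have hini : ∀ t' a, Initializing (s'.thr t').pc a → Initializing (s.thr t').pc a := by
    intro t' a h
    by_cases ht : t' = t
    · subst ht; exact absurd h (hini a)
    · rwa [hother t' ht] at h
  have hthr : ∀ t', (s'.thr t').active = (s.thr t').active ∧
      (s'.thr t').slot = (s.thr t').slot ∧ (s'.thr t').handle = (s.thr t').handle := by
    intro t'
    by_cases ht : t' = t
    · subst ht; exact hth
    · rw [hother _ ht]; exact ⟨rfl, rfl, rfl⟩
  have n0 : ∀ a, s'.node a = s.node a ∨ s'.node a = { s.node a with next := p } := by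
    intro a
    rw [hnode, Function.update_apply]
    split_ifs with h
    · subst h; exact Or.inr rfl
    · exact Or.inl rfl
  have n2 : ∀ a, (s'.node a).nrefNode = (s.node a).nrefNode := fun a => by
    rcases n0 a with h | h <;> rw [h]
  have n3 : ∀ a, (s'.node a).batchNext = (s.node a).batchNext := fun a => by
    rcases n0 a with h | h <;> rw [h]
  have n4 : ∀ a, (s'.node a).adjs = (s.node a).adjs := fun a => by
    rcases n0 a with h | h <;> rw [h]
  have n5 : ∀ a, (s'.node a).nref = (s.node a).nref := fun a => by
    rcases n0 a with h | h <;> rw [h]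
  -- The overwritten node is unused and thus lies on nobody's list.
  have n1 : ∀ t', ∀ a ∈ (g.thr t').todo, (s'.node a).next = (s.node a).next := by
    intro t' a ha
    have : a ≠ cur := by rintro rfl; exact (hI.rest t a hcur).2.2 t' ha
    rw [hnode, Function.update_of_ne this]
  constructor
  case href =>
    intro i
    rw [hheads, hI.href]
    congr 1
    apply Finset.filter_congr
    intro t' _
    rw [(hthr t').2.1]
  case null => rw [hheads]; exact hI.null
  case path =>
    intro t' h
    rw [hheads, (hthr t').1, (hthr t').2.1, (hthr t').2.2]
    exact ⟨(hI.path t' h).1, (hI.path t' h).2.frame (n1 t')⟩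
  case live =>
    intro t' a ha
    rw [Ghost.Live, n2]
    exact hI.live t' a ha
  case alive => exact hI.alive
  case owner => exact hI.owner
  case owe_le => exact hI.owe_le
  case rest => exact hI.rest
  case batch =>
    intro q hq
    have hB := hI.batch q hq
    refine ⟨hB.last, fun a ha => ?_, fun a ha => ?_, hB.nodup, hB.count, hB.count_single,
      by rw [n4]; exact hB.adjs, fun h => (hB.ring h).frame fun a _ => n3 a⟩
    · rw [n2]; exact hB.ref a ha
    · rw [hstatus]; exact hB.retired a ha
  case balance =>
    intro q hq
    have hB := hI.balance q hq
    have e1 : ∑ t', (g.thr t').held P s'.node q = ∑ t', (g.thr t').held P s.node q :=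
      Finset.sum_congr rfl fun t' _ => held_congr fun a _ => n2 a
    have e2 : missing s'.heads s'.node g.thr q = missing s.heads s.node g.thr q :=
      missing_congr (fun i => by rw [hheads]; exact headTok_congr fun a _ => n2 a) rfl
    exact ⟨by rw [e2]; exact hB.tokens, by rw [e1]; exact hB.refs, hB.granted_le,
      fun h1 => by rw [n5]; exact hB.nref h1⟩
  case fresh =>
    intro t' a h
    rw [hstatus]; exact hI.fresh t' a (hini t' a h)
  case fresh_unique =>
    intro t₁ t₂ a h1 h2
    exact hI.fresh_unique t₁ t₂ a (hini _ _ h1) (hini _ _ h2)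
  case pc =>
    intro t'
    by_cases ht : t' = t
    · subst ht; exact hpc
    · rw [hother _ ht]
      refine (hI.pc t').frame ⟨⟨_, rfl, Or.inl rfl⟩, fun a ha => ⟨n1 t' a ha, n2 a⟩, ?_, ?_, ?_⟩
      · exact fun q _ => ⟨rfl, rfl, rfl, fun _ => rfl⟩
      · exact fun q _ _ => ⟨rfl, rfl, fun a _ => n3 a⟩
      · intro a ha
        have : a ≠ cur := by rintro rfl; exact ht (hI.rest_unique ha hcur)
        rw [hnode, Function.update_of_ne this]

/-- A change of nodes that do not belong to a batch. -/
theorem Inv.unowned (hI : Inv s g)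
    (hheads : s'.heads = s.heads)
    (hnode : ∀ a, s.status a = .retired → s'.node a = s.node a ∧ s'.status a = .retired)
    (hother : ∀ t', t' ≠ t → s'.thr t' = s.thr t')
    (hth : (s'.thr t).active = (s.thr t).active ∧ (s'.thr t).slot = (s.thr t).slot ∧
      (s'.thr t).handle = (s.thr t).handle)
    (hini : ∀ t' a, Initializing (s'.thr t').pc a → s'.status a = .fresh ∧
      ∀ t'', Initializing (s'.thr t'').pc a → t' = t'')
    (hpc : PcOk P s.node g t (s.thr t) → PcOk P s.node g t (s'.thr t)) : Inv s' g := by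
  have hthr : ∀ t', (s'.thr t').active = (s.thr t').active ∧
      (s'.thr t').slot = (s.thr t').slot ∧ (s'.thr t').handle = (s.thr t').handle := by
    intro t'
    by_cases ht : t' = t
    · subst ht; exact hth
    · rw [hother _ ht]; exact ⟨rfl, rfl, rfl⟩
  have htodo : ∀ t', ∀ a ∈ (g.thr t').todo, s'.node a = s.node a := fun t' a ha =>
    (hnode a (hI.todo_retired ha)).1
  have hnodes : ∀ q, ∀ a ∈ (g.batch q).nodes, s'.node a = s.node a := fun q a ha =>
    (hnode a ((hI.batch q (List.ne_nil_of_mem ha)).retired a ha)).1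
  have hlast : ∀ q, (g.batch q).nodes ≠ [] → q ∈ (g.batch q).nodes := fun q h =>
    List.mem_of_getLast? (hI.batch q h).last
  constructor
  case href =>
    intro i
    rw [hheads, hI.href]
    congr 1
    apply Finset.filter_congr
    intro t' _
    rw [(hthr t').2.1]
  case null => rw [hheads]; exact hI.null
  case path =>
    intro t' h
    rw [hheads, (hthr t').1, (hthr t').2.1, (hthr t').2.2]
    exact ⟨(hI.path t' h).1, (hI.path t' h).2.frame fun a ha => by rw [htodo t' a ha]⟩
  case live =>
    intro t' a ha
    rw [Ghost.Live, htodo t' a ha]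
    exact hI.live t' a ha
  case alive => exact hI.alive
  case owner => exact hI.owner
  case owe_le => exact hI.owe_le
  case rest => exact hI.rest
  case batch =>
    intro q hq
    have hB := hI.batch q hq
    refine ⟨hB.last, fun a ha => ?_, fun a ha => ?_, hB.nodup, hB.count, hB.count_single, ?_,
      fun h => (hB.ring h).frame fun a ha => by rw [hnodes q a ha]⟩
    · rw [hnodes q a ha]; exact hB.ref a ha
    · exact (hnode a (hB.retired a ha)).2
    · rw [hnodes q q (hlast q hq)]; exact hB.adjs
  case balance =>
    intro q hq
    have hB := hI.balance q hq
    have e1 : ∑ t', (g.thr t').held P s'.node q = ∑ t', (g.thr t').held P s.node q :=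
      Finset.sum_congr rfl fun t' _ => held_congr fun a ha => by rw [htodo t' a ha]
    have e2 : missing s'.heads s'.node g.thr q = missing s.heads s.node g.thr q := by
      refine missing_congr (fun i => ?_) rfl
      rw [hheads]
      refine headTok_congr fun a ha => ?_
      obtain ⟨t', -, -, h⟩ := hI.exists_head_mem ha
      rw [htodo t' a h]
    exact ⟨by rw [e2]; exact hB.tokens, by rw [e1]; exact hB.refs, hB.granted_le,
      fun h1 => by rw [hnodes q q (hlast q hq.1)]; exact hB.nref h1⟩
  case fresh => exact fun t' a h => (hini t' a h).1
  case fresh_unique => exact fun t₁ t₂ a h1 h2 => (hini t₁ a h1).2 t₂ h2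
  case pc =>
    intro t'
    have : PcOk P s.node g t' (s'.thr t') := by
      by_cases ht : t' = t
      · subst ht; exact hpc (hI.pc t')
      · rw [hother _ ht]; exact hI.pc t'
    refine this.frame ⟨⟨_, rfl, Or.inl rfl⟩, fun a ha => ?_, ?_, ?_, ?_⟩
    · rw [htodo t' a ha]; exact ⟨rfl, rfl⟩
    · exact fun q _ => ⟨rfl, rfl, rfl, fun _ => rfl⟩
    · exact fun q _ _ => ⟨rfl, rfl, fun a ha => by rw [hnodes q a ha]⟩
    · intro a ha
      rw [hnodes _ a (hI.rest t' a ha).2.1]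

end

section

variable {s s' : State P} {g : Ghost P} {t : Fin P.threads}

/-- The auxiliary state after `cur` was put at the front of the list of slot `i` by thread `t`,
which then has the account `y`. -/
def Ghost.insert (g : Ghost P) (s : State P) (t : Fin P.threads) (y : Account) (i : ℕ)
    (cur : Addr) : Ghost P :=
  { g with thr := fun t' =>
      let z := Function.update g.thr t y t'
      if z.inside = true ∧ (s.thr t').slot = i then { z with todo := cur :: z.todo } else z }

/-- `retire` puts a node at the front of the list of a slot. -/
theorem Inv.insert (hP : P.Valid) (hs : s.WellFormed) (hI : Inv s g) {y : Account} {i : ℕ}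
    {cur : Addr} (hi : i < P.kmax) (hcur : cur ∈ (g.thr t).rest)
    (hcount : g.Counting (g.thr t).rref) (hhref : (s.heads i).href ≠ 0)
    (hnext : (s.node cur).next = (s.heads i).hptr)
    (hin : y.inside = (g.thr t).inside) (htodo : y.todo = (g.thr t).todo)
    -- With shared slots a contribution to the new batch passes from the retiring thread to the
    -- head, and the one to the batch of the former first node passes from the head to the thread.
    (htok : ∀ r, y.tok r + headTok P s.node (some cur) r
      = (g.thr t).tok r + headTok P s.node (s.heads i).hptr r)
    -- With own slots the one thread inside acquires a reference to the new node. With shared slots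
    -- each of the `HRef` threads inside acquires a counted reference to the former first node,
    -- which is no longer first.
    (howe : ∀ r, y.owe r = (g.thr t).owe r + if P.variant.single = true then
      (if (s.node cur).nrefNode = r then 1 else 0)
      else (s.heads i).href * headTok P s.node (s.heads i).hptr r)
    (howner : y.rtok ≠ 0 → (g.thr t).rtok ≠ 0 ∧ y.rref = (g.thr t).rref)
    (hle : y.rowe ≤ P.grain * y.rtok ∧ y.powe ≤ P.grain * y.ptok)
    (hrest : ∀ a ∈ y.rest, a ∈ (g.thr t).rest ∧ a ≠ cur ∧ y.rtok ≠ 0)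
    (hheads : s'.heads = Function.update s.heads i ⟨(s.heads i).href, some cur⟩)
    (hnode : s'.node = s.node) (hstatus : s'.status = s.status)
    (hother : ∀ t', t' ≠ t → s'.thr t' = s.thr t')
    (hth : (s'.thr t).active = (s.thr t).active ∧ (s'.thr t).slot = (s.thr t).slot ∧
      (s'.thr t).handle = (s.thr t).handle)
    (hini : ∀ a, ¬ Initializing (s'.thr t).pc a)
    (hpc : PcOk P s.node (g.setThread t y) t (s'.thr t)) : Inv s' (g.insert s t y i cur) := by
  have hini : ∀ t' a, Initializing (s'.thr t').pc a → Initializing (s.thr t').pc a := by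
    intro t' a h
    by_cases ht : t' = t
    · subst ht; exact absurd h (hini a)
    · rwa [hother t' ht] at h
  have hthr : ∀ t', (s'.thr t').active = (s.thr t').active ∧
      (s'.thr t').slot = (s.thr t').slot ∧ (s'.thr t').handle = (s.thr t').handle := by
    intro t'
    by_cases ht : t' = t
    · subst ht; exact hth
    · rw [hother _ ht]; exact ⟨rfl, rfl, rfl⟩
  set z := Function.update g.thr t y with hz
  have hz1 : ∀ t', (z t').inside = (g.thr t').inside ∧ (z t').todo = (g.thr t').todo := by
    intro t'
    by_cases ht : t' = t
    · subst ht; simp [hz, hin, htodo]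
    · simp [hz, ht]
  have hg' : ∀ t', ∃ l, (g.insert s t y i cur).thr t' = { z t' with todo := l } ∧
      (((g.thr t').inside = true ∧ (s.thr t').slot = i) ∧ l = cur :: (g.thr t').todo ∨
      ¬ ((g.thr t').inside = true ∧ (s.thr t').slot = i) ∧ l = (g.thr t').todo) := by
    intro t'
    have e : (g.insert s t y i cur).thr t' = if (z t').inside = true ∧ (s.thr t').slot = i then
      { z t' with todo := cur :: (z t').todo } else z t' := rfl
    rw [e]
    obtain ⟨e1, e2⟩ := hz1 t'
    split_ifs with h <;> rw [e1] at h
    · exact ⟨_, rfl, Or.inl ⟨h, by rw [e2]⟩⟩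
    · exact ⟨_, rfl, Or.inr ⟨h, e2⟩⟩
  have hbatch : (g.insert s t y i cur).batch = g.batch := rfl
  have hmem : ∀ t', ∀ a ∈ ((g.insert s t y i cur).thr t').todo, a = cur ∨
      a ∈ (g.thr t').todo := by
    intro t' a ha
    obtain ⟨l, h1, ⟨-, rfl⟩ | ⟨-, rfl⟩⟩ := hg' t' <;> rw [h1] at ha
    · exact List.mem_cons.1 ha
    · exact Or.inr ha
  have hcurlive : g.Live s.node cur := by
    rw [Ghost.Live, hI.rest_nrefNode hcur]
    exact ⟨(hI.rest t cur hcur).2.1, hcount⟩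
  have htodocur : ∀ t', cur ∉ (g.thr t').todo := (hI.rest t cur hcur).2.2
  have hpath : ∀ t', ((g.insert s t y i cur).thr t').inside = true →
      Path s.node (s.thr t').handle (s'.heads (s.thr t').slot).hptr
        ((g.insert s t y i cur).thr t').todo := by
    intro t' h
    obtain ⟨l, h1, hcase⟩ := hg' t'
    rw [h1] at h ⊢
    have h' : (g.thr t').inside = true := by rw [← (hz1 t').1]; exact h
    have hp := (hI.path t' h').2
    rcases hcase with ⟨⟨-, hslot⟩, rfl⟩ | ⟨hno, rfl⟩
    · rw [hslot, hheads, Function.update_self]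
      rw [hslot] at hp
      refine ⟨rfl, ?_⟩
      rw [if_neg, hnext]
      · exact hp
      -- The walk from the new node would stop there only if that node were the handle.
      · intro hc
        rw [← hc] at hp
        exact htodocur t' hp.mem_handle
    · have : (s.thr t').slot ≠ i := fun e => hno ⟨h', e⟩
      rw [hheads, Function.update_of_ne this]
      exact hp
  have htok' : ∀ t' r, ((g.insert s t y i cur).thr t').tok r = (z t').tok r := by
    intro t' r
    obtain ⟨l, h1, -⟩ := hg' t'
    rw [h1]; rfl
  have howe' : ∀ t' r, ((g.insert s t y i cur).thr t').owe r = (z t').owe r := by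
    intro t' r
    obtain ⟨l, h1, -⟩ := hg' t'
    rw [h1]; rfl
  have hfields : ∀ t', ((g.insert s t y i cur).thr t').rtok = (z t').rtok ∧
      ((g.insert s t y i cur).thr t').rref = (z t').rref ∧
      ((g.insert s t y i cur).thr t').rest = (z t').rest ∧
      ((g.insert s t y i cur).thr t').inside = (g.thr t').inside ∧
      ((g.insert s t y i cur).thr t').rowe = (z t').rowe ∧
      ((g.insert s t y i cur).thr t').ptok = (z t').ptok ∧
      ((g.insert s t y i cur).thr t').powe = (z t').powe := by
    intro t'
    obtain ⟨l, h1, -⟩ := hg' t'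
    rw [h1]; exact ⟨rfl, rfl, rfl, (hz1 t').1, rfl, rfl, rfl⟩
  have hheld : ∀ t' r, ((g.insert s t y i cur).thr t').held P s.node r =
      (g.thr t').held P s.node r + if (g.thr t').inside = true ∧ (s.thr t').slot = i then
        (if P.variant.single = true then (if (s.node cur).nrefNode = r then 1 else 0)
        else headTok P s.node (s.heads i).hptr r) else 0 := by
    intro t' r
    obtain ⟨l, h1, hcase⟩ := hg' t'
    rw [h1]
    have e1 := (hz1 t').1
    rcases hcase with ⟨hyes, rfl⟩ | ⟨hno, rfl⟩
    · rw [if_pos hyes]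
      rcases hsing : P.variant.single
      · have hp := (hI.path t' hyes.1).2
        rw [hyes.2] at hp
        cases hh : (s.heads i).hptr with
        | none =>
          rw [hh] at hp
          simp [Account.held, Account.counted, hsing, hyes.1, e1, hp.of_none.1, headTok]
        | some p =>
          rw [hh] at hp
          obtain ⟨l', hl', -⟩ := hp.of_some
          simp [Account.held, Account.counted, hsing, hyes.1, e1, hl', headTok,
            List.countP_cons]
      · simp [Account.held, Account.counted, hsing, List.countP_cons]
    · rw [if_neg hno]
      simp only [Account.held, Account.counted, e1, add_zero]
  constructor
  case href =>
    intro j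
    have : (s'.heads j).href = (s.heads j).href := by
      rw [hheads, Function.update_apply]; split_ifs with h
      · rw [h]
      · rfl
    rw [this, hI.href]
    congr 1
    apply Finset.filter_congr
    intro t' _
    rw [(hthr t').2.1, (hfields t').2.2.2.1]
  case null =>
    intro j
    rw [hheads, Function.update_apply]; split_ifs with h
    · exact fun h => absurd h hhref
    · exact hI.null j
  case path =>
    intro t' h
    rw [(hthr t').1, (hthr t').2.1, (hthr t').2.2, hnode]
    exact ⟨(hI.path t' (by rw [← (hfields t').2.2.2.1]; exact h)).1, hpath t' h⟩
  case live =>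
    intro t' a ha
    rw [hnode]
    rcases hmem t' a ha with rfl | h
    · exact hcurlive
    · exact hI.live t' a h
  case alive =>
    intro t' r h
    rw [htok'] at h
    by_cases ht : t' = t
    · subst ht
      simp only [hz, Function.update_self] at h
      by_cases h0 : (g.thr t').tok r = 0
      · have h1 := htok r
        have h2 : headTok P s.node (s.heads i).hptr r ≠ 0 := by omega
        cases hp : (s.heads i).hptr with
        | none => simp [hp, headTok] at h2
        | some p =>
          simp only [hp, headTok] at h2
          split_ifs at h2 with h3 h4
          · simp at h2
          · exact h4 ▸ (hI.head_live hp).alive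
          · simp at h2
      · exact hI.alive t' r h0
    · simp only [hz, Function.update_of_ne ht] at h
      exact hI.alive t' r h
  case owner =>
    have key : ∀ t', ((g.insert s t y i cur).thr t').rtok ≠ 0 → (g.thr t').rtok ≠ 0 ∧
        ((g.insert s t y i cur).thr t').rref = (g.thr t').rref := by
      intro t' h
      rw [(hfields t').1] at h
      rw [(hfields t').2.1]
      by_cases ht : t' = t
      · subst ht
        simp only [hz, Function.update_self] at h ⊢
        exact howner h
      · simp only [hz, Function.update_of_ne ht] at h ⊢
        simpa using h
    intro t₁ t₂ h1 h2 h3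
    exact hI.owner t₁ t₂ (key _ h1).1 (key _ h2).1 (by rw [← (key _ h1).2, ← (key _ h2).2, h3])
  case owe_le =>
    intro t'
    rw [(hfields t').1, (hfields t').2.2.2.2.1, (hfields t').2.2.2.2.2.1,
      (hfields t').2.2.2.2.2.2]
    by_cases ht : t' = t
    · subst ht; simpa [hz] using hle
    · simpa [hz, ht] using hI.owe_le t'
  case rest =>
    intro t' a ha
    rw [(hfields t').2.2.1] at ha
    rw [(hfields t').1, (hfields t').2.1, hbatch]
    by_cases ht : t' = t
    · subst ht
      simp only [hz, Function.update_self] at ha ⊢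
      obtain ⟨h1, h2, h3⟩ := hrest a ha
      refine ⟨h3, ?_, fun t'' h => ?_⟩
      · rw [(howner h3).2]; exact (hI.rest t' a h1).2.1
      · rcases hmem t'' a h with h | h
        · exact h2 h
        · exact (hI.rest t' a h1).2.2 t'' h
    · simp only [hz, Function.update_of_ne ht] at ha ⊢
      obtain ⟨h1, h2, h3⟩ := hI.rest t' a ha
      refine ⟨h1, h2, fun t'' h => ?_⟩
      rcases hmem t'' a h with h | h
      · exact ht (hI.rest_unique ha (h ▸ hcur))
      · exact h3 t'' h
  case batch => rw [hnode, hstatus]; exact hI.batch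
  case balance =>
    intro r hr
    have hb := hI.balance r hr
    rw [hnode, hbatch]
    have a1 := sum_update_add g.thr (Finset.mem_univ t) y (fun y => y.tok r)
    have a2 := sum_update_add g.thr (Finset.mem_univ t) y (fun y => y.owe r)
    have a3 := sum_update_add s.heads (Finset.mem_range.2 hi) ⟨(s.heads i).href, some cur⟩
      (fun h => headTok P s.node h.hptr r)
    rw [← hz] at a1 a2
    rw [← hheads] at a3
    have e1 : ∑ t', ((g.insert s t y i cur).thr t').tok r = ∑ t', (z t').tok r :=
      Finset.sum_congr rfl fun t' _ => htok' t' r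
    have e2 : ∑ t', ((g.insert s t y i cur).thr t').owe r = ∑ t', (z t').owe r :=
      Finset.sum_congr rfl fun t' _ => howe' t' r
    -- The number of threads that gain a reference is `HRef`, by the invariant on the heads. It is
    -- the same number that the retiring thread owes from now on.
    have e3 : ∑ t', ((g.insert s t y i cur).thr t').held P s.node r =
        ∑ t', (g.thr t').held P s.node r + (s.heads i).href *
        (if P.variant.single = true then (if (s.node cur).nrefNode = r then 1 else 0)
        else headTok P s.node (s.heads i).hptr r) := by
      rw [Finset.sum_congr rfl fun t' _ => hheld t' r, Finset.sum_add_distrib, hI.href,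
        ← Finset.sum_filter, Finset.sum_const, smul_eq_mul]
    have b1 := hb.tokens
    have b2 := hb.refs
    have c1 := htok r
    have c2 := howe r
    simp only [missing] at b1
    dsimp only at a1 a2 a3
    refine ⟨?_, ?_, hb.granted_le, hb.nref⟩
    · rw [missing, e1]; omega
    · rw [e2, e3]
      by_cases hsing : P.variant.single = true
      · have := hI.href_le_one hP hs hsing i
        have h1 : (s.heads i).href = 1 := by omega
        simp only [hsing, if_true, h1, one_mul] at c2 ⊢
        omega
      · simp only [hsing] at c2 ⊢
        simp only [Bool.false_eq_true, if_false] at c2 ⊢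
        omega
  case fresh =>
    intro t' a h
    rw [hstatus]; exact hI.fresh t' a (hini t' a h)
  case fresh_unique =>
    intro t₁ t₂ a h1 h2
    exact hI.fresh_unique t₁ t₂ a (hini _ _ h1) (hini _ _ h2)
  case pc =>
    intro t'
    rw [hnode]
    obtain ⟨l, h1, hcase⟩ := hg' t'
    have hfr : ∀ g₀ : Ghost P, g₀.thr t' = z t' → g₀.batch = g.batch →
        Frame s.node s.node g₀ (g.insert s t y i cur) t' := by
      intro g₀ h2 h3
      obtain ⟨e1, e2⟩ := hz1 t'
      refine ⟨⟨l, by rw [h1, h2], ?_⟩, fun a _ => ⟨rfl, rfl⟩, fun q _ => ?_, fun q _ _ => ?_,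
        fun a _ => rfl⟩
      · rw [h2, e1, e2]
        rcases hcase with ⟨h4, h5⟩ | ⟨-, h5⟩
        · exact Or.inr ⟨h4.1, cur, h5⟩
        · exact Or.inl h5
      · rw [h3]; exact ⟨rfl, rfl, rfl, fun _ => rfl⟩
      · rw [h3]; exact ⟨rfl, rfl, fun _ _ => rfl⟩
    by_cases ht : t' = t
    · subst ht
      exact PcOk.frame (hfr (g.setThread t' y) (by simp [hz]) rfl) hpc
    · rw [hother _ ht]
      exact (hI.pc t').frame (hfr _ (by simp [hz, ht]) rfl)

/-- A batch is handed over. -/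
theorem Inv.newBatch (hI : Inv s g) {r k : ℕ} {l : List Addr} {x : Account}
    (hq : (g.thr t).Quiet) (hempty : (g.batch r).nodes = [])
    (hx1 : x.inside = (g.thr t).inside) (hx2 : x.todo = (g.thr t).todo) (hx3 : x.rref = r)
    (hx4 : x.rtok = P.total k) (hx5 : x.rowe = 0) (hx6 : x.ptok = 0) (hx7 : x.powe = 0)
    (hx8 : ∀ a ∈ x.rest, a ∈ l ∧ x.rtok ≠ 0)
    (hl : ∀ t', ∀ a ∈ l, a ∉ (g.thr t').todo)
    (hnode : s'.node = s.node) (hstatus : s'.status = s.status)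
    (hok : BatchOk P s.node s.status r ⟨l, k, .fresh, 0, 0, 0⟩)
    (hheads : s'.heads = s.heads) (hother : ∀ t', t' ≠ t → s'.thr t' = s.thr t')
    (hth : (s'.thr t).active = (s.thr t).active ∧ (s'.thr t).slot = (s.thr t).slot ∧
      (s'.thr t).handle = (s.thr t).handle)
    (hini : ∀ a, ¬ Initializing (s'.thr t).pc a)
    {g' : Ghost P}
    (hg' : g' = ⟨Function.update g.thr t x,
      Function.update g.batch r ⟨l, k, .fresh, 0, 0, 0⟩⟩)
    (hpc : PcOk P s.node g' t (s'.thr t)) : Inv s' g' := by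
  have hini : ∀ t' a, Initializing (s'.thr t').pc a → Initializing (s.thr t').pc a := by
    intro t' a h
    by_cases ht : t' = t
    · subst ht; exact absurd h (hini a)
    · rwa [hother t' ht] at h
  have hthr : ∀ t', (s'.thr t').active = (s.thr t').active ∧
      (s'.thr t').slot = (s.thr t').slot ∧ (s'.thr t').handle = (s.thr t').handle := by
    intro t'
    by_cases ht : t' = t
    · subst ht; exact hth
    · rw [hother _ ht]; exact ⟨rfl, rfl, rfl⟩
  have hself : g'.thr t = x := by rw [hg']; simp
  have hne' : ∀ t', t' ≠ t → g'.thr t' = g.thr t' := fun t' h => by rw [hg']; simp [h]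
  have hbr : ∀ q, q ≠ r → g'.batch q = g.batch q := fun q h => by rw [hg']; simp [h]
  have hbr' : g'.batch r = ⟨l, k, .fresh, 0, 0, 0⟩ := by rw [hg']; simp
  -- The address stood for no batch, so no account and no list refers to it, and all its old sums
  -- are zero.
  have hnot : ¬ g.Alive r := fun h => h.1 hempty
  have halive : ∀ q, g.Alive q → g'.batch q = g.batch q := fun q h =>
    hbr q fun e => hnot (e ▸ h)
  have halive' : ∀ q, g.Alive q → g'.Alive q := fun q h => by
    have := halive q h
    exact ⟨by rw [this]; exact h.1, by rw [this]; exact h.2⟩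
  have haliver : g'.Alive r := by
    refine ⟨?_, fun t' => by rw [hbr']; simp⟩
    have := hok.last
    rw [hbr']
    rintro h
    simp only at h this
    simp [h] at this
  have htokr : ∀ t', (g.thr t').tok r = 0 := fun t' => by
    by_contra h
    exact hnot (hI.alive t' r h)
  have hxtok : ∀ q, x.tok q = if r = q then P.total k else 0 := fun q => by
    simp [Account.tok, hx3, hx4, hx6]
  have hxowe : ∀ q, x.owe q = 0 := fun q => by
    simp [Account.owe, hx5, hx7]
  have hqowe : ∀ q, (g.thr t).owe q = 0 := fun q => by
    simp [Account.owe, hI.rowe_eq_zero hq.1, hI.powe_eq_zero hq.2.1]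
  have key : ∀ t', (g'.thr t').inside = (g.thr t').inside ∧ (g'.thr t').todo = (g.thr t').todo ∧
      (∀ node q, (g'.thr t').held P node q = (g.thr t').held P node q) := by
    intro t'
    by_cases ht : t' = t
    · subst ht; rw [hself]
      refine ⟨hx1, hx2, fun node q => ?_⟩
      simp only [Account.held, Account.counted, hx1, hx2]
    · rw [hne' _ ht]; exact ⟨rfl, rfl, fun _ _ => rfl⟩
  have hnr : ∀ t', ∀ a ∈ (g.thr t').todo, (s.node a).nrefNode ≠ r := by
    intro t' a ha h
    exact hnot (h ▸ (hI.live t' a ha).alive)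
  constructor
  case href =>
    intro i
    rw [hheads, hI.href]
    congr 1
    apply Finset.filter_congr
    intro t' _
    rw [(key t').1, (hthr t').2.1]
  case null => rw [hheads]; exact hI.null
  case path =>
    intro t' h
    rw [(key t').1] at h
    rw [(key t').2.1, hheads, hnode, (hthr t').1, (hthr t').2.1, (hthr t').2.2]
    exact hI.path t' h
  case live =>
    intro t' a ha
    rw [(key t').2.1] at ha
    have h := hI.live t' a ha
    have := halive _ h.alive
    rw [hnode]
    exact ⟨by rw [this]; exact h.1, by rw [Ghost.Counting, this]; exact h.2⟩
  case alive =>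
    intro t' q h
    by_cases ht : t' = t
    · subst ht
      rw [hself, hxtok] at h
      have : r = q := by
        by_contra hrq
        simp [hrq] at h
      exact this ▸ haliver
    · rw [hne' _ ht] at h
      exact halive' q (hI.alive t' q h)
  case owner =>
    intro t₁ t₂ h1 h2 h3
    by_cases k1 : t₁ = t <;> by_cases k2 : t₂ = t
    · rw [k1, k2]
    · exfalso
      rw [hne' _ k2] at h2 h3
      rw [k1, hself, hx3] at h3
      have := hI.alive t₂ _ (Account.tok_rref h2)
      exact hnot (h3 ▸ this)
    · exfalso
      rw [hne' _ k1] at h1 h3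
      rw [k2, hself, hx3] at h3
      have := hI.alive t₁ _ (Account.tok_rref h1)
      exact hnot (h3 ▸ this)
    · rw [hne' _ k1] at h1 h3
      rw [hne' _ k2] at h2 h3
      exact hI.owner t₁ t₂ h1 h2 h3
  case owe_le =>
    intro t'
    by_cases ht : t' = t
    · subst ht; rw [hself, hx5, hx7]; simp
    · rw [hne' _ ht]; exact hI.owe_le t'
  case rest =>
    intro t' a ha
    by_cases ht : t' = t
    · subst ht
      rw [hself] at ha ⊢
      obtain ⟨h1, h2⟩ := hx8 a ha
      refine ⟨h2, ?_, fun t'' => by rw [(key t'').2.1]; exact hl t'' a h1⟩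
      rw [hx3, hbr']; exact h1
    · rw [hne' _ ht] at ha ⊢
      obtain ⟨h1, h2, h3⟩ := hI.rest t' a ha
      refine ⟨h1, ?_, fun t'' => by rw [(key t'').2.1]; exact h3 t''⟩
      rw [halive _ (hI.alive t' _ (Account.tok_rref h1))]
      exact h2
  case batch =>
    intro q hq
    rw [hnode, hstatus]
    by_cases hqr : q = r
    · subst hqr; rw [hbr']; exact hok
    · rw [hbr q hqr] at hq ⊢
      exact hI.batch q hq
  case balance =>
    intro q hal
    rw [hheads, hnode]
    have a1 := sum_update_add g.thr (Finset.mem_univ t) x (fun y => y.tok q)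
    have a2 := sum_update_add g.thr (Finset.mem_univ t) x (fun y => y.owe q)
    have e0 : Function.update g.thr t x = g'.thr := by rw [hg']
    rw [e0] at a1 a2
    simp only [hxtok, hxowe, hqowe, hq.tok] at a1 a2
    have e3 : ∑ t', (g'.thr t').held P s.node q = ∑ t', (g.thr t').held P s.node q :=
      Finset.sum_congr rfl fun t' _ => (key t').2.2 _ q
    by_cases hqr : q = r
    · subst hqr
      rw [hbr']
      have z1 : ∑ t', (g.thr t').tok q = 0 := Finset.sum_eq_zero fun t' _ => htokr t'
      have z2 : ∑ t', (g.thr t').owe q = 0 := by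
        refine Finset.sum_eq_zero fun t' _ => ?_
        have := Account.owe_le_tok (hI.owe_le t') q
        rw [htokr t'] at this
        simpa using this
      have z3 : ∑ t', (g.thr t').held P s.node q = 0 := by
        refine Finset.sum_eq_zero fun t' _ => ?_
        rw [Account.held, List.countP_eq_zero]
        intro a ha
        simpa using hnr t' a (counted_subset ha)
      have z4 : ∑ i ∈ Finset.range P.kmax, headTok P s.node (s.heads i).hptr q = 0 := by
        refine Finset.sum_eq_zero fun i _ => ?_
        cases hp : (s.heads i).hptr with
        | none => simp [headTok]
        | some a =>
          obtain ⟨t', -, -, h⟩ := hI.exists_head_mem hp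
          simp [headTok, hnr t' a h]
      simp only [if_true] at a1
      refine ⟨?_, ?_, by simp, fun h => by simp at h⟩
      · simp only [missing]; omega
      · rw [e3, z3]; simp only; omega
    · have hq' : g.Alive q := by
        have := hbr q hqr
        exact ⟨by rw [← this]; exact hal.1, by rw [← this]; exact hal.2⟩
      have hB := hI.balance q hq'
      rw [halive q hq']
      simp only [Ne.symm hqr, if_false] at a1
      refine ⟨?_, ?_, hB.granted_le, hB.nref⟩
      · have := hB.tokens
        simp only [missing] at this ⊢
        omega
      · have := hB.refs
        omega
  case fresh =>
    intro t' a h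
    rw [hstatus]; exact hI.fresh t' a (hini t' a h)
  case fresh_unique =>
    intro t₁ t₂ a h1 h2
    exact hI.fresh_unique t₁ t₂ a (hini _ _ h1) (hini _ _ h2)
  case pc =>
    intro t'
    rw [hnode]
    by_cases ht : t' = t
    · subst ht; exact hpc
    · rw [hother _ ht]
      refine (hI.pc t').frame ⟨⟨_, hne' _ ht, Or.inl rfl⟩, fun a _ => ⟨rfl, rfl⟩, ?_, ?_,
        fun a _ => rfl⟩
      · intro q hq
        rw [halive q (hI.alive t' q hq)]
        exact ⟨rfl, rfl, rfl, fun _ => rfl⟩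
      · intro q _ hq
        have : q ≠ r := by rintro rfl; exact hq hempty
        rw [hbr q this]
        exact ⟨rfl, rfl, fun _ _ => rfl⟩

end

/-! ## The links of a batch -/

/-- Induction over suffixes: without duplicates, the index of the first element of a suffix is the
length of the prefix. The remainder modulo the length matters for the last node only. -/
theorem ring_of_getD {N : ℕ} {node : Addr → Node N} {l : List Addr} (hnd : l.Nodup)
    (h : ∀ a ∈ l, (node a).batchNext = l.getD ((l.idxOf a + 1) % l.length) 0) :
    Ring node (l.headD 0) l := by
  have key : ∀ suf pre, l = pre ++ suf → Ring node (l.headD 0) suf := by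
    intro suf
    induction suf with
    | nil => intro pre _; trivial
    | cons a suf ih =>
      intro pre hl
      have hnd' := hnd
      rw [hl, List.nodup_append] at hnd'
      have hidx : l.idxOf a = pre.length := by
        rw [hl, List.idxOf_append_of_notMem]
        · simp
        · intro ha; exact hnd'.2.2 a ha a (by simp) rfl
      have hnext := h a (by simp [hl])
      rw [hidx] at hnext
      cases suf with
      | nil =>
        have : l.length = pre.length + 1 := by rw [hl]; simp
        rw [this, Nat.mod_self] at hnext
        simp only [Ring]
        rw [hnext]
        cases l <;> simp
      | cons b suf =>
        have hlen : pre.length + 1 < l.length := by rw [hl]; simp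
        rw [Nat.mod_eq_of_lt hlen] at hnext
        refine ⟨?_, ?_, ih (pre ++ [a]) (by simp [hl])⟩
        · rw [hnext, hl]; simp
        · rw [hl]
          cases pre with
          | nil =>
            have := hnd'.2.1
            simp at this ⊢
            tauto
          | cons c pre =>
            have := hnd'.2.2 c (by simp) b (by simp)
            simpa using this.symm
  exact key l [] rfl

theorem Ring.last {N : ℕ} {node : Addr → Node N} {first r : Addr} {l : List Addr}
    (h : Ring node first l) (hl : l.getLast? = some r) : (node r).batchNext = first := by
  induction l with
  | nil => simp at hl
  | cons a l ih =>
    cases l with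
    | nil =>
      obtain rfl : a = r := by simpa using hl
      exact h
    | cons b l => exact ih h.2.2 (by simpa using hl)

theorem Ring.next {N : ℕ} {node : Addr → Node N} {first a b : Addr} {pre suf : List Addr}
    (h : Ring node first (pre ++ a :: b :: suf)) : (node a).batchNext = b := by
  induction pre with
  | nil => exact h.1
  | cons c pre ih =>
    cases pre with
    | nil => exact h.2.2.1
    | cons d pre => exact ih h.2.2

/-! ### The lists to be traversed, step by step -/

/-- The accounts of a thread before and after a step of thread `t`, unless the thread itself
changes its list: nodes are put at the front of the list by insertions only. -/
def Keeps (s : State P) (t t' : Fin P.threads) (x x' : Account) : Prop :=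
  x'.inside = x.inside ∧ (x'.todo = x.todo ∨
    x.inside = true ∧ InsertCommit s t (s.thr t').slot ∧ ∃ a, x'.todo = a :: x.todo)

/-- What happens to the lists that the threads have to traverse in a step of thread `t`. -/
structure Track (s : State P) (t : Fin P.threads) (g g' : Ghost P) : Prop where
  other : ∀ t', t' ≠ t → Keeps s t t' (g.thr t') (g'.thr t') ∧
    (g'.thr t').frees = (g.thr t').frees
  keep : (∀ slot, ¬ EnterCommit s t slot) → (∀ slot, ¬ LeaveCommit s t slot) →
    (∀ curr next ref n, (s.thr t).pc ≠ .travFAA curr next ref n) →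
    Keeps s t t (g.thr t) (g'.thr t)
  enter : ∀ slot, EnterCommit s t slot →
    (g'.thr t).inside = true ∧ (g'.thr t).counted P = []
  leave : ∀ slot, LeaveCommit s t slot → (g'.thr t).inside = false ∧
    (g'.thr t).todo = (g.thr t).counted P
  drop : ∀ curr next ref n, (s.thr t).pc = .travFAA curr next ref n →
    (g'.thr t).inside = false ∧ (g.thr t).todo = curr :: (g'.thr t).todo
  free : ∀ first cur c, (s.thr t).pc = .freeNode first cur c →
    (g.thr t).frees = cur :: (g'.thr t).frees

section

variable {s s' : State P} {g : Ghost P} {t : Fin P.threads}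

theorem Track.refl (he : ∀ slot, ¬ EnterCommit s t slot) (hl : ∀ slot, ¬ LeaveCommit s t slot)
    (hd : ∀ curr next ref n, (s.thr t).pc ≠ .travFAA curr next ref n)
    (hf : ∀ first cur c, (s.thr t).pc ≠ .freeNode first cur c) : Track s t g g where
  other _ _ := ⟨⟨rfl, Or.inl rfl⟩, rfl⟩
  keep _ _ _ := ⟨rfl, Or.inl rfl⟩
  enter slot h := absurd h (he slot)
  leave slot h := absurd h (hl slot)
  drop _ _ _ _ h := absurd h (hd _ _ _ _)
  free _ _ _ h := absurd h (hf _ _ _)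

/-- A step that changes nothing but the fields of the account of the thread that do not matter
here. -/
theorem Track.local {g' : Ghost P} (hother : ∀ t', t' ≠ t → g'.thr t' = g.thr t')
    (h1 : (g'.thr t).inside = (g.thr t).inside) (h2 : (g'.thr t).todo = (g.thr t).todo)
    (he : ∀ slot, ¬ EnterCommit s t slot) (hl : ∀ slot, ¬ LeaveCommit s t slot)
    (hd : ∀ curr next ref n, (s.thr t).pc ≠ .travFAA curr next ref n)
    (hf : ∀ first cur c, (s.thr t).pc = .freeNode first cur c →
      (g.thr t).frees = cur :: (g'.thr t).frees) : Track s t g g' where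
  other t' ht := by rw [hother t' ht]; exact ⟨⟨rfl, Or.inl rfl⟩, rfl⟩
  keep _ _ _ := ⟨h1, Or.inl h2⟩
  enter slot h := absurd h (he slot)
  leave slot h := absurd h (hl slot)
  drop _ _ _ _ h := absurd h (hd _ _ _ _)
  free := hf

/-! ## Return from `adjust` and `free_batch` -/

/-- The comparison with the handle in `resume` is the case distinction in `PathAfter`: at the handle
the list is used up, otherwise it goes on from `next`. -/
theorem ContOk.pcOk_resume {node : Addr → Node P.bits} {s : State P} {c : Cont P.bits}
    (hc : ContOk P node g (g.thr t) (s.thr t).handle c) (hp : (g.thr t).ptok = 0)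
    (hact : (s.thr t).active = true) : PcOk P node g t ((s.resume t c).thr t) := by
  cases c with
  | leave curr next =>
    obtain ⟨h1, h2, h3, h4⟩ := hc
    simp only [State.resume]
    unfold PathAfter at h4
    split_ifs with h
    · rw [if_neg h] at h4
      simp [PcOk, State.goto, State.setThread, Account.Quiet, h1, h2, hp, h3, h4]
    · rw [if_pos (not_not.1 h)] at h4
      simp [PcOk, State.finishLeave, State.setThread, Account.Quiet, h1, h2, hp, h3, h4]
  | slot r href =>
    obtain ⟨h1, h2, h3⟩ := hc
    simp only [State.resume]
    split_ifs with h
    · simp only [State.goto, State.setThread, PcOk, Function.update_self]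
      exact ⟨h1, h2, hp, h3⟩
    · simp only [State.goto, State.setThread, PcOk, Function.update_self]
      exact ⟨⟨h1.inside, h1.ref, h1.tok, h1.owe, h1.inserts_le, h1.empty, h1.doAdj, h1.batch⟩,
        h2, hp, h3⟩
  | done =>
    obtain ⟨h1, h2, h3⟩ := hc
    simp [State.resume, PcOk, State.goto, State.setThread, Account.Quiet, h1, h2, hp, h3, hact]
  | trav curr next counter =>
    obtain ⟨h1, h2, h3, h4⟩ := hc
    simp only [State.resume, State.endTraverse]
    unfold PathAfter at h4
    split_ifs with h h'
    · rw [if_neg h] at h4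
      simp [PcOk, State.goto, State.setThread, Account.Quiet, h1, h2, hp, h3, h4]
    · rw [if_pos (not_not.1 h)] at h4
      simp [PcOk, State.goto, State.setThread, Account.Quiet, h1, h2, hp, h3, h4]
    · rw [if_pos (not_not.1 h)] at h4
      simp [PcOk, State.finishLeave, State.setThread, Account.Quiet, h1, h2, hp, h3, h4]

/-- The continuations that may end a `leave` occur outside only, so a thread that is inside stays
active. -/
theorem ContOk.resume_thr {node : Addr → Node P.bits} {s : State P} {c : Cont P.bits}
    {x : Account} {handle : Ptr}
    (hc : ContOk P node g x handle c) (hin : x.inside = true) :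
    ((s.resume t c).thr t).active = (s.thr t).active ∧
    ((s.resume t c).thr t).slot = (s.thr t).slot ∧
    ((s.resume t c).thr t).handle = (s.thr t).handle := by
  cases c with
  | leave curr next => simp [hc.2.2.1] at hin
  | trav curr next counter => simp [hc.2.2.1] at hin
  | slot r href =>
    simp only [State.resume]
    split_ifs <;> simp [State.goto, State.setThread]
  | done => simp [State.resume, State.goto, State.setThread]

theorem not_initializing_resume (s : State P) (c : Cont P.bits) (a : Addr) :
    ¬ Initializing ((s.resume t c).thr t).pc a := by
  cases c <;> simp only [State.resume, State.endTraverse] <;> (try split_ifs) <;>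
    simp [State.goto, State.setThread, State.finishLeave, Initializing]

/-- A continuation does not depend on `pref`, `ptok`, `powe` and `frees`, the fields used up by
`adjust` and `free_batch`. -/
theorem ContOk.transfer {node node' : Addr → Node P.bits} {g g' : Ghost P} {x x' : Account}
    {handle : Ptr} {c : Cont P.bits} (hc : ContOk P node g x handle c)
    (h1 : x'.inside = x.inside) (h2 : x'.todo = x.todo) (h3 : x'.rref = x.rref)
    (h4 : x'.rtok = x.rtok) (h5 : x'.rowe = x.rowe) (h6 : x'.rest = x.rest)
    (h7 : x'.skip = x.skip)
    (hnode : ∀ a ∈ x.todo, (node' a).next = (node a).next)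
    (hb : x.rtok ≠ 0 → (g'.batch x.rref).nodes = (g.batch x.rref).nodes ∧
      (g'.batch x.rref).k = (g.batch x.rref).k ∧ (g.Counting x.rref → g'.Counting x.rref)) :
    ContOk P node' g' x' handle c := by
  cases c with
  | leave curr next =>
    obtain ⟨k1, k2, k3, k4⟩ := hc
    exact ⟨h4.trans k1, h6.trans k2, h1.trans k3, by rw [h2]; exact k4.frame hnode⟩
  | trav curr next counter =>
    obtain ⟨k1, k2, k3, k4⟩ := hc
    exact ⟨h4.trans k1, h6.trans k2, h1.trans k3, by rw [h2]; exact k4.frame hnode⟩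
  | done =>
    obtain ⟨k1, k2, k3⟩ := hc
    exact ⟨h4.trans k1, h6.trans k2, h1.trans k3⟩
  | slot r href =>
    obtain ⟨k1, k2, k3⟩ := hc
    refine ⟨⟨h1.trans k1.inside, h3.trans k1.ref, by rw [h4, h7]; exact k1.tok,
      h5.trans k1.owe, k1.inserts_le, by rw [h7]; exact k1.empty, by rw [h7]; exact k1.doAdj,
      fun h => ?_⟩, ?_, fun h => ?_⟩
    · rw [h4] at h
      rw [h3, (hb h).1, (hb h).2.1]; exact k1.batch h
    · unfold CurrentOk at *
      rw [h3, h6]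
      split_ifs with hi
      · rw [if_pos hi] at k2
        rw [(hb (k1.rtok_ne hi)).1]
        exact k2
      · rw [if_neg hi] at k2
        exact k2
    · rw [h4] at h
      rw [h3]
      exact (hb h).2.2 (k3 h)

end

/-! ### Each step of the code extends the auxiliary state -/

section

variable {s : State P} {g : Ghost P} {t : Fin P.threads}

/-- The auxiliary state can be continued after the step of a thread. -/
def Extends (s s' : State P) (t : Fin P.threads) (g : Ghost P) : Prop :=
  ∃ g', Inv s' g' ∧ Track s t g g'

/-- A step that changes nothing but the program counter. -/
theorem Inv.extends_of_pc {s' : State P} (hI : Inv s g)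
    (hheads : s'.heads = s.heads) (hnode : s'.node = s.node)
    (hstatus : s'.status = s.status) (hother : ∀ t', t' ≠ t → s'.thr t' = s.thr t')
    (hth : (g.thr t).inside = true → (s'.thr t).active = true ∧
      (s'.thr t).slot = (s.thr t).slot ∧ (s'.thr t).handle = (s.thr t).handle)
    (hini : ∀ a, Initializing (s'.thr t).pc a → Initializing (s.thr t).pc a)
    (hpc : PcOk P s.node g t (s'.thr t))
    (he : ∀ slot, ¬ EnterCommit s t slot) (hl : ∀ slot, ¬ LeaveCommit s t slot)
    (hd : ∀ curr next ref n, (s.thr t).pc ≠ .travFAA curr next ref n)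
    (hf : ∀ first cur c, (s.thr t).pc ≠ .freeNode first cur c) : Extends s s' t g :=
  ⟨g, hI.of_pc hheads hnode hstatus hother hth hini hpc, Track.refl he hl hd hf⟩

theorem Inv.extends_goto {s₀ : State P} {pc : PC P.bits} (hI : Inv s g)
    (hheads : s₀.heads = s.heads) (hnode : s₀.node = s.node)
    (hstatus : s₀.status = s.status) (hthr : s₀.thr = s.thr)
    (hini : ∀ a, Initializing pc a → Initializing (s.thr t).pc a)
    (hpc : PcOk P s.node g t { s.thr t with pc := pc })
    (he : ∀ slot, ¬ EnterCommit s t slot) (hl : ∀ slot, ¬ LeaveCommit s t slot)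
    (hd : ∀ curr next ref n, (s.thr t).pc ≠ .travFAA curr next ref n)
    (hf : ∀ first cur c, (s.thr t).pc ≠ .freeNode first cur c) :
    Extends s (s₀.goto t pc) t g := by
  refine hI.extends_of_pc hheads hnode hstatus (fun t' h => ?_) (fun h => ?_) ?_ ?_ he hl hd hf
  · simp [State.goto, State.setThread, h, hthr]
  · simp [State.goto, State.setThread, hthr, (hI.path t h).1]
  · simpa [State.goto, State.setThread, hthr] using hini
  · simpa [State.goto, State.setThread, hthr] using hpc

theorem Inv.code_search (hI : Inv s g)
    (h : (∃ slot, (s.thr t).pc = .enterK slot) ∨ (∃ slot n k, (s.thr t).pc = .enterAck slot n k) ∨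
      (∃ slot k, (s.thr t).pc = .growDir slot k) ∨ (∃ k, (s.thr t).pc = .growK k) ∨
      (∃ slot, (s.thr t).pc = .enterLoad slot)) : Extends s (code P s t) t g := by
  have hp := hI.pc t
  have hpe : ∀ slot, PcOk P s.node g t { s.thr t with pc := .enterK slot } →
      PcOk P s.node g t { s.thr t with pc := enterPC P slot } := by
    intro slot h; simp only [enterPC]; split_ifs <;> exact h
  rcases h with ⟨slot, hpc⟩ | ⟨slot, n, k, hpc⟩ | ⟨slot, k, hpc⟩ | ⟨k, hpc⟩ | ⟨slot, hpc⟩ <;>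
  simp only [PcOk, hpc] at hp <;> simp only [code, hpc] <;> (try split_ifs) <;>
  refine hI.extends_goto (by rfl) (by rfl) (by rfl) (by rfl) ?_ ?_ ?_ ?_ ?_ ?_ <;>
  (try first
    | exact hp
    | exact hpe _ hp
    | simp [EnterCommit, LeaveCommit, hpc, Initializing])
  all_goals (simp only [enterPC]; split_ifs <;> simp)

theorem Inv.code_deref (hI : Inv s g) (h : InDeref s t) : Extends s (code P s t) t g := by
  have hp := hI.pc t
  rcases h with ⟨loc, hpc⟩ | ⟨loc, access, hpc⟩ | ⟨loc, access, nd, hpc⟩ | ⟨loc, era, hpc⟩ |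
    ⟨loc, era, access, hpc⟩ <;>
  simp only [PcOk, hpc] at hp
  case inr.inr.inl =>
    simp only [code, hpc]
    split_ifs
    · refine hI.extends_of_pc (by rfl) (by rfl) (by rfl) (fun t' h => ?_) (fun h => ?_) ?_ ?_
        ?_ ?_ ?_ ?_
      · simp [State.setThread, h]
      · simp [State.setThread, (hI.path t h).1]
      · simp [State.setThread, Initializing]
      · have := (hI.path t hp.2).1
        simp [State.setThread, PcOk, hp, this]
      all_goals simp [EnterCommit, LeaveCommit, hpc]
    · refine hI.extends_goto (by rfl) (by rfl) (by rfl) (by rfl) ?_ ?_ ?_ ?_ ?_ ?_ <;>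
      first
      | exact hp
      | simp [EnterCommit, LeaveCommit, hpc, Initializing]
  all_goals
    simp only [code, hpc]
    (try split_ifs) <;>
    refine hI.extends_goto (by rfl) (by rfl) (by rfl) (by rfl) ?_ ?_ ?_ ?_ ?_ ?_ <;>
    first
    | exact hp
    | simp [EnterCommit, LeaveCommit, hpc, Initializing]

/-- The node written has status `fresh` and thus belongs to no batch; `fresh_unique` keeps it apart
from nodes that other threads initialize. -/
theorem Inv.code_init (hI : Inv s g) {a : Addr} (h : Initializing (s.thr t).pc a) :
    Extends s (code P s t) t g := by
  have hp := hI.pc t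
  have hfresh := hI.fresh t a h
  have huniq := fun t' => hI.fresh_unique t t' a h
  rcases h with hpc | hpc | hpc <;> simp only [PcOk, hpc] at hp <;> simp only [code, hpc]
  · refine hI.extends_of_pc (by rfl) (by rfl) (by rfl) (fun t' h => ?_) (fun h => ?_) ?_ ?_
        ?_ ?_ ?_ ?_
    · simp [State.setThread, h]
    · simp [State.setThread, (hI.path t h).1]
    · simp only [State.setThread, Function.update_self, hpc]
      split_ifs <;> simp [Initializing]
    · simp only [State.setThread, Function.update_self]
      split_ifs <;> exact hp
    all_goals simp [EnterCommit, LeaveCommit, hpc]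
  · refine hI.extends_goto (by rfl) (by rfl) (by rfl) (by rfl) ?_ ?_ ?_ ?_ ?_ ?_ <;>
    first
    | exact hp
    | simp [EnterCommit, LeaveCommit, hpc, Initializing]
  · refine ⟨g, hI.unowned (t := t) (by rfl) (fun b hb => ?_) (fun t' h => ?_) ?_ ?_ ?_,
      Track.refl ?_ ?_ ?_ ?_⟩
    · have : b ≠ a := by rintro rfl; simp [hfresh] at hb
      simp [State.goto, State.setThread, State.setNode, this, hb]
    · simp [State.goto, State.setThread, State.setNode, h]
    · simp [State.goto, State.setThread, State.setNode]
    · intro t' b h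
      by_cases ht : t' = t
      · subst ht
        simp [State.goto, State.setThread, State.setNode, Initializing] at h
      · have h' : Initializing (s.thr t').pc b := by
          simpa [State.goto, State.setThread, State.setNode, ht] using h
        have hb : b ≠ a := by rintro rfl; exact ht (huniq t' h').symm
        refine ⟨?_, fun t'' h'' => ?_⟩
        · simpa [State.goto, State.setThread, State.setNode, hb] using hI.fresh t' b h'
        · by_cases ht' : t'' = t
          · subst ht'
            simp [State.goto, State.setThread, State.setNode, Initializing] at h''
          · refine hI.fresh_unique t' t'' b h' ?_
            simpa [State.goto, State.setThread, State.setNode, ht'] using h''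
    · intro _
      simpa [State.goto, State.setThread, State.setNode, PcOk] using hp
    all_goals simp [EnterCommit, LeaveCommit, hpc]

/-! ## `enter` -/

/-- An own slot is `[0, Null]` while its thread is outside, so the plain write of `[1, Null]` equals
an increment, and both cases are instances of `Inv.enter`. -/
theorem Inv.code_enterFAA (hP : P.Valid) (hs : s.WellFormed) (hI : Inv s g) {slot : ℕ}
    (hpc : (s.thr t).pc = .enterFAA slot) : Extends s (code P s t) t g := by
  have hp := hI.pc t
  have hw := hs.pc t
  simp only [PcOk, hpc] at hp
  simp only [PcWellFormed, hpc] at hw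
  have hown : P.variant.single = true →
      (s.heads slot).href = 0 ∧ (s.heads slot).hptr = none := by
    intro h1
    rw [hw.2.2 h1]
    have := hI.own_head hP hs h1 hp.2.1
    exact ⟨this, hI.null _ this⟩
  refine ⟨_, hI.enter (slot := slot) hp.1 hp.2.1 hp.2.2 (fun h => (hown h).2) ?_ ?_ ?_ ?_ ?_, ?_⟩
  · simp only [code, hpc]
    split_ifs with h
    · simp [State.finishEnter, State.setHead, State.setThread, hown h]
    · simp [State.finishEnter, State.setHead, State.setThread]
  · simp only [code, hpc]; split_ifs <;> rfl
  · simp only [code, hpc]; split_ifs <;> rfl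
  · intro t' ht
    simp only [code, hpc]
    split_ifs <;> simp [State.finishEnter, State.setHead, State.setThread, ht]
  · simp only [code, hpc]
    split_ifs with h
    · simp [State.finishEnter, State.setHead, State.setThread, hown h]
    · simp [State.finishEnter, State.setHead, State.setThread]
  · constructor
    · intro t' ht; rw [Ghost.setThread_ne _ ht]; exact ⟨⟨rfl, Or.inl rfl⟩, rfl⟩
    · intro h; exact absurd (Or.inl hpc) (h slot)
    · intro slot' h
      obtain rfl : slot = slot' := by simpa [EnterCommit, hpc] using h
      simp only [Ghost.setThread_self, Account.counted, true_and]
      split_ifs with h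
      · cases (s.heads slot).hptr <;> rfl
      · simp [hown (by simpa using h)]
    all_goals simp [LeaveCommit, hpc]

theorem Inv.code_enterCAS (hs : s.WellFormed) (hI : Inv s g) {slot : ℕ} {last : Head}
    (hpc : (s.thr t).pc = .enterCAS slot last) : Extends s (code P s t) t g := by
  have hp := hI.pc t
  have hw := hs.pc t
  simp only [PcOk, hpc] at hp
  simp only [PcWellFormed, hpc] at hw
  by_cases hl : s.heads slot = last
  · subst hl
    refine ⟨_, hI.enter (slot := slot) hp.1 hp.2.1 hp.2.2 (by simp [hw]) ?_ ?_ ?_ ?_ ?_, ?_⟩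
    · simp [code, hpc, State.finishEnter, State.setHead, State.setThread]
    · simp [code, hpc, State.finishEnter, State.setHead, State.setThread]
    · simp [code, hpc, State.finishEnter, State.setHead, State.setThread]
    · intro t' ht
      simp [code, hpc, State.finishEnter, State.setHead, State.setThread, ht]
    · simp [code, hpc, State.finishEnter, State.setHead, State.setThread]
    · constructor
      · intro t' ht; rw [Ghost.setThread_ne _ ht]; exact ⟨⟨rfl, Or.inl rfl⟩, rfl⟩
      · intro h; exact absurd (Or.inr hpc) (h slot)
      · intro slot' h
        have : slot = slot' := by
          simp [EnterCommit, hpc] at h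
          exact h.1
        subst this
        simp only [Ghost.setThread_self, Account.counted, true_and, hw.2.2, if_true]
        cases (s.heads slot).hptr <;> rfl
      all_goals simp [LeaveCommit, hpc]
  · simp only [code, hpc, if_neg hl]
    refine hI.extends_goto (by rfl) (by rfl) (by rfl) (by rfl) ?_ ?_ ?_ ?_ ?_ ?_
    all_goals try first
      | exact hp
      | simp [LeaveCommit, hpc, Initializing]
    rintro slot' (h | h)
    · simp [hpc] at h
    · rw [hpc] at h
      injection h with h1 h2
      subst h1
      exact hl h2.symm

end

section

variable {s : State P} {g : Ghost P} {t : Fin P.threads}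

/-! ## `leave` -/

theorem Inv.code_leaveLoad (hI : Inv s g) (hpc : (s.thr t).pc = .leaveLoad) :
    Extends s (code P s t) t g := by
  have hp := hI.pc t
  simp only [PcOk, hpc] at hp
  simp only [code, hpc]
  refine hI.extends_goto (by rfl) (by rfl) (by rfl) (by rfl) ?_ ?_ ?_ ?_ ?_ ?_
  all_goals try simp [EnterCommit, LeaveCommit, hpc, Initializing]; done
  exact ⟨hp.1, hp.2, fun c h _ => hI.head_mem_todo hp.2 h⟩

theorem Inv.code_leaveNext (hI : Inv s g) {hd : Head} (hpc : (s.thr t).pc = .leaveNext hd) :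
    Extends s (code P s t) t g := by
  have hp := hI.pc t
  simp only [PcOk, hpc] at hp
  simp only [code, hpc]
  split_ifs with h1 <;>
  refine hI.extends_goto (by rfl) (by rfl) (by rfl) (by rfl) ?_ ?_ ?_ ?_ ?_ ?_
  all_goals try simp [EnterCommit, LeaveCommit, hpc, Initializing]; done
  · exact ⟨hp.1, hp.2.1, fun c h h' => ⟨hp.2.2 c h h', by rw [h]; rfl⟩⟩
  · exact ⟨hp.1, hp.2.1, fun c h h' => absurd h' h1⟩

theorem Track.of_leave {x : Account} (hin : x.inside = false) (htodo : x.todo = (g.thr t).counted P)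
    (hpc : (s.thr t).pc = .leaveSwap ∨ ∃ next, (s.thr t).pc =
      .leaveCAS (s.heads (s.thr t).slot) next) : Track s t g (g.setThread t x) where
  other t' ht := by rw [Ghost.setThread_ne _ ht]; exact ⟨⟨rfl, Or.inl rfl⟩, rfl⟩
  keep _ h := absurd ⟨rfl, hpc⟩ (h (s.thr t).slot)
  enter slot h := by
    rcases hpc with hpc | ⟨next, hpc⟩ <;> simp [EnterCommit, hpc] at h
  leave _ _ := by rw [Ghost.setThread_self]; exact ⟨hin, htodo⟩
  drop _ _ _ _ h := by
    rcases hpc with hpc | ⟨next, hpc⟩ <;> simp [hpc] at h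
  free _ _ _ h := by
    rcases hpc with hpc | ⟨next, hpc⟩ <;> simp [hpc] at h

/-- An own slot has `HRef = 1` here, so the swap is the decrement of the last thread inside. Heads
carry no contributions in these variants, and the first node is counted, so the whole list is
traversed. -/
theorem Inv.code_leaveSwap (hP : P.Valid) (hs : s.WellFormed) (hI : Inv s g)
    (hpc : (s.thr t).pc = .leaveSwap) : Extends s (code P s t) t g := by
  have hp := hI.pc t
  have hw := hs.pc t
  simp only [PcOk, hpc] at hp
  simp only [PcWellFormed, hpc] at hw
  obtain ⟨hq, hin⟩ := hp
  have hsing := hw.2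
  have h1 : (s.heads (s.thr t).slot).href = 1 := by
    have := hI.href_le_one hP hs hsing (s.thr t).slot
    have := hI.href_pos hin
    omega
  have hpath := (hI.path t hin).2
  have hcounted : (g.thr t).counted P = (g.thr t).todo := by simp [Account.counted, hsing]
  refine ⟨g.setThread t { g.thr t with inside := false, todo := (g.thr t).counted P },
    hI.leave hs hq hin rfl rfl hq.1 (hI.rowe_eq_zero hq.1) (hI.powe_eq_zero hq.2.1) hq.2.2
      ?_ ?_ ?_ ?_ ?_ ?_ ?_, Track.of_leave rfl rfl (Or.inl hpc)⟩
  · intro r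
    simp [hq.2.1, headTok, hsing]
  · simp only [code, hpc]
    split_ifs <;> simp_all [State.setHead, State.goto, State.setThread, State.finishLeave]
  · simp only [code, hpc]
    split_ifs <;> rfl
  · simp only [code, hpc]
    split_ifs <;> rfl
  · intro t' ht
    simp only [code, hpc]
    split_ifs <;> simp [State.setHead, State.goto, State.setThread, State.finishLeave, ht]
  · intro a
    simp only [code, hpc]
    split_ifs <;>
      simp [State.setHead, State.goto, State.setThread, State.finishLeave, Initializing]
  · simp only [code, hpc]
    split_ifs with h
    · simp only [State.setHead, State.goto, State.setThread, Function.update_self, PcOk,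
        Ghost.setThread_self, hcounted]
      exact ⟨hq, trivial, hpath⟩
    · rw [not_not.1 h] at hpath
      simp only [State.setHead, State.setThread, Function.update_self, PcOk,
        Ghost.setThread_self, hcounted, State.finishLeave]
      exact ⟨hq, trivial, fun _ => hpath.of_none.1⟩

theorem Inv.code_leaveCAS (hs : s.WellFormed) (hI : Inv s g) {hd : Head}
    {next : Ptr} (hpc : (s.thr t).pc = .leaveCAS hd next) : Extends s (code P s t) t g := by
  have hp := hI.pc t
  have hw := hs.pc t
  simp only [PcOk, hpc] at hp
  simp only [PcWellFormed, hpc] at hw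
  obtain ⟨hq, hin, hnext⟩ := hp
  have hsing := hw.2
  by_cases hl : s.heads (s.thr t).slot = hd
  swap
  · simp only [code, hpc, if_neg hl]
    refine hI.extends_goto (by rfl) (by rfl) (by rfl) (by rfl) ?_ ⟨hq, hin⟩ ?_ ?_ ?_ ?_
    all_goals try simp [EnterCommit, hpc, Initializing]
    rintro slot ⟨rfl, h | ⟨next', h⟩⟩
    · simp [hpc] at h
    · rw [hpc] at h
      injection h with h1 h2
      exact hl h1.symm
  have hpath := (hI.path t hin).2
  rw [hl] at hpath
  have hcounted : (g.thr t).counted P = (g.thr t).todo.tail := by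
    simp [Account.counted, hsing, hin]
  -- The traversal omits the first node, whose reference was never counted. It starts from `next`,
  -- read before the CAS, which is still the link of the first node.
  have hafter : PathAfter s.node (s.thr t).handle hd.hptr next ((g.thr t).counted P) := by
    rw [hcounted]
    cases hh : hd.hptr with
    | none =>
      rw [hh] at hpath
      obtain ⟨h1, h2⟩ := hpath.of_none
      simp [PathAfter, h1, h2]
    | some c =>
      rw [hh] at hpath
      obtain ⟨l, hl, h⟩ := hpath.of_some
      rw [hl, List.tail_cons]
      unfold PathAfter at *
      split_ifs at h ⊢ with h1
      · exact h
      · rw [(hnext c hh (by rw [hh]; exact h1)).2]; exact h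
  have htrack : ∀ x : Account, x.inside = false → x.todo = (g.thr t).counted P →
      Track s t g (g.setThread t x) := fun x h1 h2 =>
    Track.of_leave h1 h2 (Or.inr ⟨next, by rw [hl]; exact hpc⟩)
  -- The last thread to leave takes over the contribution of the head, without references: nobody is
  -- left inside to hold one.
  by_cases hlast : ∃ c, hd.hptr = some c ∧ hd.href = 1
  · obtain ⟨c, hc, h1⟩ := hlast
    obtain ⟨hm, hcount⟩ := hI.head_live (i := (s.thr t).slot) (by rw [hl]; exact hc)
    have hcode : code P s t = (s.setHead (s.thr t).slot ⟨hd.href - 1, none⟩).goto t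
        (.adjLoad c true 0 (.leave hd.hptr next)) := by
      simp [code, hpc, hl, hc, h1]
    rw [hcode]
    refine ⟨g.setThread t { g.thr t with
        inside := false
        todo := (g.thr t).counted P
        pref := (s.node c).nrefNode
        ptok := 1
        powe := 0 },
      hI.leave hs hq hin rfl rfl hq.1 (hI.rowe_eq_zero hq.1) rfl hq.2.2
        ?_ ?_ (by rfl) (by rfl) ?_ ?_ ?_, htrack _ rfl rfl⟩
    · intro r
      simp [State.goto, State.setThread, State.setHead, hl, hc, headTok, hsing]
    · simp [State.goto, State.setThread, State.setHead, hl, h1]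
    · intro t' ht
      simp [State.goto, State.setThread, State.setHead, ht]
    · intro a
      simp [State.goto, State.setThread, Initializing]
    · simp only [State.goto, State.setThread, State.setHead, Function.update_self, PcOk,
        Ghost.setThread_self, Ghost.setThread_batch]
      refine ⟨⟨hq.1, hq.2.2, rfl, hafter⟩, one_ne_zero, hcount, hm, ?_⟩
      simp [Params.weight, hsing]
  · have hcode : code P s t = (s.setHead (s.thr t).slot
        ⟨hd.href - 1, if hd.href = 1 then none else hd.hptr⟩).resume t
          (.leave hd.hptr next) := by
      simp only [code, hpc, hl, if_true]
      cases hh : hd.hptr with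
      | none => rfl
      | some c =>
        have : hd.href ≠ 1 := fun h => hlast ⟨c, hh, h⟩
        simp [this]
    have hheads : (code P s t).heads = Function.update s.heads (s.thr t).slot
        ⟨hd.href - 1, if hd.href = 1 then none else hd.hptr⟩ := by
      rw [hcode, resume_heads]; rfl
    refine ⟨g.setThread t { g.thr t with inside := false, todo := (g.thr t).counted P },
      hI.leave hs hq hin rfl rfl hq.1 (hI.rowe_eq_zero hq.1) (hI.powe_eq_zero hq.2.1) hq.2.2
        ?_ (by rw [hheads, hl]) (by rw [hcode, resume_node]; rfl)
        (by rw [hcode, resume_status]; rfl) ?_ ?_ ?_, htrack _ rfl rfl⟩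
    · intro r
      rw [hheads]
      simp only [hq.2.1, ite_self, zero_add, Function.update_self, hl]
      split_ifs with h
      · cases hh : hd.hptr with
        | none => rfl
        | some c => exact absurd ⟨c, hh, h⟩ hlast
      · rfl
    · intro t' ht
      rw [hcode, resume_thr_ne _ ht _]; rfl
    · intro a
      rw [hcode]
      exact not_initializing_resume _ _ a
    · rw [hcode]
      refine ContOk.pcOk_resume ?_ ?_ ?_
      · rw [Ghost.setThread_self]
        exact ⟨hq.1, hq.2.2, rfl, hafter⟩
      · rw [Ghost.setThread_self]; exact hq.2.1
      · exact hw.1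

/-! ## `traverse` -/

theorem Inv.code_travLoop (hI : Inv s g) {next : Ptr} {n : ℕ}
    (hpc : (s.thr t).pc = .travLoop next n) : Extends s (code P s t) t g := by
  have hp := hI.pc t
  simp only [PcOk, hpc] at hp
  obtain ⟨hq, hin, hpath⟩ := hp
  cases next with
  | none =>
    have h0 := hpath.of_none.1
    simp only [code, hpc, State.endTraverse]
    split_ifs
    · refine hI.extends_goto (by rfl) (by rfl) (by rfl) (by rfl) ?_ ⟨hq, hin, h0⟩ ?_ ?_ ?_ ?_
      all_goals simp [EnterCommit, LeaveCommit, hpc, Initializing]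
    · refine hI.extends_of_pc (by rfl) (by rfl) (by rfl) (fun t' h => ?_) (by simp [hin]) ?_ ?_
        ?_ ?_ ?_ ?_
      · simp [State.finishLeave, State.setThread, h]
      · simp [State.finishLeave, State.setThread, Initializing]
      · simp only [State.finishLeave, State.setThread, PcOk, Function.update_self]
        exact ⟨hq, hin, fun _ => h0⟩
      all_goals simp [EnterCommit, LeaveCommit, hpc]
  | some c =>
    simp only [code, hpc]
    refine hI.extends_goto (by rfl) (by rfl) (by rfl) (by rfl) ?_ ⟨hq, hin, hpath.of_some⟩
      ?_ ?_ ?_ ?_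
    all_goals simp [EnterCommit, LeaveCommit, hpc, Initializing]

theorem Inv.code_travRef (hI : Inv s g) {curr : Addr} {next : Ptr} {n : ℕ}
    (hpc : (s.thr t).pc = .travRef curr next n) : Extends s (code P s t) t g := by
  have hp := hI.pc t
  simp only [PcOk, hpc] at hp
  obtain ⟨hq, hin, l, h1, h2⟩ := hp
  simp only [code, hpc]
  refine hI.extends_goto (by rfl) (by rfl) (by rfl) (by rfl) ?_ ⟨hq, hin, l, h1, h2, rfl⟩
    ?_ ?_ ?_ ?_
  all_goals simp [EnterCommit, LeaveCommit, hpc, Initializing]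

theorem Inv.code_travAck (hI : Inv s g) {n : ℕ} (hpc : (s.thr t).pc = .travAck n) :
    Extends s (code P s t) t g := by
  have hp := hI.pc t
  simp only [PcOk, hpc] at hp
  simp only [code, hpc]
  refine hI.extends_of_pc (by rfl) (by rfl) (by rfl) (fun t' h => ?_) (by simp [hp]) ?_ ?_
    ?_ ?_ ?_ ?_
  · simp [State.finishLeave, State.setThread, h]
  · simp [State.finishLeave, State.setThread, Initializing]
  · simp only [State.finishLeave, State.setThread, PcOk, Function.update_self]
    exact ⟨hp.1, hp.2.1, fun _ => hp.2.2⟩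
  all_goals simp [EnterCommit, LeaveCommit, hpc]

/-! ## `adjust` and `free_batch` -/

/-- The common form of the fetch-and-add in `adjust` and `traverse`: if the counter becomes `0`, the
thread takes over all nodes of the batch, otherwise it continues with `c`. -/
theorem Inv.faa_resume (hP : P.Valid) (hs : s.WellFormed) (hI : Inv s g) {ref : Addr}
    {val : UWord P.bits} {c : Cont P.bits} {x : Account} {df dR dd : ℕ}
    (hcode : code P s t = if (s.node ref).nref + val = 0 then
      (s.addNRef ref val).goto t (.freeLoad ref c) else (s.addNRef ref val).resume t c)
    (hact : (s.thr t).active = true) (hc : ContOk P s.node g x (s.thr t).handle c)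
    (hcount : g.Counting ref) (hne : (g.batch ref).nodes ≠ [])
    (hin : x.inside = (g.thr t).inside) (hx : x.inside = true → x.todo = (g.thr t).todo)
    (htodo : ∀ a ∈ x.todo, a ∈ (g.thr t).todo)
    (htok : ∀ r, x.tok r + (if r = ref then df else 0) = (g.thr t).tok r)
    (howe : ∀ r, x.owe r + (if r = ref then dR else 0) = (g.thr t).owe r)
    (hheld : ∀ r, x.held P s.node r + (if r = ref then dd else 0) = (g.thr t).held P s.node r)
    (hdR : dR ≤ P.grain * df) (hpos : 0 < df ∨ 0 < dd)
    (hval : val = P.weight (g.batch ref).k * (df : UWord P.bits) + (dR : UWord P.bits)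
      - (dd : UWord P.bits))
    (hrtok : x.rtok = (g.thr t).rtok) (hrref : x.rref = (g.thr t).rref)
    (hle : x.rowe ≤ P.grain * x.rtok ∧ x.powe ≤ P.grain * x.ptok)
    (hptok : x.ptok = 0) (hrest : x.rest = (g.thr t).rest) :
    ∃ g' : Ghost P, Inv (code P s t) g' ∧ (∀ t', t' ≠ t → g'.thr t' = g.thr t') ∧
      (g'.thr t).inside = x.inside ∧ (g'.thr t).todo = x.todo := by
  have hB := hI.batch ref hne
  by_cases hz : (s.node ref).nref + val = 0
  · rw [if_pos hz] at hcode
    rw [hcode]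
    refine ⟨_, hI.faa hP hs (x := { x with frees := (g.batch ref).nodes }) (ph := .freeing t)
      hcount hne (Or.inr ⟨rfl, hz⟩) (by rfl) (by rfl) (by rfl) ?_ hin ?_ htodo htok howe
      hheld hdR hpos hval hrtok hrref hle hrest ?_ rfl fun hrel => ?_, ?_, ?_, ?_⟩
    · intro t' ht
      simp [State.goto, State.setThread, State.addNRef, State.setNode, ht]
    · intro h
      simp [State.goto, State.setThread, State.addNRef, State.setNode, hact, hx h]
    · intro a
      simp [State.goto, State.setThread, Initializing]
    · have hrel := hrel rfl
      simp only [State.goto, State.setThread, PcOk, Function.update_self]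
      refine ⟨hc.transfer rfl rfl rfl rfl rfl rfl rfl (fun a _ => ?_) (fun h => ?_), hptok,
        trivial, trivial, hne, ?_⟩
      · exact addNRef_next _ _ _ _
      -- The batch being freed cannot be the one that the thread is still retiring, since nobody
      -- owes it a contribution.
      · have hr : x.rref ≠ ref := by
          rintro h'
          exact absurd (h' ▸ hrel) (Account.tok_rref h)
        simp only [ne_eq, hr, not_false_eq_true, Function.update_of_ne, true_and,
          Ghost.Counting]
        exact id
      · refine (hB.ring ?_).frame fun a _ => ?_
        · intro t' h
          have : (g.batch ref).phase = .counting := hcount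
          simp [this] at h
        · exact addNRef_batchNext _ _ _ _
    · intro t' ht; simp [ht]
    · simp
    · simp
  · rw [if_neg hz] at hcode
    rw [hcode]
    refine ⟨_, hI.faa hP hs (x := x) (ph := .counting)
      hcount hne (Or.inl rfl) (resume_heads (s.addNRef ref val) t c)
      (resume_node (s.addNRef ref val) t c) (resume_status (s.addNRef ref val) t c)
      ?_ hin ?_ htodo htok howe
      hheld hdR hpos hval hrtok hrref hle hrest ?_ rfl fun _ => ?_, ?_, ?_, ?_⟩
    · intro t' ht
      rw [resume_thr_ne _ ht _]; rfl
    · intro h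
      obtain ⟨h1, h2, h3⟩ := hc.resume_thr (s := s.addNRef ref val) (t := t) h
      exact ⟨h1.trans hact, h2, h3, hx h⟩
    · exact not_initializing_resume _ _
    · refine ContOk.pcOk_resume ?_ ?_ hact
      · rw [resume_node]
        simp only [Function.update_self]
        refine hc.transfer rfl rfl rfl rfl rfl rfl rfl (fun a _ => ?_) (fun h => ?_)
        · exact addNRef_next _ _ _ _
        · by_cases hr : x.rref = ref
          · simp [hr, Ghost.Counting]
          · simp [hr, Ghost.Counting]
      · simpa using hptok
    · intro t' ht; simp [ht]
    · simp
    · simp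

end

section

variable {s : State P} {g : Ghost P} {t : Fin P.threads}

theorem Inv.code_adjLoad (hI : Inv s g) {a : Addr} {useAdjs : Bool} {v : UWord P.bits}
    {c : Cont P.bits} (hpc : (s.thr t).pc = .adjLoad a useAdjs v c) :
    Extends s (code P s t) t g := by
  have hp := hI.pc t
  simp only [PcOk, hpc] at hp
  obtain ⟨hc, hne, hcount, hmem, hval⟩ := hp
  have hB := hI.batch _ (List.ne_nil_of_mem hmem)
  simp only [code, hpc]
  refine hI.extends_goto (by rfl) (by rfl) (by rfl) (by rfl) ?_
    ⟨hc, hne, hcount, hB.ref a hmem, ?_⟩ ?_ ?_ ?_ ?_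
  all_goals try simp [EnterCommit, LeaveCommit, hpc, Initializing]
  rw [hB.ref a hmem, hB.adjs]
  exact hval

/-- All `ptok` contributions and their `powe` references are paid at once, and no reference is given
up. -/
theorem Inv.code_adjFAA (hP : P.Valid) (hs : s.WellFormed) (hI : Inv s g) {ref : Addr}
    {v : UWord P.bits} {c : Cont P.bits} (hpc : (s.thr t).pc = .adjFAA ref v c) :
    Extends s (code P s t) t g := by
  have hp := hI.pc t
  have hw := hs.pc t
  simp only [PcOk, hpc] at hp
  simp only [PcWellFormed, hpc] at hw
  obtain ⟨hc, hne, hcount, rfl, hval⟩ := hp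
  have halive := hI.alive t _ (Account.tok_pref hne)
  have hle := hI.owe_le t
  refine Exists.elim (hI.faa_resume hP hs (ref := (g.thr t).pref) (val := v) (c := c)
    (x := { g.thr t with ptok := 0, powe := 0 }) (df := (g.thr t).ptok) (dR := (g.thr t).powe)
    (dd := 0) ?_ hw.1 (hc.transfer rfl rfl rfl rfl rfl rfl rfl (fun _ _ => rfl)
      fun _ => ⟨rfl, rfl, id⟩) hcount halive.1 rfl (fun _ => rfl) (fun _ h => h) ?_ ?_ ?_ hle.2
    (Or.inl (Nat.pos_of_ne_zero hne)) ?_ rfl rfl ⟨hle.1, by simp⟩ rfl rfl)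
    fun g' ⟨h1, h2, h3, h4⟩ => ⟨g', h1, ?_⟩
  · simp only [code, hpc, eq_neg_iff_add_eq_zero]
  · intro r
    simp only [Account.tok, @eq_comm _ r]
    split_ifs <;> omega
  · intro r
    simp only [Account.owe, @eq_comm _ r]
    split_ifs <;> omega
  · intro r
    simp only [ite_self, add_zero]
    rfl
  · rw [hval]; simp
  · refine Track.local h2 h3 h4 ?_ ?_ ?_ ?_ <;>
      simp [EnterCommit, LeaveCommit, hpc]

/-- One reference is given up and `curr` leaves the list in the same step. Until then the list kept
its batch from being freed. -/
theorem Inv.code_travFAA (hP : P.Valid) (hs : s.WellFormed) (hI : Inv s g) {curr ref : Addr}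
    {next : Ptr} {n : ℕ} (hpc : (s.thr t).pc = .travFAA curr next ref n) :
    Extends s (code P s t) t g := by
  have hp := hI.pc t
  have hw := hs.pc t
  simp only [PcOk, hpc] at hp
  simp only [PcWellFormed, hpc] at hw
  obtain ⟨hq, hin, l, htodo, hafter, rfl⟩ := hp
  obtain ⟨hmem, hcount⟩ := hI.live t curr (by simp [htodo])
  have hle := hI.owe_le t
  refine Exists.elim (hI.faa_resume hP hs (ref := (s.node curr).nrefNode) (val := -1)
    (c := .trav curr next n)
    (x := { g.thr t with todo := l }) (df := 0) (dR := 0)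
    (dd := 1) ?_ hw ⟨hq.1, hq.2.2, hin, hafter⟩ hcount (List.ne_nil_of_mem hmem) rfl
    (by simp [hin]) (by simp +contextual [htodo]) ?_ ?_ ?_ (by simp)
    (Or.inr one_pos) (by simp) rfl rfl hle hq.2.1 rfl)
    fun g' ⟨h1, h2, h3, h4⟩ => ⟨g', h1, ?_⟩
  · simp only [code, hpc, ← sub_eq_add_neg, sub_eq_zero]
  · intro r
    simp [Account.tok]
  · intro r
    simp [Account.owe]
  · intro r
    simp [Account.held, Account.counted, hin, htodo, List.countP_cons, @eq_comm _ r]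
  · constructor
    · intro t' ht; rw [h2 t' ht]; exact ⟨⟨rfl, Or.inl rfl⟩, rfl⟩
    · intro _ _ h; exact absurd hpc (h _ _ _ _)
    · simp [EnterCommit, hpc]
    · simp [LeaveCommit, hpc]
    · intro curr' next' ref' n' h
      rw [hpc] at h
      injection h with e1 e2 e3 e4
      subst e1
      exact ⟨h3.trans hin, by rw [h4]; exact htodo⟩
    · simp [hpc]

theorem Inv.code_freeLoad (hI : Inv s g) {ref : Addr} {c : Cont P.bits}
    (hpc : (s.thr t).pc = .freeLoad ref c) : Extends s (code P s t) t g := by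
  have hp := hI.pc t
  simp only [PcOk, hpc] at hp
  obtain ⟨hc, h0, hphase, hnodes, hne, hring⟩ := hp
  have hB := hI.batch ref (by rw [hnodes]; exact hne)
  have hlast : (s.node ref).batchNext = (g.thr t).frees.headD 0 :=
    hring.last (by rw [← hnodes]; exact hB.last)
  simp only [code, hpc]
  refine hI.extends_goto (by rfl) (by rfl) (by rfl) (by rfl) ?_
    ⟨hc, h0, ref, (g.thr t).frees.tail, hphase, hnodes, ?_, ?_⟩ ?_ ?_ ?_ ?_
  all_goals try simp [EnterCommit, LeaveCommit, hpc, Initializing]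
  · rw [hlast]
    cases h : (g.thr t).frees with
    | nil => exact absurd h hne
    | cons a l => rfl
  · rw [hlast]; exact hring

theorem Inv.code_freeNode (hs : s.WellFormed) (hI : Inv s g) {first cur : Addr} {c : Cont P.bits}
    (hpc : (s.thr t).pc = .freeNode first cur c) : Extends s (code P s t) t g := by
  have hp := hI.pc t
  have hw := hs.pc t
  simp only [PcOk, hpc] at hp
  simp only [PcWellFormed, hpc] at hw
  obtain ⟨hc, h0, r, l, hphase, hnodes, hfrees, hring⟩ := hp
  rw [hfrees] at hnodes hring
  -- The ring returns to `first` from the last node only, so the test of the loop tells whether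
  -- nodes remain.
  have hnext : (s.node cur).batchNext ≠ first ↔ l ≠ [] := by
    cases l with
    | nil => simpa [Ring] using hring
    | cons b l => simpa [hring.1] using hring.2.1
  set s' : State P := { s with status := Function.update s.status cur .free } with hs'
  have hcode : code P s t = if l ≠ [] then s'.goto t (.freeNode first (s.node cur).batchNext c)
      else s'.resume t c := by
    simp only [code, hpc, hnext, hs']
  set g' : Ghost P := ⟨Function.update g.thr t { g.thr t with frees := l },
      Function.update g.batch r { g.batch r with
        nodes := l
        phase := if l = [] then .counting else .freeing t }⟩ with hg'
  have hself : g'.thr t = { g.thr t with frees := l } := by simp [hg']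
  have hc' : ContOk P s.node g' (g'.thr t) (s.thr t).handle c := by
    rw [hself]
    refine hc.transfer rfl rfl rfl rfl rfl rfl rfl (fun _ _ => rfl) fun h => ?_
    have : (g.thr t).rref ≠ r := by
      rintro h'
      exact (hI.alive t _ (Account.tok_rref h)).2 t (h' ▸ hphase)
    simp [hg', this, Ghost.Counting]
  have hI' : Inv (code P s t) g' := by
    rw [hcode]
    split_ifs with hl
    · refine hI.freeNode hphase hnodes (by rfl) (by rfl) (by rfl) (fun t' ht => ?_) ?_ ?_ hg' ?_
      · simp [State.goto, State.setThread, hs', ht]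
      · simp [State.goto, State.setThread, hs', hw.1]
      · simp [State.goto, State.setThread, Initializing]
      · rw [goto_thr_self]
        refine ⟨hc', by rw [hself]; exact h0, r, l.tail, ?_, ?_, ?_, ?_⟩
        · simp [hg', hl]
        · simp [hg']
        · rw [hself]
          cases l with
          | nil => exact absurd rfl hl
          | cons b l => simp [hring.1]
        · rw [hself]
          cases l with
          | nil => exact absurd rfl hl
          | cons b l => exact hring.2.2
    · refine hI.freeNode hphase hnodes (resume_heads s' t c) (resume_node s' t c)
        (resume_status s' t c) (fun t' ht => ?_) (fun h => ?_) (not_initializing_resume s' c) hg' ?_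
      · rw [resume_thr_ne _ ht]
      · obtain ⟨h1, h2, h3⟩ := hc.resume_thr (s := s') (t := t) h
        exact ⟨h1.trans hw.1, h2, h3⟩
      · exact ContOk.pcOk_resume hc' (by rw [hself]; exact h0) hw.1
  refine ⟨g', hI', Track.local (fun t' ht => ?_) (by rw [hself]) (by rw [hself]) ?_ ?_ ?_ ?_⟩
  · simp [hg', ht]
  · simp [EnterCommit, hpc]
  · simp [LeaveCommit, hpc]
  · simp [hpc]
  · intro f' c' k h
    rw [hpc] at h
    injection h with e1 e2 e3
    rw [hself, hfrees, e2]

end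

/-! ### The steps of `retire` -/

section

variable {s : State P} {g : Ghost P} {t : Fin P.threads}

theorem CurrentOk.mem_rest {x : Account} {r : RLocals P.bits} {i : ℕ}
    (h : CurrentOk g x r i) (hi : i < r.k) : r.cur ∈ x.rest := by
  rw [CurrentOk, if_pos hi] at h
  obtain ⟨_, l, -, h, -⟩ := h
  simp [h]

theorem Inv.code_retInit (hI : Inv s g) {r : RLocals P.bits}
    (hpc : (s.thr t).pc = .retInit r) : Extends s (code P s t) t g := by
  have hp := hI.pc t
  simp only [PcOk, hpc] at hp
  obtain ⟨hr, hcur, h0, hne, hphase, hset, hgr, hdr⟩ := hp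
  simp only [code, hpc]
  rw [hr.ref] at hphase hset hgr hdr
  have hb : ∀ q, (Function.update g.batch r.ref
      { g.batch r.ref with phase := .counting } q).nodes = (g.batch q).nodes ∧
      (Function.update g.batch r.ref { g.batch r.ref with phase := .counting } q).k =
        (g.batch q).k := by
    intro q
    by_cases hq : q = r.ref
    · subst hq; simp
    · simp [hq]
  refine ⟨_, hI.retInit (t := t) hr.ref hne hphase hset hgr hdr (by rfl) (by rfl) (by rfl)
    (fun t' ht => ?_) ?_ ?_ rfl ?_, Track.local (fun t' ht => ?_) ?_ ?_ ?_ ?_ ?_ ?_⟩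
  · simp [State.goto, State.setThread, State.setNode, ht]
  · simp [State.goto, State.setThread, State.setNode]
  · simp [State.goto, State.setThread, Initializing]
  · rw [goto_thr_self]
    refine ⟨?_, ?_, h0, fun _ => ?_⟩
    · exact hr.frame (todo := (g.thr t).todo) fun _ => hb _
    · exact hcur.frame (todo := (g.thr t).todo) fun _ => (hb _).1
    · simp [Ghost.Counting, hr.ref]
  all_goals simp [EnterCommit, LeaveCommit, hpc]

/-- `retire` passes over a slot. -/
theorem Inv.skipSlot (hs : s.WellFormed) (hI : Inv s g) {r : RLocals P.bits}
    (hpc : (s.thr t).pc = .retSlot r ∨ ∃ hd, (s.thr t).pc = .retAccess r hd) (hi : r.i < r.k) :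
    Extends s (s.skipSlot t r) t g := by
  have hp : PcOk P s.node g t { s.thr t with pc := .retSlot r } := by
    have hp := hI.pc t
    rcases hpc with hpc | ⟨hd, hpc⟩ <;> simpa only [PcOk, hpc] using hp
  have hact : (s.thr t).active = true := by
    have hw := hs.pc t
    rcases hpc with hpc | ⟨hd, hpc⟩ <;> simp only [PcWellFormed, hpc] at hw <;> exact hw.1
  obtain ⟨hr, hcur, h0, hcount⟩ := hp
  have hne := hr.rtok_ne hi
  -- The debt `(k - i) + skip` stays the same, as `i` and `skip` both grow by one. After the last
  -- slot the remaining nodes are no longer called unused.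
  refine ⟨_, hI.of_local (t := t) (x := { g.thr t with
      skip := (g.thr t).skip + 1
      rest := if r.i + 1 < r.k then (g.thr t).rest else [] }) (by rfl) (by rfl) (by rfl)
    (fun t' ht => ?_) rfl ?_ rfl (fun _ => rfl) (fun _ => rfl) (fun h => ⟨h, rfl⟩) (hI.owe_le t)
    (fun a ha => ?_) ?_ ?_, Track.local (fun t' ht => ?_) ?_ ?_ ?_ ?_ ?_ ?_⟩
  · simp [State.skipSlot, State.goto, State.setThread, ht]
  · simp [State.skipSlot, State.goto, State.setThread, hact]
  · refine ⟨?_, hne⟩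
    split_ifs at ha
    · exact ha
    · simp at ha
  · simp [State.skipSlot, State.goto, State.setThread, Initializing]
  · rw [State.skipSlot, goto_thr_self]
    simp only [PcOk, Ghost.setThread_self]
    refine ⟨⟨hr.inside, hr.ref, ?_, hr.owe, fun h => (hr.inserts_le h).trans (Nat.le_succ _),
      fun h => ?_, fun h => by simp, fun h => hr.batch h⟩, ?_, h0, hcount⟩
    · have := hr.tok
      by_cases hsing : P.variant.single = true
      · rw [if_pos hsing] at this ⊢
        exact this
      · rw [if_neg hsing] at this ⊢
        simp only
        omega
    · simp only [hr.empty h]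
      push_cast; ring
    · unfold CurrentOk at *
      rw [if_pos hi] at hcur
      simp only [Ghost.setThread_batch]
      split_ifs with h
      · obtain ⟨used, l, h1, h2, h3⟩ := hcur
        exact ⟨used, l, h1, h2, by omega⟩
      · rfl
  · simp [Ghost.setThread_ne _ ht]
  · simp
  · simp
  all_goals rcases hpc with hpc | ⟨hd, hpc⟩ <;> simp [EnterCommit, LeaveCommit, hpc]

theorem Inv.code_retSlot (hs : s.WellFormed) (hI : Inv s g) {r : RLocals P.bits}
    (hpc : (s.thr t).pc = .retSlot r) : Extends s (code P s t) t g := by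
  have hp := hI.pc t
  have hw := hs.pc t
  simp only [PcOk, hpc] at hp
  simp only [PcWellFormed, hpc] at hw
  obtain ⟨hact, hrw, hik⟩ := hw
  have hp' := hp
  obtain ⟨hr, hcur, h0, hcount⟩ := hp
  by_cases hi : r.i < r.k
  · simp only [code, hpc, if_pos hi]
    split_ifs
    · refine hI.extends_goto (by rfl) (by rfl) (by rfl) (by rfl) ?_ hp' ?_ ?_ ?_ ?_
      all_goals simp [EnterCommit, LeaveCommit, hpc, Initializing]
    · exact hI.skipSlot hs (Or.inl hpc) hi
    · refine hI.extends_goto (by rfl) (by rfl) (by rfl) (by rfl) ?_ hp' ?_ ?_ ?_ ?_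
      all_goals simp [EnterCommit, LeaveCommit, hpc, Initializing]
  · have hrest : (g.thr t).rest = [] := by simpa only [CurrentOk, if_neg hi] using hcur
    have hk : r.k - r.i = 0 := by omega
    have htok := hr.tok
    rw [hk, zero_add] at htok
    have hle := hI.owe_le t
    -- At the end the debt of `retire` is moved to the fields of `adjust`, which pays it to the same
    -- batch.
    have key : ∀ v : UWord P.bits, (g.thr t).rtok ≠ 0 →
        v = P.weight r.k * ((g.thr t).rtok : UWord P.bits) + ((g.thr t).rowe : UWord P.bits) →
        Extends s (s.goto t (.adjLoad r.first false v .done)) t g := by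
      intro v hne hv
      obtain ⟨hfirst, hbk⟩ := hr.batch hne
      have hpowe := hI.powe_eq_zero h0
      refine ⟨_, hI.of_local (t := t) (x := { g.thr t with
          rtok := 0
          rowe := 0
          pref := (g.thr t).rref
          ptok := (g.thr t).rtok
          powe := (g.thr t).rowe }) (by rfl) (by rfl) (by rfl)
        (fun t' ht => ?_) rfl ?_ rfl (fun q => ?_) (fun q => ?_) (by simp) ⟨by simp, hle.1⟩
        (by simp [hrest]) ?_ ?_, Track.local (fun t' ht => ?_) ?_ ?_ ?_ ?_ ?_ ?_⟩
      · simp [State.goto, State.setThread, ht]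
      · simp [State.goto, State.setThread, hact]
      · simp [Account.tok, h0]
      · simp [Account.owe, hpowe]
      · simp [State.goto, State.setThread, Initializing]
      · rw [goto_thr_self]
        simp only [PcOk, Ghost.setThread_self]
        refine ⟨⟨rfl, hrest, hr.inside⟩, hne, hcount hne, hfirst, ?_⟩
        simp only [Ghost.setThread_batch, hbk]
        exact hv
      · simp [Ghost.setThread_ne _ ht]
      · simp
      · simp
      all_goals simp [EnterCommit, LeaveCommit, hpc]
    simp only [code, hpc, if_neg hi]
    by_cases hsing : P.variant.single = true
    · rw [if_pos hsing] at htok ⊢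
      refine key _ (by rw [htok]; exact one_ne_zero) ?_
      have := hr.owe
      rw [if_pos hsing] at this
      simp [Params.weight, hsing, this]
    · have hsing' : P.variant.single = false := by simpa using hsing
      rw [if_neg hsing] at htok ⊢
      have howe := hr.owe
      rw [if_neg hsing] at howe
      split_ifs with hd
      · refine key _ (by rw [htok]; exact (hr.doAdj hsing').1 hd) ?_
        rw [hr.empty hsing', hrw.2.2, htok, howe]
        simp [Params.weight, hsing', mul_comm]
      -- No final adjustment is due: all contributions went to the heads of lists.
      · have hskip : (g.thr t).skip = 0 := by
          by_contra h
          exact hd ((hr.doAdj hsing').2 h)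
        refine hI.extends_goto (by rfl) (by rfl) (by rfl) (by rfl) ?_
          ⟨⟨htok.trans hskip, h0, hrest⟩, ?_, ?_⟩ ?_ ?_ ?_ ?_
        all_goals simp [EnterCommit, LeaveCommit, hpc, Initializing, hr.inside, hact]

theorem Inv.code_retAccess (hs : s.WellFormed) (hI : Inv s g) {r : RLocals P.bits} {hd : Head}
    (hpc : (s.thr t).pc = .retAccess r hd) : Extends s (code P s t) t g := by
  have hp := hI.pc t
  have hw := hs.pc t
  simp only [PcOk, hpc] at hp
  simp only [PcWellFormed, hpc] at hw
  simp only [code, hpc]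
  split_ifs
  · exact hI.skipSlot hs (Or.inr ⟨hd, hpc⟩) hw.2.2
  · refine hI.extends_goto (by rfl) (by rfl) (by rfl) (by rfl) ?_ hp ?_ ?_ ?_ ?_
    all_goals simp [EnterCommit, LeaveCommit, hpc, Initializing]

theorem Inv.code_retLink (hs : s.WellFormed) (hI : Inv s g) {r : RLocals P.bits} {hd : Head}
    (hpc : (s.thr t).pc = .retLink r hd) : Extends s (code P s t) t g := by
  have hp := hI.pc t
  have hw := hs.pc t
  simp only [PcOk, hpc] at hp
  simp only [PcWellFormed, hpc] at hw
  obtain ⟨hr, hcur, h0, hcount⟩ := hp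
  have hmem := hcur.mem_rest hw.2.2.1
  simp only [code, hpc]
  refine ⟨g, hI.retLink (t := t) hmem (by rfl) (by rfl) (by rfl) (fun t' ht => ?_) ?_ ?_ ?_,
    Track.refl ?_ ?_ ?_ ?_⟩
  · simp [State.goto, State.setThread, State.setNode, ht]
  · simp [State.goto, State.setThread, State.setNode]
  · simp [State.goto, State.setThread, Initializing]
  · rw [goto_thr_self]
    exact ⟨hr, hcur, h0, hcount, hmem, by simp [State.goto, State.setThread, State.setNode]⟩
  all_goals simp [EnterCommit, LeaveCommit, hpc]

theorem Inv.code_retAdvance (hs : s.WellFormed) (hI : Inv s g) {r : RLocals P.bits} {hd : Head}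
    (hpc : (s.thr t).pc = .retAdvance r hd) : Extends s (code P s t) t g := by
  have hp := hI.pc t
  have hw := hs.pc t
  simp only [PcOk, hpc] at hp
  simp only [PcWellFormed, hpc] at hw
  obtain ⟨hr, hused, hcount, hpred, hnone⟩ := hp
  -- If slots remain, the thread still owes a contribution, so the batch is alive and `BatchNext`
  -- can be trusted. After the last slot the value read may be garbage, but it is not used any more.
  have hcur : CurrentOk g (g.thr t) { r with cur := (s.node r.cur).batchNext } (r.i + 1) := by
    unfold CurrentOk CurrentUsed at *
    split_ifs at hused ⊢ with hi
    · obtain ⟨used, h1, h2⟩ := hused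
      cases hl : (g.thr t).rest with
      | nil => simp [hl] at h2
      | cons b l =>
        rw [hl] at h1 h2
        have hne := hr.rtok_ne hi
        have halive := hI.alive t _ (Account.tok_rref hne)
        have hring := (hI.batch _ halive.1).ring halive.2
        rw [h1] at hring
        refine ⟨used ++ [r.cur], l, by simp [h1], by simp [hring.next], ?_⟩
        simp only [List.length_cons] at h2
        simp only
        omega
    · exact hused
  have htrans : ∀ {ins : ℕ}, (P.variant.single = true → ins = r.inserts + 1) →
      RetireOk P g (g.thr t) { r with cur := (s.node r.cur).batchNext } (r.i + 1) ins := by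
    intro ins h
    refine ⟨hr.inside, hr.ref, hr.tok, ?_, fun h1 => by rw [h h1]; exact hr.inserts_le h1,
      hr.empty, hr.doAdj, hr.batch⟩
    rw [hr.owe]
    split_ifs with h1
    · rw [h h1]
    · rfl
  by_cases hsing : P.variant.single = true
  · simp only [code, hpc, if_pos hsing]
    have h1 := htrans (ins := r.inserts + 1) fun _ => rfl
    refine hI.extends_goto (by rfl) (by rfl) (by rfl) (by rfl) ?_
      ⟨⟨h1.inside, h1.ref, h1.tok, h1.owe, h1.inserts_le, h1.empty, h1.doAdj, h1.batch⟩,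
        hcur, hnone (Or.inl hsing), hcount⟩ ?_ ?_ ?_ ?_
    all_goals simp [EnterCommit, LeaveCommit, hpc, Initializing]
  · have hsing' : P.variant.single = false := by simpa using hsing
    have h1 := htrans (ins := r.inserts) fun h => absurd h hsing
    cases hh : hd.hptr with
    | some p =>
      simp only [code, hpc, if_neg hsing, hh]
      obtain ⟨k1, k2, k3, k4⟩ := hpred p hsing' hh
      refine hI.extends_goto (by rfl) (by rfl) (by rfl) (by rfl) ?_
        ⟨⟨h1, hcur, hcount⟩, by rw [k1]; exact one_ne_zero, k3, k4, ?_⟩ ?_ ?_ ?_ ?_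
      · simp [Initializing]
      · simp [k1, k2, Params.weight, hsing']
      all_goals simp [EnterCommit, LeaveCommit, hpc]
    | none =>
      simp only [code, hpc, if_neg hsing, hh]
      set c : Cont P.bits := .slot { r with cur := (s.node r.cur).batchNext } hd.href with hcdef
      have hc : ContOk P s.node g (g.thr t) (s.thr t).handle c := ⟨h1, hcur, hcount⟩
      refine hI.extends_of_pc (by simp) (by simp) (by simp) (fun t' h => resume_thr_ne _ h _)
        (fun h => ?_) (fun a h => absurd h (not_initializing_resume s c a))
        (hc.pcOk_resume (hnone (Or.inr hh)) hw.1) ?_ ?_ ?_ ?_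
      · obtain ⟨k1, k2, k3⟩ := hc.resume_thr (s := s) (t := t) h
        exact ⟨k1.trans hw.1, k2, k3⟩
      all_goals simp [EnterCommit, LeaveCommit, hpc]

theorem Inv.code_retAck (hI : Inv s g) {r : RLocals P.bits} {n : ℕ}
    (hpc : (s.thr t).pc = .retAck r n) : Extends s (code P s t) t g := by
  have hp := hI.pc t
  simp only [PcOk, hpc] at hp
  obtain ⟨hr, hcur, h0, hcount⟩ := hp
  simp only [code, hpc]
  refine hI.extends_goto (by rfl) (by rfl) (by rfl) (by rfl) ?_
    ⟨⟨hr.inside, hr.ref, hr.tok, hr.owe, hr.inserts_le, hr.empty, hr.doAdj, hr.batch⟩,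
      hcur, h0, hcount⟩ ?_ ?_ ?_ ?_
  all_goals simp [EnterCommit, LeaveCommit, hpc, Initializing]

theorem Inv.code_retCAS (hP : P.Valid) (hs : s.WellFormed) (hI : Inv s g) {r : RLocals P.bits}
    {hd : Head} (hpc : (s.thr t).pc = .retCAS r hd) : Extends s (code P s t) t g := by
  have hp := hI.pc t
  have hw := hs.pc t
  simp only [PcOk, hpc] at hp
  simp only [PcWellFormed, hpc] at hw
  obtain ⟨hr, hcur, h0, hcount, hmem, hnext⟩ := hp
  obtain ⟨hact, hrw, hi, hhref⟩ := hw
  by_cases hl : s.heads r.i = hd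
  swap
  · simp only [code, hpc, if_neg hl]
    refine hI.extends_goto (by rfl) (by rfl) (by rfl) (by rfl) ?_ ⟨hr, hcur, h0, hcount⟩
      ?_ ?_ ?_ ?_
    all_goals simp [EnterCommit, LeaveCommit, hpc, Initializing]
  have hne := hr.rtok_ne hi
  have hpowe := hI.powe_eq_zero h0
  have hrefcur := hI.rest_nrefNode hmem
  have hkmax : r.i < P.kmax := hi.trans_le hrw.1.le_kmax
  simp only [code, hpc, if_pos hl]
  -- With shared slots one contribution goes to the head, and a debt of one contribution with `HRef`
  -- references to the predecessor's batch comes in, if there is a predecessor. With own slots only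
  -- the number of references to be granted in the end grows.
  obtain ⟨y, hy1, hy2, hy3, hy4, hy5, hy6, hy7, hy8⟩ : ∃ y : Account,
      y.inside = (g.thr t).inside ∧ y.todo = (g.thr t).todo ∧ y.rref = (g.thr t).rref ∧
      y.rtok = (if P.variant.single = true then (g.thr t).rtok else (g.thr t).rtok - 1) ∧
      y.rowe = (if P.variant.single = true then (g.thr t).rowe + 1 else (g.thr t).rowe) ∧
      y.skip = (g.thr t).skip ∧ y.rest = (if r.i + 1 < r.k then (g.thr t).rest.tail else []) ∧
      (y.frees = (g.thr t).frees ∧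
      if P.variant.single = true then y.ptok = 0 ∧ y.powe = 0 else
        match hd.hptr with
        | none => y.ptok = 0 ∧ y.powe = 0
        | some p => y.pref = (s.node p).nrefNode ∧ y.ptok = 1 ∧ y.powe = hd.href) := by
    obtain ⟨q, a, b, hq⟩ : ∃ (q : Addr) (a b : ℕ), if P.variant.single = true then a = 0 ∧ b = 0
        else match hd.hptr with
          | none => a = 0 ∧ b = 0
          | some p => q = (s.node p).nrefNode ∧ a = 1 ∧ b = hd.href := by
      split_ifs
      · exact ⟨0, 0, 0, rfl, rfl⟩
      · cases hd.hptr with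
        | none => exact ⟨0, 0, 0, rfl, rfl⟩
        | some p => exact ⟨_, _, _, rfl, rfl, rfl⟩
    exact ⟨⟨_, _, _, _, _, q, a, b, _, _, _⟩, rfl, rfl, rfl, rfl, rfl, rfl, rfl, rfl, hq⟩
  have hrest : (g.thr t).rest.tail.length + 1 = (g.thr t).rest.length ∧
      (g.thr t).rest = r.cur :: (g.thr t).rest.tail := by
    rw [CurrentOk, if_pos hi] at hcur
    obtain ⟨_, l, -, h, -⟩ := hcur
    simp [h]
  have hnd : (g.thr t).rest.Nodup := by
    rw [CurrentOk, if_pos hi] at hcur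
    obtain ⟨used, l, h1, -⟩ := hcur
    have halive := hI.alive t _ (Account.tok_rref hne)
    have := (hI.batch _ halive.1).nodup
    rw [h1] at this
    exact this.of_append_right
  have hytok : y.rtok = if P.variant.single = true then 1 else (r.k - (r.i + 1)) + y.skip := by
    have := hr.tok
    rw [hy4, hy6]
    split_ifs at this ⊢ <;> omega
  have hyowe : y.rowe = if P.variant.single = true then r.inserts + 1 else 0 := by
    have := hr.owe
    rw [hy5]
    split_ifs at this ⊢ <;> omega
  have htrack : Track s t g (g.insert s t y r.i r.cur) := by
    have hins : ∀ t', (s.thr t').slot = r.i → InsertCommit s t (s.thr t').slot := by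
      intro t' h
      exact ⟨r, h.symm, by rw [h, hl]; exact hpc⟩
    have key : ∀ t', Keeps s t t' (g.thr t') ((g.insert s t y r.i r.cur).thr t') ∧
        ((g.insert s t y r.i r.cur).thr t').frees = (g.thr t').frees := by
      intro t'
      have hz : (Function.update g.thr t y t').inside = (g.thr t').inside ∧
          (Function.update g.thr t y t').todo = (g.thr t').todo ∧
          (Function.update g.thr t y t').frees = (g.thr t').frees := by
        by_cases ht : t' = t
        · subst ht; simp [hy1, hy2, hy8.1]
        · simp [ht]
      simp only [Ghost.insert]
      split_ifs with h
      · refine ⟨⟨hz.1, Or.inr ⟨hz.1 ▸ h.1, hins t' h.2, r.cur, ?_⟩⟩, hz.2.2⟩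
        simp only [hz.2.1]
      · exact ⟨⟨hz.1, Or.inl hz.2.1⟩, hz.2.2⟩
    constructor
    · exact fun t' _ => key t'
    · exact fun _ _ _ => (key t).1
    all_goals simp [EnterCommit, LeaveCommit, hpc]
  refine ⟨_, hI.insert (t := t) hP hs hkmax hmem (hcount hne) (by rw [hl]; exact hhref)
    (by rw [hl]; exact hnext) hy1 hy2 (fun q => ?_) (fun q => ?_) (fun h => ⟨hne, hy3⟩)
    ⟨?_, ?_⟩ (fun a ha => ?_) (by rw [hl]; rfl) (by rfl) (by rfl) (fun t' ht => ?_) ?_ ?_ ?_,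
    htrack⟩
  · simp only [Account.tok, hl, hy3, hy4, headTok, hrefcur, h0, ite_self, add_zero]
    by_cases hsing : P.variant.single = true
    · simp only [hsing, if_true] at hy8 ⊢
      simp [hy8]
    · simp only [hsing] at hy8 ⊢
      cases hh : hd.hptr with
      | none =>
        simp only [hh] at hy8
        simp only [Bool.false_eq_true, if_false] at hy8 ⊢
        simp only [hy8, ite_self]
        split_ifs <;> omega
      | some p =>
        simp only [hh] at hy8
        simp only [Bool.false_eq_true, if_false] at hy8 ⊢
        simp only [hy8]
        split_ifs <;> omega
  · simp only [Account.owe, hl, hy3, hy5, headTok, hrefcur, hpowe, ite_self, add_zero]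
    by_cases hsing : P.variant.single = true
    · simp only [hsing, if_true] at hy8 ⊢
      simp only [hy8, ite_self, add_zero]
      split_ifs <;> omega
    · simp only [hsing] at hy8 ⊢
      cases hh : hd.hptr with
      | none =>
        simp only [hh] at hy8
        simp only [Bool.false_eq_true, if_false] at hy8 ⊢
        simp [hy8]
      | some p =>
        simp only [hh] at hy8
        simp only [Bool.false_eq_true, if_false] at hy8 ⊢
        simp [hy8]
  · rw [hyowe, hytok]
    by_cases hsing : P.variant.single = true
    · have h1 := hr.inserts_le hsing
      have h2 := hrw.2.1 hsing
      simp only [hsing, if_true, Params.grain]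
      omega
    · simp [hsing]
  · by_cases hsing : P.variant.single = true
    · simp only [hsing, if_true] at hy8
      simp [hy8]
    · cases hh : hd.hptr with
      | none =>
        simp only [hh, hsing] at hy8
        simp only [Bool.false_eq_true, if_false] at hy8
        simp [hy8]
      | some p =>
        simp only [hh, hsing] at hy8
        simp only [Bool.false_eq_true, if_false] at hy8
        have := hI.href_le r.i
        rw [hl] at this
        simpa [hy8, Params.grain, hsing] using this
  · rw [hy7] at ha
    split_ifs at ha with h
    · refine ⟨List.mem_of_mem_tail ha, ?_, ?_⟩
      · rintro rfl
        rw [hrest.2] at hnd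
        exact (List.nodup_cons.1 hnd).1 ha
      · rw [hytok]; split_ifs <;> omega
    · simp at ha
  · simp [State.goto, State.setThread, State.setHead, ht]
  · simp [State.goto, State.setThread, State.setHead]
  · simp [State.goto, State.setThread, Initializing]
  · rw [goto_thr_self]
    simp only [PcOk, Ghost.setThread_self]
    refine ⟨⟨hy1.trans hr.inside, hy3.trans hr.ref, hytok, hyowe,
      fun h => Nat.succ_le_succ (hr.inserts_le h), by rw [hy6]; exact hr.empty,
      by rw [hy6]; exact hr.doAdj, fun h => by rw [hy3]; exact hr.batch hne⟩, ?_, fun h => ?_,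
      fun p hsing hp => ?_, fun h => ?_⟩
    · rw [CurrentOk, if_pos hi] at hcur
      unfold CurrentUsed
      obtain ⟨used, l, k1, k2, k3⟩ := hcur
      rw [hy7]
      split_ifs with h
      · rw [hy3]
        refine ⟨used, by rw [← hrest.2]; exact k1, ?_⟩
        rw [k2, List.tail_cons]
        omega
      · rfl
    · rw [hy3]; exact hcount hne
    · simp only [hp, hsing] at hy8
      simp only [Bool.false_eq_true, if_false] at hy8
      obtain ⟨k1, k2⟩ := hI.head_live (i := r.i) (by rw [hl]; exact hp)
      rw [hy8.2.1]
      exact ⟨hy8.2.2.1, hy8.2.2.2, k2, k1⟩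
    · rcases h with h | h
      · simp only [h, if_true] at hy8
        exact hy8.2.1
      · simp only [h] at hy8
        split_ifs at hy8 <;> exact hy8.2.1

end

section

variable {s s' : State P} {g : Ghost P} {t : Fin P.threads}

theorem Inv.code (hP : P.Valid) (hs : s.WellFormed) (hI : Inv s g)
    (hne : (s.thr t).pc ≠ .idle) : Extends s (code P s t) t g := by
  rcases hpc : (s.thr t).pc
  case idle => exact absurd hpc hne
  case enterK => exact hI.code_search (Or.inl ⟨_, hpc⟩)
  case enterAck => exact hI.code_search (Or.inr (Or.inl ⟨_, _, _, hpc⟩))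
  case growDir => exact hI.code_search (Or.inr (Or.inr (Or.inl ⟨_, _, hpc⟩)))
  case growK => exact hI.code_search (Or.inr (Or.inr (Or.inr (Or.inl ⟨_, hpc⟩))))
  case enterLoad => exact hI.code_search (Or.inr (Or.inr (Or.inr (Or.inr ⟨_, hpc⟩))))
  case enterFAA => exact hI.code_enterFAA hP hs hpc
  case enterCAS => exact hI.code_enterCAS hs hpc
  case leaveLoad => exact hI.code_leaveLoad hpc
  case leaveNext => exact hI.code_leaveNext hpc
  case leaveCAS => exact hI.code_leaveCAS hs hpc
  case leaveSwap => exact hI.code_leaveSwap hP hs hpc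
  case adjLoad => exact hI.code_adjLoad hpc
  case adjFAA => exact hI.code_adjFAA hP hs hpc
  case freeLoad => exact hI.code_freeLoad hpc
  case freeNode => exact hI.code_freeNode hs hpc
  case travLoop => exact hI.code_travLoop hpc
  case travRef => exact hI.code_travRef hpc
  case travFAA => exact hI.code_travFAA hP hs hpc
  case travAck => exact hI.code_travAck hpc
  case retInit => exact hI.code_retInit hpc
  case retSlot => exact hI.code_retSlot hs hpc
  case retAccess => exact hI.code_retAccess hs hpc
  case retLink => exact hI.code_retLink hs hpc
  case retCAS => exact hI.code_retCAS hP hs hpc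
  case retAdvance => exact hI.code_retAdvance hs hpc
  case retAck => exact hI.code_retAck hpc
  case derefAccess => exact hI.code_deref (Or.inl ⟨_, hpc⟩)
  case derefNode => exact hI.code_deref (Or.inr (Or.inl ⟨_, _, hpc⟩))
  case derefEra => exact hI.code_deref (Or.inr (Or.inr (Or.inl ⟨_, _, _, hpc⟩)))
  case touchLoad => exact hI.code_deref (Or.inr (Or.inr (Or.inr (Or.inl ⟨_, _, hpc⟩))))
  case touchCAS => exact hI.code_deref (Or.inr (Or.inr (Or.inr (Or.inr ⟨_, _, _, hpc⟩))))
  case initTest => exact hI.code_init (Or.inl hpc)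
  case initFAA => exact hI.code_init (Or.inr (Or.inl hpc))
  case initBirth => exact hI.code_init (Or.inr (Or.inr hpc))

/-! ## Calls -/

theorem Inv.idle (hI : Inv s g) (hpc : (s.thr t).pc = .idle) : (g.thr t).Quiet ∧
    (g.thr t).inside = (s.thr t).active ∧ ((g.thr t).inside = false → (g.thr t).todo = []) := by
  simpa only [PcOk, hpc] using hI.pc t

theorem Track.of_idle (hpc : (s.thr t).pc = .idle) : Track s t g g := by
  refine Track.refl ?_ ?_ ?_ ?_ <;> simp [EnterCommit, LeaveCommit, hpc]

theorem Inv.call (hI : Inv s g) {pc : PC P.bits} (hidle : (s.thr t).pc = .idle)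
    (hini : ∀ a, ¬ Initializing pc a) (hpc : PcOk P s.node g t { s.thr t with pc := pc }) :
    Extends s (s.goto t pc) t g :=
  hI.extends_goto rfl rfl rfl rfl (fun a h => absurd h (hini a)) hpc
    (by simp [EnterCommit, hidle]) (by simp [LeaveCommit, hidle]) (by simp [hidle])
    (by simp [hidle])

/-- Steps that concern a node that was free. -/
theorem Inv.allocate (hI : Inv s g) {a : Addr} (hidle : (s.thr t).pc = .idle)
    (hfree : s.status a = .free) {pc : PC P.bits} (hheads : s'.heads = s.heads)
    (hnode : ∀ b, b ≠ a → s'.node b = s.node b ∧ s'.status b = s.status b)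
    (hthr : s'.thr = Function.update s.thr t { s.thr t with pc := pc })
    (hpc : pc = .idle ∨ pc = .initTest a ∧ s'.status a = .fresh) : Extends s s' t g := by
  have hold : ∀ t' b, Initializing (s.thr t').pc b → b ≠ a := by
    rintro t' b h rfl
    have := hI.fresh t' b h
    simp [hfree] at this
  have hini : ∀ t' b, Initializing (s'.thr t').pc b →
      (t' = t ∧ b = a ∧ s'.status a = .fresh) ∨ (t' ≠ t ∧ Initializing (s.thr t').pc b) := by
    intro t' b h
    rw [hthr] at h
    by_cases ht : t' = t
    · subst ht
      rw [Function.update_self] at h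
      rcases hpc with rfl | ⟨rfl, h'⟩
      · simp [Initializing] at h
      · have : a = b := by simpa [Initializing] using h
        exact Or.inl ⟨rfl, this.symm, h'⟩
    · rw [Function.update_of_ne ht] at h
      exact Or.inr ⟨ht, h⟩
  refine ⟨g, hI.unowned (t := t) hheads (fun b hb => ?_) (fun t' ht => by rw [hthr]; simp [ht])
    (by rw [hthr]; simp) (fun t' b h => ?_) (fun h => ?_), Track.of_idle hidle⟩
  · have : b ≠ a := by rintro rfl; simp [hfree] at hb
    exact ⟨(hnode b this).1, (hnode b this).2.trans hb⟩
  · rcases hini t' b h with ⟨rfl, rfl, h1⟩ | ⟨h1, h2⟩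
    · refine ⟨h1, fun t'' h' => ?_⟩
      rcases hini t'' b h' with ⟨h2, -⟩ | ⟨-, h2⟩
      · exact h2.symm
      · exact absurd rfl (hold _ _ h2)
    · have hb := hold _ _ h2
      refine ⟨(hnode b hb).2.trans (hI.fresh _ _ h2), fun t'' h' => ?_⟩
      rcases hini t'' b h' with ⟨-, h3, -⟩ | ⟨-, h3⟩
      · exact absurd h3 hb
      · exact hI.fresh_unique _ _ b h2 h3
  · have := hI.idle hidle
    rw [hthr, Function.update_self]
    rcases hpc with rfl | ⟨rfl, -⟩ <;> exact this

/-- There are two stages: linking changes only nodes outside all batches (`Inv.unowned`), and then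
the linked nodes become a batch named by its last node (`Inv.newBatch`). -/
theorem Inv.callRetire (hP : P.Valid) (hs : s.WellFormed) (hI : Inv s g) {l : List Addr}
    (hpc : (s.thr t).pc = .idle) (hact : (s.thr t).active = true)
    (hnodup : l.Nodup) (hlen : s.k < l.length) (hlive : ∀ a ∈ l, s.status a = .live) :
    Extends s ({ s with
      node := linkBatch P.bits s.k l s.node
      status := fun a => if a ∈ l then .retired else s.status a }.goto t
        (.retInit (startRetire s l))) t g := by
  obtain ⟨hq, hin, -⟩ := hI.idle hpc
  rw [hact] at hin
  set s₁ : State P := { s with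
    node := linkBatch P.bits s.k l s.node
    status := fun a => if a ∈ l then .retired else s.status a } with hs₁
  have hk : 0 < s.k := by
    obtain ⟨j, -, h⟩ := hs.slotCount
    have := hP.kmin_pos
    rw [h]; positivity
  have hl : l ≠ [] := by rintro rfl; simp at hlen
  have hI₁ : Inv s₁ g := by
    refine hI.unowned (t := t) rfl (fun a ha => ?_) (fun _ _ => rfl) ⟨rfl, rfl, rfl⟩
      (fun t' a h => ⟨?_, fun t'' h' => hI.fresh_unique _ _ a h h'⟩) id
    · have : a ∉ l := fun h => by simp [hlive a h] at ha
      simp [hs₁, linkBatch, this, ha]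
    · have hf := hI.fresh t' a h
      have : a ∉ l := fun h => by simp [hlive a h] at hf
      simp [hs₁, this, hf]
  have hlast : l.getLast? = some (l.getLastD 0) := by
    rw [List.getLastD_eq_getLast?]
    cases h : l.getLast? with
    | none => exact absurd (List.getLast?_eq_none_iff.1 h) hl
    | some a => rfl
  have hmem : l.getLastD 0 ∈ l := List.mem_of_getLast? hlast
  have hhead : l = l.headD 0 :: l.tail := by
    cases l with
    | nil => exact absurd rfl hl
    | cons a l => rfl
  -- A batch of this name would contain its counter node with status `retired`, but that node is
  -- live.
  have hempty : (g.batch (l.getLastD 0)).nodes = [] := by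
    by_contra h
    have hB := hI.batch _ h
    have := hB.retired _ (List.mem_of_getLast? hB.last)
    rw [hlive _ hmem] at this
    cases this
  have hlink : ∀ a ∈ l, s₁.node a = { s.node a with
      nrefNode := l.getLastD 0
      batchNext := l.getD ((l.idxOf a + 1) % l.length) 0
      adjs := adjsOf P.bits s.k } := fun a ha => by simp [hs₁, linkBatch, ha]
  have htotal : P.total s.k ≠ 0 := by
    unfold Params.total; split_ifs <;> omega
  refine ⟨_, hI₁.newBatch (t := t) (r := l.getLastD 0) (k := s.k) (l := l) (x :=
    { inside := (g.thr t).inside, todo := (g.thr t).todo, rref := l.getLastD 0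
      rtok := P.total s.k, rowe := 0, pref := 0, ptok := 0, powe := 0, skip := 0
      rest := l, frees := (g.thr t).frees }) hq hempty rfl rfl rfl rfl rfl rfl rfl
    (fun a ha => ⟨ha, htotal⟩) (fun t' a ha h => ?_) (by rfl) (by rfl) ?_ (by rfl)
    (fun t' ht => goto_thr_ne _ ht _) (by simp) (by simp [Initializing]) rfl ?_,
    Track.local (fun t' ht => ?_) ?_ ?_ ?_ ?_ ?_ ?_⟩
  · have := hI.todo_retired h
    simp [hlive a ha] at this
  · refine ⟨hlast, fun a ha => ?_, fun a ha => ?_, hnodup, hs.slotCount, fun h => ?_, ?_,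
      fun _ => ?_⟩
    · rw [hlink a ha]
    · simp only at ha
      simp [hs₁, ha]
    · exact hs.fixed fun h' => by simp [h', Variant.single] at h
    · rw [hlink _ hmem]
    · exact ring_of_getD hnodup fun a ha => by rw [hlink a ha]
  · rw [goto_thr_self]
    simp only [PcOk, Function.update_self]
    refine ⟨⟨hin, rfl, ?_, ?_, fun _ => le_rfl, fun _ => ?_, fun _ => ?_, fun _ => ?_⟩, ?_, trivial,
      htotal, trivial, trivial, trivial, trivial⟩
    · simp [Params.total, startRetire]
    · simp [startRetire]
    · simp [startRetire]
    · simp [startRetire]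
    · simp only [Function.update_self, startRetire, and_true]
      rw [hhead]; simp
    · rw [CurrentOk, if_pos (by simpa [startRetire] using hk)]
      refine ⟨[], l.tail, by simp, hhead, ?_⟩
      simp [startRetire]
      omega
  · simp [ht]
  · simp
  · simp
  all_goals simp [EnterCommit, LeaveCommit, hpc]

theorem Inv.step (hP : P.Valid) (hs : s.WellFormed) (hI : Inv s g) (h : Step P s t s') :
    Extends s s' t g := by
  cases h
  case run hpc => exact hI.code hP hs hpc
  case callEnter slot hpc hact hslot hown =>
    obtain ⟨h1, h2, h3⟩ := hI.idle hpc
    rw [hact] at h2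
    refine hI.call hpc ?_ ?_ <;> unfold enterPC <;> split_ifs
    all_goals first
      | exact ⟨h1, h2, h3 h2⟩
      | simp [Initializing]
  case callLeave hpc hact =>
    obtain ⟨h1, h2, h3⟩ := hI.idle hpc
    rw [hact] at h2
    refine hI.call hpc ?_ ?_ <;> split_ifs
    all_goals first
      | exact ⟨h1, h2⟩
      | simp [Initializing]
  case callDeref loc hrob hpc hact =>
    obtain ⟨h1, h2, h3⟩ := hI.idle hpc
    rw [hact] at h2
    exact hI.call hpc (by simp [Initializing]) ⟨h1, h2⟩
  case callRetire l hpc hact hnodup hlen hlive =>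
    exact hI.callRetire hP hs hpc hact hnodup hlen hlive
  case callInit a junk hrob hpc hfree =>
    refine hI.allocate (a := a) (pc := .initTest a) hpc hfree (by rfl) (fun b hb => ?_) (by rfl)
      (Or.inr ⟨rfl, ?_⟩)
    · simp [State.goto, State.setThread, State.setNode, hb]
    · simp [State.goto, State.setThread, State.setNode]
  case malloc a junk hrob hpc hfree =>
    refine hI.allocate (a := a) (pc := .idle) hpc hfree (by rfl) (fun b hb => ?_) ?_ (Or.inl rfl)
    · simp [State.setNode, hb]
    · rw [← hpc]; simp [State.setNode]
  case write f hpc =>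
    refine ⟨g, hI.of_pc (t := t) rfl rfl rfl (fun _ _ => rfl) (fun h => ?_) (fun a h => h)
      (hI.pc t), Track.of_idle hpc⟩
    exact ⟨(hI.path t h).1, rfl, rfl⟩

end

/-! ### The auxiliary state along an execution -/

theorem exists_inv_init (P : Params) : ∃ g, Inv (init P) g := by
  refine ⟨⟨fun _ => ⟨false, [], 0, 0, 0, 0, 0, 0, 0, [], []⟩, fun _ => ⟨[], 0, .counting, 0, 0, 0⟩⟩, ?_⟩
  constructor <;> simp [init, Account.tok, Ghost.Alive, PcOk, Account.Quiet, Initializing]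

/-- The auxiliary state in the course of an execution. -/
theorem Execution.exists_ghost (hP : P.Valid) {σ : ℕ → State P} {τ : ℕ → Fin P.threads}
    (hσ : Execution P σ τ) : ∃ γ : ℕ → Ghost P, ∀ i, Inv (σ i) (γ i) ∧
      Track (σ i) (τ i) (γ i) (γ (i + 1)) := by
  obtain ⟨g₀, h₀⟩ := exists_inv_init P
  rw [← hσ.start] at h₀
  choose! f hf using fun (i : ℕ) (g : Ghost P) (h : Inv (σ i) g) =>
    h.step hP (hσ.wellFormed hP i) (hσ.step i)
  let γ : ℕ → Ghost P := fun i => Nat.rec g₀ f i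
  have hγ : ∀ i, Inv (σ i) (γ i) := by
    intro i
    induction i with
    | zero => exact h₀
    | succ i ih => exact (hf i _ ih).1
  exact ⟨γ, fun i => ⟨hγ i, (hf i _ (hγ i)).2⟩⟩

/-! ### The bound on the number of visits -/

section

variable {s s' : State P} {g g' : Ghost P} {t : Fin P.threads}

theorem Step.enter_slot (h : Step P s t s') {slot : ℕ} (he : EnterCommit s t slot) :
    (s'.thr t).slot = slot := by
  cases h
  case run =>
    rcases he with he | he <;> simp only [code, he] <;> (try split_ifs) <;>
      simp [State.finishEnter, State.setThread, State.setHead]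
  all_goals simp_all [EnterCommit]

theorem resume_slot (s : State P) (c : Cont P.bits) :
    ((s.resume t c).thr t).slot = (s.thr t).slot := by
  cases c <;> simp only [State.resume, State.endTraverse] <;> (try split_ifs) <;>
    simp [State.goto, State.setThread, State.finishLeave]

theorem Step.slot_eq (h : Step P s t s') (he : ∀ slot, ¬ EnterCommit s t slot) :
    (s'.thr t).slot = (s.thr t).slot := by
  cases h
  case run =>
    rcases hpc : (s.thr t).pc <;> simp only [EnterCommit, hpc] at he <;> simp only [code, hpc]
    case travLoop next counter =>
      cases next <;> simp only [State.endTraverse] <;> (try split_ifs) <;>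
        simp [State.goto, State.setThread, State.finishLeave]
    all_goals
      (try split_ifs) <;> (try split) <;>
      simp_all [State.goto, State.setThread, State.setNode, State.setHead, State.skipSlot,
        State.addNRef, State.finishLeave, resume_slot]
  all_goals simp [State.goto, State.setThread, State.setNode]

theorem resume_active (s : State P) (c : Cont P.bits)
    (h : ((s.resume t c).thr t).pc ≠ .idle) :
    ((s.resume t c).thr t).active = (s.thr t).active := by
  revert h
  cases c <;> simp only [State.resume, State.endTraverse] <;> (try split_ifs) <;>
    simp [State.goto, State.setThread, State.finishLeave]

theorem Step.active_eq (h : Step P s t s') (hne : (s'.thr t).pc ≠ .idle) :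
    (s'.thr t).active = (s.thr t).active := by
  revert hne
  cases h
  case run =>
    rcases hpc : (s.thr t).pc <;> simp only [code, hpc]
    case travLoop next counter =>
      cases next <;> simp only [State.endTraverse] <;> (try split_ifs) <;>
        simp [State.goto, State.setThread, State.finishLeave]
    all_goals
      (try split_ifs) <;> (try split) <;> (try exact resume_active _ _) <;>
      simp_all [State.goto, State.setThread, State.setNode, State.setHead, State.skipSlot,
        State.addNRef, State.finishLeave, State.finishEnter]
  all_goals simp [State.goto, State.setThread, State.setNode]

theorem LeaveCommit.inside (hI : Inv s g) {slot : ℕ} (h : LeaveCommit s t slot) :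
    (g.thr t).inside = true := by
  have hp := hI.pc t
  rcases h with ⟨-, h | ⟨next, h⟩⟩ <;> simp only [PcOk, h] at hp
  · exact hp.2
  · exact hp.2.1

theorem EnterCommit.not_inside (hI : Inv s g) {slot : ℕ} (h : EnterCommit s t slot) :
    (g.thr t).inside = false := by
  have hp := hI.pc t
  rcases h with h | h <;> simp only [PcOk, h] at hp <;> exact hp.2.1

theorem EnterCommit.not_active (hs : s.WellFormed) {slot : ℕ} (h : EnterCommit s t slot) :
    (s.thr t).active = false := by
  have hp := hs.pc t
  rcases h with h | h <;> simp only [PcWellFormed, h] at hp <;> exact hp.1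

/-- A node that is being processed but still belongs to the list to be traversed. -/
def inHand {N : ℕ} : PC N → ℕ
  | .travRef _ _ _ => 1
  | .travFAA _ _ _ _ => 1
  | _ => 0

open Classical in
/-- A visit of `traverse` is paid for by a node that the thread has to traverse. -/
theorem Track.visit (hs : s.WellFormed) (hI : Inv s g) (hT : Track s t g g')
    (h : Step P s t s') (hact : (s.thr t).active = true) (hin : (g.thr t).inside = false)
    (hop : InOperation s t) : (g'.thr t).inside = false ∧
      (if TraverseVisit s t then 1 else 0) + ((g'.thr t).todo.length - inHand (s'.thr t).pc) ≤
        (g.thr t).todo.length - inHand (s.thr t).pc := by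
  have h1 : ∀ slot, ¬ EnterCommit s t slot := fun slot h => by
    simp [h.not_active hs] at hact
  have h2 : ∀ slot, ¬ LeaveCommit s t slot := fun slot h => by
    simp [h.inside hI] at hin
  have hp := hI.pc t
  -- The potential is the length of the list minus the node in hand. It drops at the visit in
  -- `travLoop`, when the node is taken in hand. At the fetch-and-add the node leaves the list and
  -- the hand together.
  by_cases hfaa : ∃ curr next ref n, (s.thr t).pc = .travFAA curr next ref n
  · obtain ⟨curr, next, ref, n, hpc⟩ := hfaa
    obtain ⟨k1, k2⟩ := hT.drop curr next ref n hpc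
    refine ⟨k1, ?_⟩
    simp [TraverseVisit, hpc, k2, inHand]
  push Not at hfaa
  obtain ⟨k1, k2⟩ := hT.keep h1 h2 hfaa
  have k2 : (g'.thr t).todo = (g.thr t).todo := by
    rcases k2 with k2 | ⟨k2, -⟩
    · exact k2
    · simp [hin] at k2
  refine ⟨k1.trans hin, ?_⟩
  rw [k2]
  cases h
  case run =>
    rcases hpc : (s.thr t).pc
    case travLoop next n =>
      simp only [PcOk, hpc] at hp
      cases next with
      | none => simp [TraverseVisit, hpc, inHand]
      | some c =>
        obtain ⟨l, hl, -⟩ := hp.2.2.of_some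
        simp [TraverseVisit, hpc, inHand, code, hl, add_comm]
    case travFAA => exact absurd hpc (hfaa _ _ _ _)
    case travRef curr next n =>
      simp [TraverseVisit, hpc, inHand, code]
    all_goals simp [TraverseVisit, hpc, inHand]
  all_goals contradiction

end

open Classical in
/-- Between `enter` and `leave`, the list of a thread grows by insertions only. -/
theorem counted_le_insertions {σ : ℕ → State P} {τ : ℕ → Fin P.threads}
    (hσ : Execution P σ τ) {γ : ℕ → Ghost P}
    (hγ : ∀ i, Inv (σ i) (γ i) ∧ Track (σ i) (τ i) (γ i) (γ (i + 1))) {t : Fin P.threads}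
    {slot i j : ℕ} (hij : i < j) (hi : τ i = t) (he : EnterCommit (σ i) t slot)
    (hno : ∀ q, i < q → q < j → τ q = t → ∀ slot', ¬ LeaveCommit (σ q) t slot') :
    (((γ j).thr t).counted P).length ≤
      ((Finset.Ioo i j).filter fun m => InsertCommit (σ m) (τ m) slot).card := by
  suffices h : ((γ j).thr t).inside = true ∧ ((σ j).thr t).slot = slot ∧
      (((γ j).thr t).counted P).length ≤
        ((Finset.Ioo i j).filter fun m => InsertCommit (σ m) (τ m) slot).card from h.2.2
  induction j, (hij : i + 1 ≤ j) using Nat.le_induction with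
  | base =>
    have hT := (hγ i).2
    have hstep := hσ.step i
    rw [hi] at hT hstep
    obtain ⟨h1, h2⟩ := hT.enter slot he
    exact ⟨h1, hstep.enter_slot he, by simp [h2]⟩
  | succ j hij' ih =>
    obtain ⟨h1, h2, h3⟩ := ih (fun q k1 k2 => hno q k1 (by omega))
    obtain ⟨hI, hT⟩ := hγ j
    have hstep := hσ.step j
    have hkeep : Keeps (σ j) (τ j) t ((γ j).thr t) ((γ (j + 1)).thr t) := by
      by_cases ht : τ j = t
      · rw [ht] at hT ⊢
        refine hT.keep (fun slot' h => ?_) (hno j (by omega) (by omega) ht) ?_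
        · simp [h.not_inside hI] at h1
        · intro curr next ref n h
          have hp := hI.pc t
          simp only [PcOk, h] at hp
          simp [hp.2.1] at h1
      · exact (hT.other t (Ne.symm ht)).1
    have hslot : ((σ (j + 1)).thr t).slot = slot := by
      by_cases ht : τ j = t
      · rw [ht] at hstep
        rw [hstep.slot_eq, h2]
        intro slot' h
        simp [h.not_inside hI] at h1
      · rw [hstep.thr_ne (Ne.symm ht), h2]
    obtain ⟨k1, k2⟩ := hkeep
    rw [h2] at k2
    refine ⟨k1.trans h1, hslot, ?_⟩
    have hIoo : Finset.Ioo i (j + 1) = insert j (Finset.Ioo i j) := by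
      ext m; simp; omega
    rw [hIoo, Finset.filter_insert]
    rcases k2 with k2 | ⟨-, k2, a, k3⟩
    · have e : ((γ (j + 1)).thr t).counted P = ((γ j).thr t).counted P := by
        simp only [Account.counted, k1, k2]
      rw [e]
      refine h3.trans (Finset.card_le_card ?_)
      split_ifs
      · exact Finset.subset_insert _ _
      · exact subset_rfl
    · rw [if_pos k2, Finset.card_insert_of_notMem (by simp)]
      -- With shared slots the counted part gains the former first node, or nothing if the list was
      -- empty; with own slots it gains the new node.
      have e : (((γ (j + 1)).thr t).counted P).length ≤ (((γ j).thr t).counted P).length + 1 := by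
        simp only [Account.counted, k1, k3]
        split_ifs
        · simp only [List.tail_cons, List.length_tail]; omega
        · simp
      omega

/-- `leave` turns the counted part of the list, which is bounded by the insertions, into the list of
the traversal. That list no longer grows, and each visit is paid for by one of its nodes. -/
theorem traverseBounded (hP : P.Valid) {σ : ℕ → State P} {τ : ℕ → Fin P.threads}
    (hσ : Execution P σ τ) : TraverseBounded σ τ := by
  classical
  intro t slot i j hij hi hj he hl hno
  obtain ⟨γ, hγ⟩ := hσ.exists_ghost hP
  have hbound := counted_le_insertions hσ hγ hij hi he hno
  set L := ((Finset.Ioo i j).filter fun m => InsertCommit (σ m) (τ m) slot).card with hL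
  obtain ⟨hIj, hTj⟩ := hγ j
  rw [hj] at hTj
  obtain ⟨l1, l2⟩ := hTj.leave slot hl
  have hactj := (hIj.path t (hl.inside hIj)).1
  have hopj : InOperation (σ j) t := by
    rcases hl with ⟨-, h | ⟨_, h⟩⟩ <;> simp [InOperation, h]
  set S := {q | j < q ∧ τ q = t ∧ TraverseVisit (σ q) t ∧
        ∀ r, j ≤ r → r < q → ¬ Completes σ τ t r} with hS
  have key : ∀ b, j + 1 ≤ b → ((∀ r, j ≤ r → r < b → ¬ Completes σ τ t r) →
      InOperation (σ b) t ∧ ((σ b).thr t).active = true ∧ ((γ b).thr t).inside = false ∧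
      ((Finset.Ioo j b).filter (· ∈ S)).card +
        (((γ b).thr t).todo.length - inHand ((σ b).thr t).pc) ≤ L) ∧
      ((Finset.Ioo j b).filter (· ∈ S)).card ≤ L := by
    intro b hb
    induction b, hb using Nat.le_induction with
    | base =>
      have hempty : Finset.Ioo j (j + 1) = ∅ := by
        ext m
        simp only [Finset.mem_Ioo, Finset.notMem_empty, iff_false]
        omega
      rw [hempty]
      refine ⟨fun h => ?_, by simp⟩
      have hop : InOperation (σ (j + 1)) t := by
        by_contra hc
        exact h j le_rfl (by omega) ⟨hj, hopj, hc⟩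
      have hstep := hσ.step j
      rw [hj] at hstep
      refine ⟨hop, (hstep.active_eq hop).trans hactj, l1, ?_⟩
      rw [l2]
      simp only [Finset.filter_empty, Finset.card_empty, zero_add]
      exact (Nat.sub_le _ _).trans hbound
    | succ b hb ih =>
      obtain ⟨ih1, ih2⟩ := ih
      have hIoo : Finset.Ioo j (b + 1) = insert b (Finset.Ioo j b) := by
        ext m; simp; omega
      by_cases hc : ∀ r, j ≤ r → r < b → ¬ Completes σ τ t r
      · obtain ⟨h1, h2, h3, h4⟩ := ih1 hc
        obtain ⟨hI, hT⟩ := hγ b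
        have hstep := hσ.step b
        by_cases ht : τ b = t
        · rw [ht] at hT hstep
          obtain ⟨v1, v2⟩ := hT.visit (hσ.wellFormed hP b) hI hstep h2 h3 h1
          have hcard : ((Finset.Ioo j (b + 1)).filter (· ∈ S)).card ≤
              ((Finset.Ioo j b).filter (· ∈ S)).card +
                if TraverseVisit (σ b) t then 1 else 0 := by
            rw [hIoo, Finset.filter_insert]
            split_ifs with k1 k2 k3
            · exact Finset.card_insert_le _ _
            · exact absurd k1.2.2.1 k2
            all_goals omega
          refine ⟨fun h => ?_, by omega⟩
          have hop : InOperation (σ (b + 1)) t := by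
            by_contra hcc
            exact h b (by omega) (by omega) ⟨ht, h1, hcc⟩
          refine ⟨hop, (hstep.active_eq hop).trans h2, v1, by omega⟩
        · have hnot : b ∉ S := fun h => ht h.2.1
          rw [hIoo, Finset.filter_insert, if_neg hnot]
          refine ⟨fun h => ?_, ih2⟩
          have e := hstep.thr_ne (Ne.symm ht)
          obtain ⟨⟨k1, k2⟩, -⟩ := hT.other t (Ne.symm ht)
          have k2 : ((γ (b + 1)).thr t).todo = ((γ b).thr t).todo := by
            rcases k2 with k2 | ⟨k2, -⟩
            · exact k2
            · simp [h3] at k2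
          rw [InOperation, e, k1, k2]
          exact ⟨h1, h2, h3, h4⟩
      · have hnot : b ∉ S := fun h => hc h.2.2.2
        rw [hIoo, Finset.filter_insert, if_neg hnot]
        exact ⟨fun h => absurd (fun r k1 k2 => h r k1 (by omega)) hc, ih2⟩
  by_contra hlt
  rw [not_le] at hlt
  -- If there were more than `L` visits, possibly infinitely many, `L + 1` of them would occur
  -- before some finite time.
  obtain ⟨u, hu, hcard⟩ := Set.exists_subset_encard_eq (Order.add_one_le_of_lt hlt)
  have hfin : u.Finite := Set.finite_of_encard_eq_coe (k := L + 1) (by rw [hcard]; push_cast; rfl)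
  obtain ⟨B, hB⟩ := hfin.bddAbove
  have hsub : hfin.toFinset ⊆ (Finset.Ioo j (B + j + 2)).filter (· ∈ S) := by
    intro q hq
    have hq' := hfin.mem_toFinset.1 hq
    have := hB hq'
    simp only [Finset.mem_filter, Finset.mem_Ioo]
    exact ⟨⟨(hu hq').1, by omega⟩, hu hq'⟩
  have h1 := Finset.card_le_card hsub
  have h2 := (key (B + j + 2) (by omega)).2
  rw [hfin.encard_eq_coe_toFinset_card] at hcard
  have h3 : hfin.toFinset.card = L + 1 := by exact_mod_cast hcard
  omega

/-! ## Commits of one operation -/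

/-- The number of modifications of heads and of the global era that a call may still make after
`adjust` or `free_batch`. -/
def Cont.commits {N : ℕ} : Cont N → ℕ
  | .slot r _ => r.k - (r.i + 1)
  | _ => 0

/-- The number of modifications of heads and of the global era that a call may still make before
it returns. -/
def PC.commits {N : ℕ} : PC N → ℕ
  | .leaveLoad | .leaveNext _ | .leaveCAS _ _ | .leaveSwap => 1
  | .adjLoad _ _ _ c | .adjFAA _ _ c | .freeLoad _ c | .freeNode _ _ c => c.commits
  | .retInit r | .retSlot r | .retAccess r _ | .retLink r _ | .retCAS r _ => r.k - r.i
  | .retAdvance r _ | .retAck r _ => r.k - (r.i + 1)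
  | .initTest _ | .initFAA _ => 1
  | _ => 0

/-- The rank of a call after `adjust` or `free_batch`, where `T` is the number of nodes to be
traversed. -/
def Cont.rank {N : ℕ} (T : ℕ) : Cont N → ℕ
  | .leave _ _ => 5 * T + 3
  | .trav _ _ _ => 5 * T + 3
  | .done => 0
  | .slot r _ => 16 * (r.k - (r.i + 1)) + 7

/-- The rank of a call in a time in which the heads and the number `K` of slots do not change. -/
def PC.rank {N : ℕ} (heads : ℕ → Head) (K slot T : ℕ) : PC N → ℕ
  -- An outdated value of a head ranks above the load to which its failing CAS returns. An
  -- up-to-date value ranks below it, because its CAS would be a commit, which is excluded.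
  | .enterLoad _ => 1
  | .enterCAS slot last => if heads slot = last then 0 else 2
  | .enterFAA _ => 1
  -- A search with the current `K` ranks below `enterK`. A search with an outdated number of slots
  -- ranks above it, since it may reach `growK`, fail there and start again once.
  | .enterK _ => 6 + K
  | .enterAck _ tries k => if k = K then 5 + (K - tries) else 9 + K + (k - tries)
  | .growDir _ k => if k = K then 4 else 8 + K
  | .growK k => if k = K then 3 else 7 + K
  | .leaveLoad => 2
  | .leaveNext hd => if heads slot = hd then 1 else 4
  | .leaveCAS hd _ => if heads slot = hd then 0 else 3
  | .adjLoad _ _ _ c => c.rank T + 4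
  | .adjFAA _ _ c => c.rank T + 3
  | .freeLoad _ c => c.rank T + 2
  | .freeNode _ _ c => c.rank T + 1
  -- Each node must pay for the three steps of its visit and, if its batch is freed, for
  -- `free_batch` up to `5 * (T - 1) + 5`, which is still below `5 * T + 1`; hence the factor 5.
  | .travLoop _ _ => 5 * T + 3
  | .travRef _ _ _ => 5 * T + 2
  | .travFAA _ _ _ _ => 5 * T + 1
  | .travAck _ => 2
  -- The factor 16 exceeds the largest offset 12, at `retAdvance`, which is followed by a whole
  -- adjustment before the next slot.
  | .retInit r => 16 * (r.k - r.i) + 9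
  | .retSlot r => 16 * (r.k - r.i) + 5
  | .retAccess r hd => 16 * (r.k - r.i) + if heads r.i = hd then 4 else 8
  | .retLink r hd => 16 * (r.k - r.i) + if heads r.i = hd then 3 else 7
  | .retCAS r hd => 16 * (r.k - r.i) + if heads r.i = hd then 2 else 6
  | .retAdvance r _ => 16 * (r.k - (r.i + 1)) + 12
  | .retAck r _ => 16 * (r.k - (r.i + 1)) + 6
  | .initTest _ => 3
  | .initFAA _ => 2
  | .initBirth _ => 1
  | _ => 0

/-- The number of nodes that `free_batch` has yet to free. -/
def PC.pending {N : ℕ} (F : ℕ) : PC N → ℕ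
  | .freeNode _ _ _ => F
  | _ => 0

/-- The number of nodes that a thread has to traverse after the modification of the head. -/
def Account.load (x : Account) : ℕ := if x.inside = true then 0 else x.todo.length

section

variable {s s' : State P} {g g' : Ghost P} {t : Fin P.threads}

theorem resume_commits (s : State P) (c : Cont P.bits) :
    ((s.resume t c).thr t).pc.commits ≤ c.commits := by
  cases c <;> simp only [State.resume, State.endTraverse] <;> (try split_ifs) <;>
    simp [State.goto, State.setThread, State.finishLeave, PC.commits, Cont.commits]

theorem resume_rank (s : State P) (c : Cont P.bits) (heads : ℕ → Head) (K slot T : ℕ) :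
    ((s.resume t c).thr t).pc.rank heads K slot T ≤ c.rank T := by
  cases c <;> simp only [State.resume, State.endTraverse] <;> (try split_ifs) <;>
    simp [State.goto, State.setThread, State.finishLeave, PC.rank, Cont.rank]

/-- `leave` commits once, `retire` at most once per remaining slot, and `init_node` advances the era
at most once. A commit of `enter` is also its return and is excluded by `hop'`, which is why `enter`
has budget `0`. -/
theorem Step.commits_le (hs : s.WellFormed) (h : Step P s t s') (hop : InOperation s t)
    (hop' : InOperation s' t) : (s'.thr t).pc.commits ≤ (s.thr t).pc.commits ∧
      ((∃ slot, HeadCommit s t slot) ∨ EraAdvance s t →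
        (s'.thr t).pc.commits < (s.thr t).pc.commits) := by
  have hw := hs.pc t
  revert hop'
  cases h
  case run =>
    rcases hpc : (s.thr t).pc <;> simp only [PcWellFormed, hpc] at hw <;>
      simp only [code, hpc, HeadCommit, EnterCommit, LeaveCommit, InsertCommit, EraAdvance,
        InOperation]
    case travLoop next counter =>
      cases next <;> simp only [State.endTraverse] <;> (try split_ifs) <;>
        simp [State.goto, State.setThread, State.finishLeave, PC.commits]
    case leaveCAS hd next =>
      have key : ∀ (s₀ : State P) (p : Ptr) (A : Prop),
          ((s₀.resume t (.leave p next)).thr t).pc.commits ≤ 1 ∧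
          (A → ((s₀.resume t (.leave p next)).thr t).pc.commits < 1) := fun s₀ p A => by
        have := resume_commits (t := t) s₀ (.leave p next)
        simp only [Cont.commits] at this
        exact ⟨by omega, fun _ => by omega⟩
      split_ifs with h1 h2
      · cases hd.hptr with
        | none => exact fun _ => key _ _ _
        | some c => simp [State.goto, State.setThread, PC.commits, Cont.commits]
      · cases hd.hptr <;> exact fun _ => key _ _ _
      · refine fun _ => ⟨by simp [PC.commits], ?_⟩
        rintro (⟨slot, h | ⟨rfl, h | ⟨next', h⟩⟩ | ⟨r, -, h⟩⟩ | ⟨a, h⟩)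
        · simp at h
        · simp at h
        · injection h with h2 h3
          exact absurd h2.symm h1
        · simp at h
        · simp at h
    case adjFAA ref v c =>
      split_ifs
      · simp [State.goto, State.setThread, PC.commits]
      · exact fun _ => ⟨resume_commits _ _, fun h => by simp at h⟩
    case freeNode first cur c =>
      split_ifs
      · simp [State.goto, State.setThread, PC.commits]
      · exact fun _ => ⟨resume_commits _ _, fun h => by simp at h⟩
    case travFAA curr next ref n =>
      split_ifs
      · simp [State.goto, State.setThread, PC.commits, Cont.commits]
      · exact fun _ => ⟨resume_commits (s.addNRef ref (-1)) (.trav curr next n),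
          fun h => by simp at h⟩
    case retAdvance r hd =>
      split_ifs
      · simp [State.goto, State.setThread, PC.commits]
      · cases hd.hptr with
        | none =>
          exact fun _ => ⟨resume_commits s
            (.slot { r with cur := (s.node r.cur).batchNext } hd.href), fun h => by simp at h⟩
        | some p => simp [State.goto, State.setThread, PC.commits, Cont.commits]
    all_goals
      (try split_ifs) <;>
      simp_all [State.goto, State.setThread, State.setNode, State.setHead, State.skipSlot,
        State.finishLeave, State.finishEnter, PC.commits, Cont.commits, enterPC]
    all_goals first
      | omega
      | exact Ne.symm ‹_›
      | (split_ifs <;> simp)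
  all_goals contradiction

theorem Keeps.load_eq {t' : Fin P.threads} {x x' : Account} (h : Keeps s t t' x x') :
    x'.load = x.load := by
  obtain ⟨h1, h2⟩ := h
  simp only [Account.load, h1]
  split_ifs with h
  · rfl
  · rcases h2 with h2 | ⟨h2, -⟩
    · rw [h2]
    · exact absurd h2 h

theorem Track.load_eq (hT : Track s t g g') (hcommit : ∀ slot, ¬ HeadCommit s t slot)
    (hfaa : ∀ curr next ref n, (s.thr t).pc ≠ .travFAA curr next ref n) :
    (g'.thr t).load = (g.thr t).load :=
  (hT.keep (fun slot h => hcommit slot (Or.inl h))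
    (fun slot h => hcommit slot (Or.inr (Or.inl h))) hfaa).load_eq

end

section

variable {s s' : State P} {g g' : Ghost P} {t : Fin P.threads}

theorem Inv.load_travFAA (hI : Inv s g) (hT : Track s t g g') {curr ref : Addr} {next : Ptr}
    {n : ℕ} (hpc : (s.thr t).pc = .travFAA curr next ref n) :
    (g.thr t).load = (g'.thr t).load + 1 := by
  obtain ⟨h1, h2⟩ := hT.drop curr next ref n hpc
  have hp := hI.pc t
  simp only [PcOk, hpc] at hp
  simp [Account.load, h1, h2, hp.2.1]

/-- In a time without modifications of the heads and of the number of slots, the steps of an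
operation other than `deref` decrease its rank. -/
theorem Step.rank_lt (hP : P.Valid) (hs : s.WellFormed) (hI : Inv s g) (hT : Track s t g g')
    (h : Step P s t s') (hop : InOperation s t) (hop' : InOperation s' t) (hder : ¬ InDeref s t)
    (hcommit : ∀ slot, ¬ HeadCommit s t slot) (hera : ¬ EraAdvance s t) (hk : s'.k = s.k) :
    (s'.thr t).pc.rank s.heads s.k (s'.thr t).slot (g'.thr t).load <
        (s.thr t).pc.rank s.heads s.k (s.thr t).slot (g.thr t).load ∨
      (s'.thr t).pc.rank s.heads s.k (s'.thr t).slot (g'.thr t).load ≤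
        (s.thr t).pc.rank s.heads s.k (s.thr t).slot (g.thr t).load ∧
      (s'.thr t).pc.pending (g'.thr t).frees.length <
        (s.thr t).pc.pending (g.thr t).frees.length := by
  have hw := hs.pc t
  have hslot : (s'.thr t).slot = (s.thr t).slot :=
    h.slot_eq fun slot h => hcommit slot (Or.inl h)
  rw [hslot]
  cases h
  case run =>
    by_cases hfree : ∃ first cur c, (s.thr t).pc = .freeNode first cur c
    · obtain ⟨first, cur, c, hpc⟩ := hfree
      have hload := hT.load_eq hcommit (by simp [hpc])
      have hF := hT.free first cur c hpc
      rw [hload]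
      simp only [code, hpc, PC.pending]
      split_ifs
      -- Freeing one node of many keeps the rank; the number of nodes still to be freed is the
      -- second component.
      · right
        simp [State.goto, State.setThread, PC.rank, hF]
      · left
        exact Nat.lt_succ_of_le (resume_rank _ _ _ _ _ _)
    push Not at hfree
    left
    by_cases hfaa : ∃ curr next ref n, (s.thr t).pc = .travFAA curr next ref n
    · obtain ⟨curr, next, ref, n, hpc⟩ := hfaa
      rw [hI.load_travFAA hT hpc]
      simp only [code, hpc]
      split_ifs
      · simp [State.goto, State.setThread, PC.rank, Cont.rank]
        omega
      · refine (resume_rank _ _ _ _ _ _).trans_lt ?_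
        simp only [Cont.rank, PC.rank]
        omega
    push Not at hfaa
    rw [hT.load_eq hcommit hfaa]
    generalize (g.thr t).load = T
    rcases hpc : (s.thr t).pc <;>
      simp only [InDeref, hpc] at hder <;>
      simp only [HeadCommit, EnterCommit, LeaveCommit, InsertCommit, hpc] at hcommit <;>
      simp only [EraAdvance, hpc] at hera <;> simp only [PcWellFormed, hpc] at hw <;>
      simp only [InOperation, code, hpc] at hop' <;> simp only [code, hpc] at hk <;>
      simp only [code, hpc]
    case travLoop next counter =>
      cases next <;> simp only [State.endTraverse] at hop' ⊢ <;> (try split_ifs at hop' ⊢) <;>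
        simp [State.goto, State.setThread, State.finishLeave, PC.rank] at hop' ⊢
    case enterAck slot tries k =>
      have hk' := hw.2.2.2.1
      simp only [enterPC]
      split_ifs <;> simp only [State.goto, State.setThread, Function.update_self, PC.rank] <;>
        split_ifs <;> omega
    case growK k =>
      -- A successful CAS on the number of slots would change `k`; the failing one shows that the
      -- number read was outdated.
      split_ifs at hk ⊢ with h
      · have : 0 < s.k := by
          obtain ⟨j, -, hj⟩ := hs.slotCount
          have := hP.kmin_pos
          rw [hj]; positivity
        simp [State.goto, State.setThread] at hk
        omega
      · simp only [State.goto, State.setThread, Function.update_self, PC.rank]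
        rw [if_neg (Ne.symm h)]
        omega
    case leaveCAS hd next =>
      have : s.heads (s.thr t).slot ≠ hd := fun h => by
        subst h
        exact hcommit _ (Or.inr (Or.inl ⟨rfl, Or.inr ⟨next, rfl⟩⟩))
      simp [this, State.goto, State.setThread, PC.rank]
    case retCAS r hd =>
      have : s.heads r.i ≠ hd := fun h => by
        subst h
        exact hcommit _ (Or.inr (Or.inr ⟨r, rfl, rfl⟩))
      simp [this, State.goto, State.setThread, PC.rank]
    case enterCAS slot hd =>
      have : s.heads slot ≠ hd := fun h => by
        subst h
        exact hcommit _ (Or.inl (Or.inr rfl))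
      simp [this, State.goto, State.setThread, PC.rank]
    case travFAA => exact absurd hpc (hfaa _ _ _ _)
    case freeNode => exact absurd hpc (hfree _ _ _)
    case adjFAA ref v c =>
      split_ifs
      · simp [State.goto, State.setThread, PC.rank]
      · have := resume_rank (t := t) (s.addNRef ref v) c s.heads s.k (s.thr t).slot T
        simp only [PC.rank] at *
        omega
    case retAdvance r hd =>
      split_ifs
      · simp [State.goto, State.setThread, PC.rank]
      · cases hd.hptr with
        | none =>
          refine (resume_rank _ _ _ _ _ _).trans_lt ?_
          simp [PC.rank, Cont.rank]
        | some p => simp [State.goto, State.setThread, PC.rank, Cont.rank]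
    all_goals
      (try split_ifs) <;>
      simp_all [State.goto, State.setThread, State.setNode, State.skipSlot,
        State.finishLeave, PC.rank, Cont.rank]
    all_goals first
      | omega
      | (split_ifs <;> omega)
  all_goals contradiction

end

/-! ### Lock-freedom -/

theorem HeadCommit.inOperation {s : State P} {t : Fin P.threads} {slot : ℕ}
    (h : HeadCommit s t slot) : InOperation s t := by
  rcases h with (h | h) | ⟨-, h | ⟨_, h⟩⟩ | ⟨_, -, h⟩ <;> simp [InOperation, h]

theorem EraAdvance.inOperation {s : State P} {t : Fin P.threads} (h : EraAdvance s t) :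
    InOperation s t := by
  obtain ⟨_, h⟩ := h
  simp [InOperation, h]

section

variable {σ : ℕ → State P} {τ : ℕ → Fin P.threads}

theorem InOperation.persists (hσ : Execution P σ τ) {t : Fin P.threads} {i j : ℕ} (hij : i ≤ j)
    (h : InOperation (σ i) t) (hc : ∀ r, i ≤ r → ¬ Completes σ τ t r) : InOperation (σ j) t := by
  induction j, hij using Nat.le_induction with
  | base => exact h
  | succ j hij ih =>
    by_cases ht : τ j = t
    · by_contra hcon
      exact hc j hij ⟨ht, ih, hcon⟩
    · rw [InOperation, (hσ.step j).thr_ne (Ne.symm ht)]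
      exact ih

/-- If no operation is completed any more, then the heads and the global era are modified finitely
often. -/
theorem eventually_no_commit (hP : P.Valid) (hσ : Execution P σ τ) {N : ℕ}
    (hN : ∀ t r, N ≤ r → ¬ Completes σ τ t r) :
    ∀ᶠ q in atTop, (∀ slot, ¬ HeadCommit (σ q) (τ q) slot) ∧ ¬ EraAdvance (σ q) (τ q) := by
  have key : ∀ t, ∀ᶠ q in atTop, ¬ (τ q = t ∧
      ((∃ slot, HeadCommit (σ q) t slot) ∨ EraAdvance (σ q) t)) := by
    intro t
    -- A thread found in an operation after `N` stays in this one call for ever, so its budget of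
    -- commits only shrinks. A thread never found in one makes no commits.
    by_cases hidle : ∃ i, N ≤ i ∧ InOperation (σ i) t
    · obtain ⟨i, hi, hop⟩ := hidle
      have hop' : ∀ q, i ≤ q → InOperation (σ q) t := fun q hq =>
        hop.persists hσ hq fun r hr => hN t r (hi.trans hr)
      have hmono : ∀ q, i ≤ q →
          ((σ (q + 1)).thr t).pc.commits ≤ ((σ q).thr t).pc.commits := by
        intro q hq
        by_cases ht : τ q = t
        · have hstep := hσ.step q
          rw [ht] at hstep
          exact (hstep.commits_le (hσ.wellFormed hP q) (hop' q hq) (hop' _ (by omega))).1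
        · rw [(hσ.step q).thr_ne (Ne.symm ht)]
      have := not_frequently_descending (f := fun q => ((σ q).thr t).pc.commits) hmono
      rw [not_frequently] at this
      filter_upwards [this, eventually_ge_atTop i] with q h1 hq
      rintro ⟨ht, h2⟩
      have hstep := hσ.step q
      rw [ht] at hstep
      exact h1 ((hstep.commits_le (hσ.wellFormed hP q) (hop' q hq) (hop' _ (by omega))).2 h2)
    · push Not at hidle
      filter_upwards [eventually_ge_atTop N] with q hq
      rintro ⟨-, h⟩
      refine hidle q hq ?_
      rcases h with ⟨slot, h⟩ | h
      · exact h.inOperation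
      · exact h.inOperation
  filter_upwards [eventually_all.2 key] with q hq
  have := hq (τ q)
  simp only [true_and, not_or, not_exists] at this
  exact this

/-- Without completions, heads, eras and the number of slots are eventually frozen. A thread that
runs on for ever in this frozen state would make the rank descend infinitely often. -/
theorem lockFree (hP : P.Valid) (hσ : Execution P σ τ) : LockFree σ τ := by
  intro hfreq
  by_contra hcon
  obtain ⟨N, hN⟩ := eventually_atTop.1 (not_frequently.1 hcon)
  have hN : ∀ t r, N ≤ r → ¬ Completes σ τ t r := fun t r hr h => hN r hr (h.1.symm ▸ h)
  -- By the pigeonhole principle: there are finitely many threads.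
  obtain ⟨t, ht⟩ : ∃ t, ∃ᶠ q in atTop, τ q = t ∧ InOperation (σ q) t := by
    by_contra h
    push Not at h
    exact hfreq ((eventually_all.2 h).mono fun q hq hop => hq (τ q) rfl hop)
  have hk : ∀ᶠ q in atTop, (σ (q + 1)).k = (σ q).k :=
    eventually_constant_of_le (f := fun q => (σ q).k) (M := 0) (b := P.kmax)
      (fun q _ => (hσ.step q).k_le) fun q _ => (hσ.wellFormed hP q).slotCount.le_kmax
  obtain ⟨M, hM⟩ := eventually_atTop.1
    ((eventually_no_commit hP hσ hN).and (hk.and (eventually_ge_atTop N)))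
  obtain ⟨M', hM', -, hop⟩ := frequently_atTop.1 ht M
  have hop : ∀ q, M' ≤ q → InOperation (σ q) t := fun q hq =>
    hop.persists hσ hq fun r hr => hN t r ((hM M' hM').2.2.trans hr)
  have hder : ∀ q, M' ≤ q → ¬ InDeref (σ q) t := by
    intro q hq hd
    -- The era no longer advances, so a `deref` of this thread would return.
    obtain ⟨j, hj, hc⟩ := derefTerminates hP hσ t q hd (ht.mono fun _ h => h.1)
      fun m hm _ => (hM m (by omega)).1.2
    exact hN t j ((hM j (by omega)).2.2) hc
  have hheads : ∀ q, M' ≤ q → (σ (q + 1)).heads = (σ q).heads := by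
    intro q hq
    funext slot
    by_contra h
    exact (hM q (by omega)).1.1 slot ((hσ.step q).heads_change h)
  obtain ⟨γ, hγ⟩ := hσ.exists_ghost hP
  -- Steps of other threads leave both components unchanged: heads and slots are frozen, and the
  -- thread's account changes at most by insertions while it is inside, which `load` ignores.
  let f : ℕ → ℕ ×ₗ ℕ := fun q => toLex
    (((σ q).thr t).pc.rank (σ q).heads (σ q).k ((σ q).thr t).slot ((γ q).thr t).load,
      ((σ q).thr t).pc.pending ((γ q).thr t).frees.length)
  have hown : ∀ q, M' ≤ q → τ q = t → f (q + 1) < f q := by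
    intro q hq hqt
    have hstep := hσ.step q
    obtain ⟨hI, hT⟩ := hγ q
    obtain ⟨⟨hc, he⟩, hkq, -⟩ := hM q (by omega)
    rw [hqt] at hstep hT hc he
    have := hstep.rank_lt hP (hσ.wellFormed hP q) hI hT (hop q hq) (hop _ (by omega))
      (hder q hq) hc he hkq
    simp only [f, Prod.Lex.toLex_lt_toLex, hheads q hq, hkq]
    rcases this with h | ⟨h1, h2⟩
    · exact Or.inl h
    · rcases h1.lt_or_eq with h1 | h1
      · exact Or.inl h1
      · exact Or.inr ⟨h1, h2⟩
  refine not_frequently_descending (f := f) (M := M') (fun q hq => ?_)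
    ((ht.and_eventually (eventually_ge_atTop M')).mono fun q h => hown q h.2 h.1.1)
  by_cases hqt : τ q = t
  · exact (hown q hq hqt).le
  · obtain ⟨h1, h2⟩ := (hγ q).2.other t (Ne.symm hqt)
    obtain ⟨-, hkq, -⟩ := hM q (by omega)
    refine le_of_eq ?_
    simp only [f, hheads q hq, hkq, (hσ.step q).thr_ne (Ne.symm hqt), h1.load_eq, h2]

end

end Hyaline

theorem theorem2 (P : Hyaline.Params) (hP : P.Valid)
    (σ : ℕ → Hyaline.State P) (τ : ℕ → Fin P.threads) (hσ : Hyaline.Execution P σ τ) :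
    Hyaline.LockFree σ τ ∧
    Hyaline.FailureImpliesProgress σ τ
      Hyaline.HeadFail Hyaline.HeadLoad Hyaline.HeadCommit ∧
    Hyaline.FailureImpliesProgress σ τ
      Hyaline.TouchFail Hyaline.TouchLoad Hyaline.TouchCommit ∧
    Hyaline.TraverseBounded σ τ ∧
    Hyaline.DerefRepeatImpliesAdvance σ τ ∧
    Hyaline.DerefTerminates σ τ := by
  exact ⟨Hyaline.lockFree hP hσ, Hyaline.headFail_progress hσ, Hyaline.touchFail_progress hσ,
    Hyaline.traverseBounded hP hσ, Hyaline.derefRepeatImpliesAdvance hP hσ,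
    Hyaline.derefTerminates hP hσ⟩
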